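/- **Conventions.** Let $(M,c)$ be a smooth manifold of dimension $n\ge 3$ with a conformal structure of arbitrary signature, and let $g\in c$ be a metric from the conformal class, which also trivialises all density bundles; indices are raised and lowered with $g$, and round (square) brackets denote (skew-)symmetrisation with the factor $1/k!$. Let $\nabla$ be the Levi-Civita connection, $[\nabla_a,\nabla_b]v^c=R_{ab}{}^c{}_dv^d$, $\mathrm{Ric}_{ab}=R_{ca}{}^c{}_b=(n-2)P_{ab}+Jg_{ab}$ with $J=P_a{}^a$, $R_{abcd}=C_{abcd}+2g_{c[a}P_{b]d}+2g_{d[b}P_{a]c}$ (so $C$ is the Weyl tensor), $A_{abc}=2\nabla_{[a}P_{b]c}$ (the Cotton tensor) and $B_{ab}=\nabla^pA_{pab}+P^{pq}C_{paqb}$ (the Bach tensor if $n=4$). The standard tractor bundle $\mathcal E^A$ has, in the scale $g$, sections $(\alpha,\mu_a,\tau)\in\mathcal E[1]\oplus\mathcal E_a[1]\oplus\mathcal E[-1]$; for $\hat g=e^{2\Upsilon}g$ and $\Upsilon_a=\nabla_a\Upsilon$ the triples are identified by $\hat\alpha=\alpha$, $\hat\mu_a=\mu_a+\Upsilon_a\alpha$,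 $\hat\tau=\tau-\Upsilon^b\mu_b-\tfrac12\Upsilon_c\Upsilon^c\alpha$. It carries the metric $h_{AB}V^AV^B=2\alpha\tau+\mu_a\mu^a$, used to raise and lower tractor indices, and the normal connection $\nabla_a(\alpha,\mu_b,\tau)=(\nabla_a\alpha-\mu_a,\ \nabla_a\mu_b+g_{ab}\tau+P_{ab}\alpha,\ \nabla_a\tau-P_{ab}\mu^b)$, extended to all tractor tensors by the Leibniz rule. Let $X_A,Z_A{}^a,Y_A$ be defined by $X_AV^A=\alpha$, $Z_A{}^aV^A=\mu^a$, $Y_AV^A=\tau$. Let $V$ be the bundle $\mathcal E_{(BC)_0}$ of symmetric trace-free covariant $2$-tractors, filtered by giving $Y,Z,X$ the degrees $-1,0,1$: $V^i$ consists of the tractors whose components of degree $<i$ vanish. (The statement holds equally for the bundle $\mathcal E_{(BC)}$ of all symmetric $2$-tractors.) For a $V$-valued $2$-form $\psi_{ab}$ the Kostant codifferential is $(\partial^*\psi)_b=\gamma^a\sharp\psi_{ab}$, where $\gamma^a{}_{EF}=-2X_{[E}Z_{F]}{}^a$ and $\sharp$ is the tensorial action determined by $(\gamma\sharp f)_C=-\gamma^P{}_Cf_P$.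 A prolongation connection on $V$ is a connection $\tilde\nabla=\nabla+\Phi$, with $\Phi$ a smooth $1$-form with values in $\mathrm{End}\,V$, such that (i) $\Phi$ is homogeneous of degree $\ge1$, i.e. $\Phi_a(V^i)\subseteq V^i$ for all $i$; (ii) $\Phi\in\mathrm{im}(\partial^*\otimes\mathrm{id}_{V^*})$, i.e. for every $F\in V$ the $V$-valued $1$-form $\Phi F$ is $\partial^*$ of a $V$-valued $2$-form; (iii) the curvature $\tilde\Omega$ of $\tilde\nabla$ satisfies $(\partial^*\otimes\mathrm{id}_{V^*})(\tilde\Omega)=0$. **Proposition 4.4.** Over every coordinate domain of $M$ and for every scale $g\in c$, a connection $\tilde\nabla=\nabla+\Phi$ on $\mathcal E_{(BC)_0}$ is the prolongation connection if and only if $$\tilde\nabla_aF_{BC}=\nabla_aF_{BC}+\tfrac23\tilde\Psi_{aBC}{}^{PQ}F_{PQ}\quad\text{for all smooth sections }F,$$ where $$\begin{aligned}\tilde\Psi_{aBC}{}^{PQ}={}&-Z_{(B}{}^bZ_{C)}{}^c\Big[X^{(P}Z^{Q)q}C_{a(bc)q}+X^PX^QA_{a(bc)}\Big]\\ &+X_{(B}Z_{C)}{}^c\Big[-\tfrac4nZ^{p(P}Z^{Q)q}C_{a(pq)c}+2X^{(P}Z^{Q)q}\big(A_{a(cq)}+\tfrac{n-4}{n}A_{q(ac)}\big)-\tfrac1nX^PX^QB_{ac}\Big]\\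 &+X_BX_C\Big[-\tfrac4nZ^{p(P}Z^{Q)q}A_{a(pq)}+\tfrac1nX^{(P}Z^{Q)q}\big(B_{aq}+\tfrac{4}{3(n-1)}C_a{}^{(rs)p}C_{qrsp}\big)+\tfrac{4}{3n(n-1)}X^PX^QC_a{}^{(rs)p}A_{prs}\Big].\end{aligned}$$ -/

import Mathlib

open scoped Manifold ContDiff

noncomputable section

namespace ConformalProlongation

/-! ## Tensor calculus in coordinates

`g` is the matrix of components of a pseudo-Riemannian metric on an open set of coordinate space;
`g y a b` is `g_{ab}` and `(g y)⁻¹ a b` is `g^{ab}`. All tensors below are given by components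
with the indices in the order in which they are usually written. -/

/-- Coordinate space. -/
abbrev Coord (n : ℕ) : Type := EuclideanSpace ℝ (Fin n)

/-- The matrix of components of a metric, as a function of the coordinates. -/
abbrev MetricMatrix (n : ℕ) : Type := Coord n → Matrix (Fin n) (Fin n) ℝ

section Coordinates

variable {n : ℕ}

/-- Partial derivative `∂_a f` at `y`. -/
def pd (a : Fin n) (f : Coord n → ℝ) (y : Coord n) : ℝ :=
  fderiv ℝ f y (EuclideanSpace.single a 1)

variable (g : MetricMatrix n)

/-- Christoffel symbols `Γ^c_{ab}` of the Levi-Civita connection. -/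
def christoffel (y : Coord n) (c a b : Fin n) : ℝ :=
  (1 / 2) * ∑ e, (g y)⁻¹ c e *
    (pd a (fun z => g z e b) y + pd b (fun z => g z e a) y - pd e (fun z => g z a b) y)

/-- The curvature `R_{ab}{}^c{}_d`, with `[∇_a, ∇_b] v^c = R_{ab}{}^c{}_d v^d`. -/
def riemannUp (y : Coord n) (a b c d : Fin n) : ℝ :=
  pd a (fun z => christoffel g z c b d) y - pd b (fun z => christoffel g z c a d) y
    + ∑ e, (christoffel g y c a e * christoffel g y e b d
      - christoffel g y c b e * christoffel g y e a d)

/-- `R_{abcd} = g_{ce} R_{ab}{}^e{}_d`. -/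
def riemann (y : Coord n) (a b c d : Fin n) : ℝ :=
  ∑ e, g y c e * riemannUp g y a b e d

/-- `Ric_{ab} = R_{ca}{}^c{}_b`. -/
def ricci (y : Coord n) (a b : Fin n) : ℝ :=
  ∑ c, riemannUp g y c a c b

/-- The trace `J` of the Schouten tensor, i.e. the scalar curvature divided by `2 (n - 1)`. -/
def schoutenTrace (y : Coord n) : ℝ :=
  (∑ a, ∑ b, (g y)⁻¹ a b * ricci g y a b) / (2 * ((n : ℝ) - 1))

/-- The Schouten tensor `P_{ab}`, with `Ric_{ab} = (n - 2) P_{ab} + J g_{ab}`. -/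
def schouten (y : Coord n) (a b : Fin n) : ℝ :=
  (ricci g y a b - schoutenTrace g y * g y a b) / ((n : ℝ) - 2)

/-- The Weyl tensor `C_{abcd}`, with
`R_{abcd} = C_{abcd} + 2 g_{c[a} P_{b]d} + 2 g_{d[b} P_{a]c}`. -/
def weyl (y : Coord n) (a b c d : Fin n) : ℝ :=
  riemann g y a b c d
    - (g y c a * schouten g y b d - g y c b * schouten g y a d)
    - (g y d b * schouten g y a c - g y d a * schouten g y b c)

/-- Covariant derivative `∇_a T_{bc}`. -/
def nabla₂ (T : Coord n → Fin n → Fin n → ℝ) (y : Coord n) (a b c : Fin n) : ℝ :=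
  pd a (fun z => T z b c) y
    - ∑ e, christoffel g y e a b * T y e c - ∑ e, christoffel g y e a c * T y b e

/-- Covariant derivative `∇_a T_{bcd}`. -/
def nabla₃ (T : Coord n → Fin n → Fin n → Fin n → ℝ) (y : Coord n) (a b c d : Fin n) : ℝ :=
  pd a (fun z => T z b c d) y
    - ∑ e, christoffel g y e a b * T y e c d - ∑ e, christoffel g y e a c * T y b e d
    - ∑ e, christoffel g y e a d * T y b c e

/-- The Cotton tensor `A_{abc} = 2 ∇_{[a} P_{b]c}`. -/
def cotton (y : Coord n) (a b c : Fin n) : ℝ :=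
  nabla₂ g (schouten g) y a b c - nabla₂ g (schouten g) y b a c

/-- `B_{ab} = ∇^p A_{pab} + P^{pq} C_{paqb}`; the Bach tensor when `n = 4`. -/
def bach (y : Coord n) (a b : Fin n) : ℝ :=
  (∑ p, ∑ q, (g y)⁻¹ p q * nabla₃ g (cotton g) y q p a b)
    + ∑ p, ∑ q, ∑ r, ∑ s, (g y)⁻¹ p r * (g y)⁻¹ q s * schouten g y r s * weyl g y p a q b

/-- `C_{a(bc)d}`. -/
def weylSym (y : Coord n) (a b c d : Fin n) : ℝ :=
  (weyl g y a b c d + weyl g y a c b d) / 2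

/-- `A_{a(bc)}`. -/
def cottonSym (y : Coord n) (a b c : Fin n) : ℝ :=
  (cotton g y a b c + cotton g y a c b) / 2

/-- `C_a{}^{(rs)p} C_{qrsp}`. -/
def weylWeyl (y : Coord n) (a q : Fin n) : ℝ :=
  ∑ r, ∑ s, ∑ p, ∑ r', ∑ s', ∑ p',
    (g y)⁻¹ r r' * (g y)⁻¹ s s' * (g y)⁻¹ p p' * weylSym g y a r' s' p' * weyl g y q r s p

/-- `C_a{}^{(rs)p} A_{prs}`. -/
def weylCotton (y : Coord n) (a : Fin n) : ℝ :=
  ∑ r, ∑ s, ∑ p, ∑ r', ∑ s', ∑ p',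
    (g y)⁻¹ r r' * (g y)⁻¹ s s' * (g y)⁻¹ p p' * weylSym g y a r' s' p' * cotton g y p r s

/-! ## Tractor calculus in a scale and a coordinate system

A covariant tractor is written `F_B = Y_B σ + Z_B{}^b μ_b + X_B ν`; its components `σ, μ_b, ν` are
indexed by the slots `slotY`, `slotZ b`, `slotX`. -/

/-- Tractor indices: the slots of `Y`, of `Z^b` and of `X`. -/
abbrev TIdx (n : ℕ) : Type := Unit ⊕ (Fin n ⊕ Unit)

/-- The slot of the injector `Y_B`. -/
abbrev slotY : TIdx n := Sum.inl ()

/-- The slot of the injector `Z_B{}^b`. -/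
abbrev slotZ (b : Fin n) : TIdx n := Sum.inr (Sum.inl b)

/-- The slot of the injector `X_B`. -/
abbrev slotX : TIdx n := Sum.inr (Sum.inr ())

/-- Components `F_{BC}` of a covariant 2-tractor at a point. -/
abbrev Tractor₂ (n : ℕ) : Type := TIdx n → TIdx n → ℝ

/-- The injector `X_B`. -/
def Xlow (B : TIdx n) : ℝ := if B = slotX then 1 else 0

/-- The injector `Z_B{}^b`. -/
def Zlow (b : Fin n) (B : TIdx n) : ℝ := if B = slotZ b then 1 else 0

/-- The inverse tractor metric `h^{BC}`. -/
def hUp (G : Matrix (Fin n) (Fin n) ℝ) : TIdx n → TIdx n → ℝ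
  | Sum.inl _, Sum.inr (Sum.inr _) => 1
  | Sum.inr (Sum.inr _), Sum.inl _ => 1
  | Sum.inr (Sum.inl a), Sum.inr (Sum.inl b) => G⁻¹ a b
  | _, _ => 0

/-- `X^P = h^{PQ} X_Q`. -/
def Xup (G : Matrix (Fin n) (Fin n) ℝ) (P : TIdx n) : ℝ := ∑ Q, hUp G P Q * Xlow Q

/-- `Z^{Pq} = h^{PQ} Z_Q{}^q`. -/
def Zup (G : Matrix (Fin n) (Fin n) ℝ) (q : Fin n) (P : TIdx n) : ℝ :=
  ∑ Q, hUp G P Q * Zlow q Q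

/-- The symmetrised product `u_{(B} v_{C)}`. -/
def sym (u v : TIdx n → ℝ) (B C : TIdx n) : ℝ := (u B * v C + u C * v B) / 2

/-- The connection form of the normal tractor connection on covariant tractors,
`∇_a (σ, μ_b, ν) =
  (∂_a σ - μ_a, ∂_a μ_b - Γ^c_{ab} μ_c + g_{ab} ν + P_{ab} σ, ∂_a ν - P_a{}^b μ_b)`. -/
def tractorForm (y : Coord n) (a : Fin n) : TIdx n → TIdx n → ℝ
  | Sum.inl _, Sum.inr (Sum.inl b) => if b = a then -1 else 0
  | Sum.inr (Sum.inl b), Sum.inl _ => schouten g y a b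
  | Sum.inr (Sum.inl b), Sum.inr (Sum.inl c) => -christoffel g y c a b
  | Sum.inr (Sum.inl b), Sum.inr (Sum.inr _) => g y a b
  | Sum.inr (Sum.inr _), Sum.inr (Sum.inl b) => -∑ c, (g y)⁻¹ b c * schouten g y a c
  | _, _ => 0

/-- The normal tractor connection `∇_a F_{BC}`. -/
def tractorNabla (a : Fin n) (F : Coord n → Tractor₂ n) (y : Coord n) : Tractor₂ n :=
  fun B C => pd a (fun z => F z B C) y
    + ∑ D, tractorForm g y a B D * F y D C + ∑ D, tractorForm g y a C D * F y B D

/-- `Ψ̃_{aBC}{}^{PQ}`. -/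
def psi (y : Coord n) (a : Fin n) (B C P Q : TIdx n) : ℝ :=
  -(∑ b, ∑ c, sym (Zlow b) (Zlow c) B C *
      ((∑ q, sym (Xup (g y)) (Zup (g y) q) P Q * weylSym g y a b c q)
        + Xup (g y) P * Xup (g y) Q * cottonSym g y a b c))
  + ∑ c, sym Xlow (Zlow c) B C *
      (-(4 / (n : ℝ)) * (∑ p, ∑ q, sym (Zup (g y) p) (Zup (g y) q) P Q * weylSym g y a p q c)
        + 2 * (∑ q, sym (Xup (g y)) (Zup (g y) q) P Q *
            (cottonSym g y a c q + (((n : ℝ) - 4) / n) * cottonSym g y q a c))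
        - (1 / (n : ℝ)) * (Xup (g y) P * Xup (g y) Q * bach g y a c))
  + Xlow B * Xlow C *
      (-(4 / (n : ℝ)) * (∑ p, ∑ q, sym (Zup (g y) p) (Zup (g y) q) P Q * cottonSym g y a p q)
        + (1 / (n : ℝ)) * (∑ q, sym (Xup (g y)) (Zup (g y) q) P Q *
            (bach g y a q + (4 / (3 * ((n : ℝ) - 1))) * weylWeyl g y a q))
        + (4 / (3 * (n : ℝ) * ((n : ℝ) - 1))) * (Xup (g y) P * Xup (g y) Q * weylCotton g y a))

/-- `Ψ̃_{aBC}{}^{PQ} F_{PQ}`. -/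
def psiAct (y : Coord n) (a : Fin n) (F : Tractor₂ n) : Tractor₂ n :=
  fun B C => ∑ P, ∑ Q, psi g y a B C P Q * F P Q

/-- The tensorial action `γ ♯ F` of an adjoint tractor `γ_{EF}` on 2-tractors, the extension by the
Leibniz rule of `(γ ♯ F)_C = - γ^P{}_C F_P`. -/
def sharp (G : Matrix (Fin n) (Fin n) ℝ) (γ : TIdx n → TIdx n → ℝ) (F : Tractor₂ n) :
    Tractor₂ n :=
  fun B C => -(∑ P, (∑ E, hUp G P E * γ E B) * F P C) - ∑ P, (∑ E, hUp G P E * γ E C) * F B P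

/-- The inclusion of `T^*M` into the adjoint tractor bundle, `-2 X_{[E} Z_{F]}{}^a`. -/
def iota (a : Fin n) (E F : TIdx n) : ℝ := -(Xlow E * Zlow a F - Xlow F * Zlow a E)

/-- The Kostant codifferential on tractor-valued 2-forms, `(∂^* ψ)_b = -2 X_{[E} Z_{F]}{}^a ♯ ψ_{ab}`. -/
def codiff (G : Matrix (Fin n) (Fin n) ℝ) (ψ : Fin n → Fin n → Tractor₂ n) (b : Fin n) :
    Tractor₂ n :=
  ∑ a, sharp G (iota a) (ψ a b)

/-- The symmetric 2-tractors `E_{(BC)}` at a point. -/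
def symTractors (_G : Matrix (Fin n) (Fin n) ℝ) : Submodule ℝ (Tractor₂ n) where
  carrier := {F | ∀ B C, F B C = F C B}
  add_mem' := fun hF hF' B C => by simp [hF B C, hF' B C]
  zero_mem' := fun _ _ => rfl
  smul_mem' := fun r F hF B C => by simp [hF B C]

/-- The trace-free symmetric 2-tractors `E_{(BC)_0}` at a point. -/
def traceFreeSymTractors (G : Matrix (Fin n) (Fin n) ℝ) : Submodule ℝ (Tractor₂ n) where
  carrier := {F | (∀ B C, F B C = F C B) ∧ ∑ B, ∑ C, hUp G B C * F B C = 0}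
  add_mem' := fun hF hF' => ⟨fun B C => by simp [hF.1 B C, hF'.1 B C], by
    simp only [Pi.add_apply, mul_add, Finset.sum_add_distrib, hF.2, hF'.2, add_zero]⟩
  zero_mem' := ⟨fun _ _ => rfl, by simp⟩
  smul_mem' := fun r F hF => ⟨fun B C => by simp [hF.1 B C], by
    have h : ∑ B, ∑ C, hUp G B C * (r • F) B C = r * ∑ B, ∑ C, hUp G B C * F B C := by
      simp only [Finset.mul_sum, Pi.smul_apply, smul_eq_mul]
      exact Finset.sum_congr rfl fun B _ => Finset.sum_congr rfl fun C _ => by ring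
    rw [h, hF.2, mul_zero]⟩

/-- Degrees of the slots in the grading of the standard tractor bundle. -/
def slotDegree : TIdx n → ℤ
  | Sum.inl _ => -1
  | Sum.inr (Sum.inl _) => 0
  | Sum.inr (Sum.inr _) => 1

/-- `F` lies in the `i`-th filtration component: its components of degree `< i` vanish. -/
def InFiltration (i : ℤ) (F : Tractor₂ n) : Prop :=
  ∀ B C, slotDegree B + slotDegree C < i → F B C = 0

/-- Components of a 1-form with values in endomorphisms of 2-tractors. -/
abbrev EndForm (n : ℕ) : Type := Fin n → Coord n → (Tractor₂ n →ₗ[ℝ] Tractor₂ n)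

/-- The connection `∇ + Φ`. -/
def modNabla (φ : EndForm n) (a : Fin n) (F : Coord n → Tractor₂ n) (y : Coord n) : Tractor₂ n :=
  tractorNabla g a F y + φ a y (F y)

/-- The curvature `(∇̃_a ∇̃_b - ∇̃_b ∇̃_a) F` of `∇̃ = ∇ + Φ`. -/
def modCurvature (φ : EndForm n) (F : Coord n → Tractor₂ n) (y : Coord n) (a b : Fin n) :
    Tractor₂ n :=
  modNabla g φ a (modNabla g φ b F) y - modNabla g φ b (modNabla g φ a F) y

/-- Smooth sections over `U` of the bundle with fibres `V (g y)`. -/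
def IsSectionOn (V : Matrix (Fin n) (Fin n) ℝ → Submodule ℝ (Tractor₂ n))
    (U : Set (Coord n)) (F : Coord n → Tractor₂ n) : Prop :=
  (∀ B C, ContDiffOn ℝ ∞ (fun y => F y B C) U) ∧ ∀ y ∈ U, F y ∈ V (g y)

/-- `φ` is a smooth 1-form on `U` with values in endomorphisms of the bundle with fibres `V (g y)`.
(Only its restriction to `V` is ever used.) -/
def IsEndFormOn (V : Matrix (Fin n) (Fin n) ℝ → Submodule ℝ (Tractor₂ n))
    (U : Set (Coord n)) (φ : EndForm n) : Prop :=
  (∀ a f B C, ContDiffOn ℝ ∞ (fun y => φ a y f B C) U) ∧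
    ∀ a, ∀ y ∈ U, ∀ f ∈ V (g y), φ a y f ∈ V (g y)

/-- `φ` is homogeneous of degree `≥ l` for the natural filtrations of `TM` (concentrated in degree
`-1`) and of the tractor bundle. -/
def IsHomogeneousOn (V : Matrix (Fin n) (Fin n) ℝ → Submodule ℝ (Tractor₂ n))
    (U : Set (Coord n)) (l : ℤ) (φ : EndForm n) : Prop :=
  ∀ a, ∀ y ∈ U, ∀ i : ℤ, ∀ f ∈ V (g y), InFiltration i f → InFiltration (i - 1 + l) (φ a y f)

/-- `φ` lies in the image of `∂_V^* ⊗ id_{V^*}`: each 1-form `φ f` is `∂^*` of a `V`-valued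
2-form. -/
def InImCodiffOn (V : Matrix (Fin n) (Fin n) ℝ → Submodule ℝ (Tractor₂ n))
    (U : Set (Coord n)) (φ : EndForm n) : Prop :=
  ∀ y ∈ U, ∀ f ∈ V (g y), ∃ ψ : Fin n → Fin n → Tractor₂ n,
    (∀ a b, ψ a b ∈ V (g y)) ∧ (∀ a b, ψ a b = -ψ b a) ∧ ∀ b, φ b y f = codiff (g y) ψ b

/-- `∇ + Φ` is the prolongation connection on `U`: it is admissible and its curvature is annihilated
by `∂_V^* ⊗ id_{V^*}`. -/
def IsProlongation (V : Matrix (Fin n) (Fin n) ℝ → Submodule ℝ (Tractor₂ n))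
    (U : Set (Coord n)) (φ : EndForm n) : Prop :=
  IsEndFormOn g V U φ ∧ IsHomogeneousOn g V U 1 φ ∧ InImCodiffOn g V U φ ∧
    ∀ F, IsSectionOn g V U F → ∀ y ∈ U, ∀ b, codiff (g y) (modCurvature g φ F y) b = 0

end Coordinates

/-! ## Conformal manifolds and the standard tractor bundle -/

section Manifold

variable {n : ℕ} {M : Type*} [TopologicalSpace M] [ChartedSpace (Coord n) M]

/-- The coordinate vector field `∂_a` of the chart `e`, at the point with coordinates `y`. -/
def coordVec (e : OpenPartialHomeomorph M (Coord n)) (y : Coord n) (a : Fin n) :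
    TangentSpace (𝓡 n) (e.symm y) :=
  mfderiv (𝓡 n) (𝓡 n) e.symm y (EuclideanSpace.single a (1 : ℝ) : Coord n)

variable (n M) in
/-- A smooth pseudo-Riemannian metric (of any signature). -/
structure PseudoMetric where
  val : ∀ x : M, TangentSpace (𝓡 n) x →L[ℝ] TangentSpace (𝓡 n) x →L[ℝ] ℝ
  symm : ∀ x u v, val x u v = val x v u
  nondegenerate : ∀ x u, (∀ v, val x u v = 0) → u = 0
  smooth : ∀ e ∈ IsManifold.maximalAtlas (𝓡 n) ∞ M, ∀ a b,
    ContDiffOn ℝ ∞ (fun y => val (e.symm y) (coordVec e y a) (coordVec e y b)) e.target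

/-- The components of a metric in a chart. -/
def PseudoMetric.matrix (g : PseudoMetric n M) (e : OpenPartialHomeomorph M (Coord n)) :
    MetricMatrix n :=
  fun y => Matrix.of fun a b => g.val (e.symm y) (coordVec e y a) (coordVec e y b)

/-- `ĝ = e^{2Υ} g` for a smooth function `Υ`. -/
def IsRescaling (g g' : PseudoMetric n M) (Υ : M → ℝ) : Prop :=
  ContMDiff (𝓡 n) 𝓘(ℝ, ℝ) ∞ Υ ∧ ∀ x u v, g'.val x u v = Real.exp (2 * Υ x) * g.val x u v

variable (n M) in
/-- A conformal structure: an equivalence class of conformally related metrics, its scales. -/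
structure ConformalStructure where
  scales : Set (PseudoMetric n M)
  nonempty : scales.Nonempty
  mem_iff : ∀ g ∈ scales, ∀ g', g' ∈ scales ↔ ∃ Υ, IsRescaling g g' Υ

/-- A metric from the conformal class. -/
abbrev ConformalStructure.Scale (c : ConformalStructure n M) : Type _ := {g // g ∈ c.scales}

/-- The fibre at `x` of the standard tractor bundle `E^A` of a conformal structure. An element
assigns to each scale `g` a triple `(α, μ_a, τ)` in `E[1] ⊕ E_a[1] ⊕ E[-1]`, densities being
trivialised by `g`, and for `ĝ = e^{2Υ} g` the triples are related by
`α̂ = α`, `μ̂_a = μ_a + Υ_a α`, `τ̂ = τ - Υ^b μ_b - 1/2 Υ_c Υ^c α`, where `Υ_a = ∇_a Υ`; the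
additional powers of `e^Υ` come from the change of trivialisation of the densities.
Below, `u` is the vector `Υ^a`. -/
def tractorFibre (c : ConformalStructure n M) (x : M) :
    Submodule ℝ (c.Scale → ℝ × (TangentSpace (𝓡 n) x →L[ℝ] ℝ) × ℝ) where
  carrier := {s | ∀ g g' : c.Scale, ∀ Υ, IsRescaling g.1 g'.1 Υ →
    ∀ u, (∀ v, g.1.val x u v = mvfderiv (𝓡 n) Υ x v) →
      (s g').1 = Real.exp (Υ x) * (s g).1 ∧
      (s g').2.1 = Real.exp (Υ x) • ((s g).2.1 + (s g).1 • mvfderiv (𝓡 n) Υ x) ∧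
      (s g').2.2 = Real.exp (-Υ x) *
        ((s g).2.2 - (s g).2.1 u - (1 / 2) * mvfderiv (𝓡 n) Υ x u * (s g).1)}
  add_mem' := by
    intro s t hs ht g g' Υ h u hu
    obtain ⟨h1, h2, h3⟩ := hs g g' Υ h u hu
    obtain ⟨k1, k2, k3⟩ := ht g g' Υ h u hu
    refine ⟨?_, ?_, ?_⟩
    · simp only [Pi.add_apply, Prod.fst_add, h1, k1]; ring
    · simp only [Pi.add_apply, Prod.fst_add, Prod.snd_add, h2, k2]; module
    · simp only [Pi.add_apply, Prod.fst_add, Prod.snd_add, h3, k3,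
        add_apply]; ring
  zero_mem' := by
    intro g g' Υ h u hu
    simp
  smul_mem' := by
    intro r s hs g g' Υ h u hu
    obtain ⟨h1, h2, h3⟩ := hs g g' Υ h u hu
    refine ⟨?_, ?_, ?_⟩
    · simp only [Pi.smul_apply, Prod.smul_fst, smul_eq_mul, h1]; ring
    · simp only [Pi.smul_apply, Prod.smul_fst, Prod.smul_snd, smul_eq_mul, h2]; module
    · simp only [Pi.smul_apply, Prod.smul_fst, Prod.smul_snd, smul_eq_mul, h3,
        smul_apply]; ring

/-- The fibre at `x` of the bundle `E_{BC}`: bilinear forms on the standard tractor fibre. -/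
abbrev tractor₂Fibre (c : ConformalStructure n M) (x : M) : Type _ :=
  LinearMap.BilinForm ℝ (tractorFibre c x)

/-- The coframe `Y_B, Z_B{}^b, X_B` determined by a scale `g` and a chart `e`, at the point with
coordinates `y`: it maps `V^B = (α, μ_a, τ)` to `τ`, `μ^b = g^{ba} μ_a` and `α`. -/
def coframe (c : ConformalStructure n M) (g : c.Scale) (e : OpenPartialHomeomorph M (Coord n))
    (y : Coord n) : TIdx n → (tractorFibre c (e.symm y) →ₗ[ℝ] ℝ)
  | Sum.inl _ =>
    { toFun := fun s => (s.1 g).2.2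
      map_add' := fun _ _ => rfl
      map_smul' := fun _ _ => rfl }
  | Sum.inr (Sum.inl b) =>
    { toFun := fun s => ∑ a, (g.1.matrix e y)⁻¹ b a * (s.1 g).2.1 (coordVec e y a)
      map_add' := fun s t => by simp [mul_add, Finset.sum_add_distrib]
      map_smul' := fun r s => by
        simp only [SetLike.val_smul, Pi.smul_apply, Prod.smul_snd, Prod.smul_fst,
          smul_apply, smul_eq_mul, RingHom.id_apply, Finset.mul_sum]
        exact Finset.sum_congr rfl fun a _ => by ring }
  | Sum.inr (Sum.inr _) =>
    { toFun := fun s => (s.1 g).1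
      map_add' := fun _ _ => rfl
      map_smul' := fun _ _ => rfl }

/-- The 2-tractor with components `f` in the scale `g` and the chart `e`,
`F(V, W) = f_{BC} θ^B(V) θ^C(W)` for the coframe `θ`. -/
def ofComponents (c : ConformalStructure n M) (g : c.Scale)
    (e : OpenPartialHomeomorph M (Coord n)) (y : Coord n) (f : Tractor₂ n) :
    tractor₂Fibre c (e.symm y) :=
  ∑ B, ∑ C, f B C • LinearMap.BilinForm.linMulLin (coframe c g e y B) (coframe c g e y C)

/-- 1-forms on `M` with values in endomorphisms of the 2-tractors. -/
abbrev ModificationMap (c : ConformalStructure n M) : Type _ :=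
  ∀ x : M, TangentSpace (𝓡 n) x →ₗ[ℝ] (tractor₂Fibre c x →ₗ[ℝ] tractor₂Fibre c x)

/-- The covariant derivative `(∇ + Φ)_a F` along `∂_a` of the section with components `F`, where `∇`
is the normal tractor connection. -/
def modifiedConnection (c : ConformalStructure n M) (Φ : ModificationMap c) (g : c.Scale)
    (e : OpenPartialHomeomorph M (Coord n)) (a : Fin n) (F : Coord n → Tractor₂ n)
    (y : Coord n) : tractor₂Fibre c (e.symm y) :=
  ofComponents c g e y (tractorNabla (g.1.matrix e) a F y)
    + Φ (e.symm y) (coordVec e y a) (ofComponents c g e y (F y))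

/-- `φ` gives the components of `Φ`, on the subbundle with fibres `V`, in the scale `g` and the
chart `e`. -/
def Represents (c : ConformalStructure n M) (Φ : ModificationMap c) (g : c.Scale)
    (e : OpenPartialHomeomorph M (Coord n))
    (V : Matrix (Fin n) (Fin n) ℝ → Submodule ℝ (Tractor₂ n)) (φ : EndForm n) : Prop :=
  ∀ a, ∀ y ∈ e.target, ∀ f ∈ V (g.1.matrix e y),
    Φ (e.symm y) (coordVec e y a) (ofComponents c g e y f) = ofComponents c g e y (φ a y f)

/-- `∇ + Φ` is, over the domain of the chart `e`, the prolongation connection of the conformal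
structure on the bundle with fibres `V`. -/
def IsProlongationConnection (c : ConformalStructure n M) (Φ : ModificationMap c) (g : c.Scale)
    (e : OpenPartialHomeomorph M (Coord n))
    (V : Matrix (Fin n) (Fin n) ℝ → Submodule ℝ (Tractor₂ n)) : Prop :=
  ∃ φ : EndForm n, Represents c Φ g e V φ ∧ IsProlongation (g.1.matrix e) V e.target φ

end Manifold

end ConformalProlongation

end

noncomputable section

namespace ConformalProlongation

/-! In a scale and a chart everything becomes a computation with components, and the equivalence
splits into uniqueness of the prolongation connection (`IsProlongation.unique`) and the fact that
the explicit modification defines one (`IsMetricOn.modAct_isProlongation`). The two are joined by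
`IsMetricOn.modAct_eq_psiAct`, which identifies the slot-wise modification with (2/3)Ψ̃ on symmetric
2-tractors.

Uniqueness is Kostant's argument. If δ is the difference of two admissible modifications, the
curvatures differ by the skew part in a, b of ∇_a(δ_b F) + δ_a(∇̃_b F) + Φ'_a(δ_b F), and ∂^* kills
this. In the lowest slots in which δ is not yet known to vanish, the derivative of δF, the term δ∇̃F
and, by homogeneity, the term Φ'δF contribute nothing; what is left is the algebraic part of the
tractor connection applied to δ. So ∂^*∂δ = 0 on the leading part of an element of the image of ∂^*,
where this Laplacian is invertible. The invertibility is checked by hand in the order YZ, YX, ZZ,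
ZX, XX; the last factors that have to be nonzero are n + 2 for YX, n(n + 2) for ZX and n - 1 for XX.

Existence climbs the same ladder. The slots of the curvature containing Y vanish because the skew
part of the ZZ slot, and then of the ZX slot, of the modification compensates the tractor curvature
(`modZZ_skew`, `modZX_skew`). Once these slots vanish, ∂^* sees only the traces of the ZZ and ZX
slots of the curvature. The former contains n times the ZX slot of the modification and the latter n
- 1 times its XX slot, which explains the denominators in Ψ̃ (`tr_modCurv_ZZ`, `tr_modCurv_ZX`). The
remaining terms are divergences: that of the Weyl tensor is a multiple of the Cotton tensor, that of
the Cotton tensor gives the Bach tensor, and that of the Bach tensor is -(n - 4)P^{pq}A_{qbp}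
(`div_weyl`, `div_cotton₁`, `div_bach`); all of them rest on the Bianchi identities. The terms
quadratic in curvature come from Φ∘Φ. Membership of Φ in the image of ∂^* follows from an explicit
preimage (`exists_eq_codiff`), available because all traces of the modification vanish.

The tensor calculus is done over an abstract commutative ℝ-algebra with commuting derivations and a
metric. It is applied to the ring of functions smooth on the chart domain and transported to points
by evaluation, which is a ring homomorphism; the same trace calculus over ℝ serves for the linear
algebra at a point. -/

/-- A metric over a ring of functions with commuting partial derivatives `D a`; `gi` is the inverse
metric. -/
structure LocalMetric (n : ℕ) (R : Type*) [CommRing R] [Algebra ℝ R] where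
  D : Fin n → Derivation ℝ R R
  D_comm : ∀ a b x, D a (D b x) = D b (D a x)
  g : Fin n → Fin n → R
  gi : Fin n → Fin n → R
  g_symm : ∀ a b, g a b = g b a
  gi_symm : ∀ a b, gi a b = gi b a
  g_gi : ∀ a c, ∑ b, g a b * gi b c = if a = c then 1 else 0

namespace LocalMetric

variable {n : ℕ} {R : Type*} [CommRing R] [Algebra ℝ R]

/-- `R` is only an ℝ-algebra, so halves are images of real numbers; this relation lets
`linear_combination` clear them. -/
lemma half_two : algebraMap ℝ R (1 / 2) * 2 = 1 := by
  rw [← map_ofNat (algebraMap ℝ R) 2, ← map_mul]; norm_num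

variable (m : LocalMetric n R)

lemma gi_g (a c : Fin n) : ∑ b, m.gi a b * m.g b c = if a = c then 1 else 0 := by
  have h := m.g_gi c a
  simp only [eq_comm (a := a), ← h]
  exact Finset.sum_congr rfl fun b _ => by rw [m.gi_symm a b, m.g_symm b c, mul_comm]

/-! ### Traces -/

/-- The metric trace `g^{ab} T_{ab}`. -/
def tr (T : Fin n → Fin n → R) : R := ∑ a, ∑ b, m.gi a b * T a b

/-- `v^q = g^{qr} v_r`. -/
def up (v : Fin n → R) (q : Fin n) : R := ∑ r, m.gi q r * v r

lemma tr_add (S T : Fin n → Fin n → R) :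
    m.tr (fun a b => S a b + T a b) = m.tr S + m.tr T := by
  simp [tr, mul_add, Finset.sum_add_distrib]

lemma tr_sub (S T : Fin n → Fin n → R) :
    m.tr (fun a b => S a b - T a b) = m.tr S - m.tr T := by
  simp [tr, mul_sub, Finset.sum_sub_distrib]

lemma tr_neg (S : Fin n → Fin n → R) : m.tr (fun a b => - S a b) = - m.tr S := by
  simp [tr]

lemma tr_zero : m.tr (fun _ _ => 0) = 0 := by simp [tr]

lemma tr_mul_left (k : R) (S : Fin n → Fin n → R) :
    m.tr (fun a b => k * S a b) = k * m.tr S := by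
  simp only [tr, Finset.mul_sum]
  exact Finset.sum_congr rfl fun a _ => Finset.sum_congr rfl fun b _ => by ring

lemma tr_mul_right (k : R) (S : Fin n → Fin n → R) :
    m.tr (fun a b => S a b * k) = m.tr S * k := by
  simp only [mul_comm _ k, tr_mul_left]

lemma tr_swap (S : Fin n → Fin n → R) : m.tr (fun a b => S b a) = m.tr S := by
  simp only [tr]
  rw [Finset.sum_comm]
  exact Finset.sum_congr rfl fun a _ => Finset.sum_congr rfl fun b _ => by rw [m.gi_symm]

lemma tr_sum {ι : Type*} (s : Finset ι) (S : ι → Fin n → Fin n → R) :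
    m.tr (fun a b => ∑ i ∈ s, S i a b) = ∑ i ∈ s, m.tr (S i) := by
  simp only [tr, Finset.mul_sum]
  rw [Finset.sum_comm]
  simp only [Finset.sum_comm (s := s)]
  rw [Finset.sum_comm]

lemma tr_comm (S : Fin n → Fin n → Fin n → Fin n → R) :
    m.tr (fun a b => m.tr fun c d => S a b c d) = m.tr (fun c d => m.tr fun a b => S a b c d) := by
  have h : ∀ c d, m.tr (fun a b => S a b c d) = ∑ a, ∑ b, m.gi a b * S a b c d := fun _ _ => rfl
  simp only [h, tr_sum, tr_mul_left]
  rfl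

lemma tr_g_mul (c : Fin n) (v : Fin n → R) : m.tr (fun a b => m.g a c * v b) = v c := by
  simp only [tr]
  rw [Finset.sum_comm]
  have : ∀ b, ∑ a, m.gi a b * (m.g a c * v b) = (if b = c then 1 else 0) * v b := fun b => by
    rw [← m.gi_g b c, Finset.sum_mul]
    exact Finset.sum_congr rfl fun a _ => by rw [m.gi_symm a b]; ring
  simp [this]

lemma tr_g_mul' (c : Fin n) (v : Fin n → R) : m.tr (fun a b => m.g c a * v b) = v c := by
  simp only [m.g_symm c, tr_g_mul]

lemma tr_mul_g (c : Fin n) (v : Fin n → R) : m.tr (fun a b => v a * m.g b c) = v c := by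
  rw [← tr_swap]; simp only [mul_comm (v _), tr_g_mul]

lemma tr_mul_g' (c : Fin n) (v : Fin n → R) : m.tr (fun a b => v a * m.g c b) = v c := by
  simp only [m.g_symm c, tr_mul_g]

lemma tr_g : m.tr m.g = n := by
  have : ∀ a, ∑ b, m.gi a b * m.g a b = 1 := fun a => by
    have := m.gi_g a a
    rw [if_pos rfl] at this
    rw [← this]
    exact Finset.sum_congr rfl fun b _ => by rw [m.g_symm]
  simp [tr, this]

lemma tr_skew (S : Fin n → Fin n → R) (h : ∀ a b, S a b = - S b a) : m.tr S = 0 := by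
  have h1 : m.tr S = - m.tr S := by
    conv_lhs => rw [← tr_swap]
    rw [← tr_neg]
    congr 1; funext a b; rw [h b a]
  linear_combination (-m.tr S) * half_two (R := R) + algebraMap ℝ R (1 / 2) * h1

lemma tr_mul_eq_up (S v : Fin n → R) : m.tr (fun a b => S a * v b) = ∑ a, S a * m.up v a := by
  simp only [tr, up, Finset.mul_sum]
  exact Finset.sum_congr rfl fun a _ => Finset.sum_congr rfl fun b _ => by ring

/-! ### The Levi-Civita connection -/

/-- Christoffel symbols `Γ^c_{ab}`. -/
def Γ (c a b : Fin n) : R :=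
  algebraMap ℝ R (1 / 2) * ∑ e, m.gi c e *
    (m.D a (m.g e b) + m.D b (m.g e a) - m.D e (m.g a b))

lemma Γ_symm (c a b : Fin n) : m.Γ c a b = m.Γ c b a := by
  simp only [Γ]
  congr 1
  exact Finset.sum_congr rfl fun e _ => by rw [m.g_symm a b]; ring

lemma sum_g_gi_mul (a : Fin n) (v : Fin n → R) :
    ∑ c, m.g a c * ∑ e, m.gi c e * v e = v a := by
  simp only [Finset.mul_sum]
  rw [Finset.sum_comm]
  have : ∀ e, ∑ c, m.g a c * (m.gi c e * v e) = (if a = e then 1 else 0) * v e := fun e => by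
    rw [← m.g_gi a e, Finset.sum_mul]
    exact Finset.sum_congr rfl fun c _ => by ring
  simp [this]

lemma sum_gi_g_mul (a : Fin n) (v : Fin n → R) :
    ∑ c, m.gi a c * ∑ e, m.g c e * v e = v a := by
  simp only [Finset.mul_sum]
  rw [Finset.sum_comm]
  have : ∀ e, ∑ c, m.gi a c * (m.g c e * v e) = (if a = e then 1 else 0) * v e := fun e => by
    rw [← m.gi_g a e, Finset.sum_mul]
    exact Finset.sum_congr rfl fun c _ => by ring
  simp [this]

lemma g_Γ (d a b : Fin n) : ∑ c, m.g d c * m.Γ c a b =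
    algebraMap ℝ R (1 / 2) * (m.D a (m.g d b) + m.D b (m.g d a) - m.D d (m.g a b)) := by
  rw [← m.sum_g_gi_mul d fun e => m.D a (m.g e b) + m.D b (m.g e a) - m.D e (m.g a b)]
  rw [Finset.mul_sum]
  exact Finset.sum_congr rfl fun e _ => by rw [Γ]; ring

/-- By `g_Γ` both sums are Christoffel symbols of the first kind; adding them, all derivatives of
the metric cancel except the one on the left. -/
lemma D_g (e a b : Fin n) :
    m.D e (m.g a b) = ∑ x, m.Γ x e a * m.g x b + ∑ x, m.Γ x e b * m.g a x := by
  have h1 := m.g_Γ b e a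
  have h2 := m.g_Γ a e b
  simp only [m.g_symm b] at h1
  have h3 : ∑ x, m.Γ x e a * m.g x b = ∑ x, m.g x b * m.Γ x e a :=
    Finset.sum_congr rfl fun _ _ => mul_comm _ _
  have h4 : ∑ x, m.Γ x e b * m.g a x = ∑ x, m.g a x * m.Γ x e b :=
    Finset.sum_congr rfl fun _ _ => mul_comm _ _
  rw [h3, h4, h1, h2, m.g_symm e a, m.g_symm e b]
  linear_combination (-m.D e (m.g a b)) * half_two (R := R)

/-- `∇_a T_b`. -/
def nab₁ (T : Fin n → R) (a b : Fin n) : R :=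
  m.D a (T b) - ∑ e, m.Γ e a b * T e

/-- `∇_a T_{bc}`. -/
def nab₂ (T : Fin n → Fin n → R) (a b c : Fin n) : R :=
  m.D a (T b c) - ∑ e, m.Γ e a b * T e c - ∑ e, m.Γ e a c * T b e

/-- `∇_a T_{bcd}`. -/
def nab₃ (T : Fin n → Fin n → Fin n → R) (a b c d : Fin n) : R :=
  m.D a (T b c d) - ∑ e, m.Γ e a b * T e c d - ∑ e, m.Γ e a c * T b e d
    - ∑ e, m.Γ e a d * T b c e

/-- `∇_a T_{bcde}`. -/
def nab₄ (T : Fin n → Fin n → Fin n → Fin n → R) (a b c d e : Fin n) : R :=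
  m.D a (T b c d e) - ∑ x, m.Γ x a b * T x c d e - ∑ x, m.Γ x a c * T b x d e
    - ∑ x, m.Γ x a d * T b c x e - ∑ x, m.Γ x a e * T b c d x

/-- `∇_a u^b`. -/
def nabUp₁ (u : Fin n → R) (a b : Fin n) : R := m.D a (u b) + ∑ e, m.Γ b a e * u e

/-- `∇_a W^{bc}`. -/
def nabUp₂ (W : Fin n → Fin n → R) (a b c : Fin n) : R :=
  m.D a (W b c) + ∑ e, m.Γ b a e * W e c + ∑ e, m.Γ c a e * W b e

lemma nab₂_g (a b c : Fin n) : m.nab₂ m.g a b c = 0 := by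
  rw [nab₂, D_g]; ring

/-- Differentiating g_{db} g^{bc} = δ and inserting the compatibility of the connection with `g`
shows that `g` annihilates this derivative; `g` is invertible. -/
lemma nabUp₂_gi (a b c : Fin n) : m.nabUp₂ m.gi a b c = 0 := by
  have key : ∀ d, ∑ b, m.g d b * m.nabUp₂ m.gi a b c = 0 := by
    intro d
    have h0 : m.D a (∑ b, m.g d b * m.gi b c) = 0 := by
      rw [g_gi]; split_ifs <;> simp
    simp only [map_sum, Derivation.leibniz, smul_eq_mul, Finset.sum_add_distrib] at h0
    simp only [nabUp₂, mul_add, Finset.sum_add_distrib]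
    have h1 : ∑ b, m.gi b c * m.D a (m.g d b) =
        m.Γ c a d + ∑ b, m.g d b * ∑ e, m.Γ b a e * m.gi e c := by
      simp only [D_g, mul_add, Finset.sum_add_distrib]
      congr 1
      · simp only [Finset.mul_sum]
        rw [Finset.sum_comm]
        have : ∀ x, ∑ b, m.gi b c * (m.Γ x a d * m.g x b) = m.Γ x a d * if x = c then 1 else 0 := by
          intro x
          rw [← m.g_gi x c, Finset.mul_sum]
          exact Finset.sum_congr rfl fun _ _ => by ring
        simp [this]
      · simp only [Finset.mul_sum]
        rw [Finset.sum_comm]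
        exact Finset.sum_congr rfl fun _ _ => Finset.sum_congr rfl fun _ _ => by ring
    have h2 : ∑ b, m.g d b * ∑ e, m.Γ c a e * m.gi b e = m.Γ c a d := by
      rw [← m.sum_g_gi_mul d fun e => m.Γ c a e]
      exact Finset.sum_congr rfl fun _ _ => by
        congr 1; exact Finset.sum_congr rfl fun _ _ => mul_comm _ _
    linear_combination h0 - h1 + h2
  rw [← m.sum_gi_g_mul b fun b => m.nabUp₂ m.gi a b c]
  simp [key]

/-! ### Leibniz rules for contractions -/

lemma D_contract₂ (W T : Fin n → Fin n → R) (e : Fin n) :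
    m.D e (∑ p, ∑ q, W p q * T p q) =
      ∑ p, ∑ q, (m.nabUp₂ W e p q * T p q + W p q * m.nab₂ T e p q) := by
  simp only [map_sum, Derivation.leibniz, smul_eq_mul, nabUp₂, nab₂]
  have h1 : ∑ p, ∑ q, (∑ x, m.Γ p e x * W x q) * T p q
      = ∑ p, ∑ q, W p q * ∑ x, m.Γ x e p * T x q := by
    simp only [Finset.sum_mul, Finset.mul_sum]
    rw [Finset.sum_comm, ]
    conv_rhs => rw [Finset.sum_comm]
    refine Finset.sum_congr rfl fun q _ => ?_
    rw [Finset.sum_comm]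
    exact Finset.sum_congr rfl fun _ _ => Finset.sum_congr rfl fun _ _ => by ring
  have h2 : ∑ p, ∑ q, (∑ x, m.Γ q e x * W p x) * T p q
      = ∑ p, ∑ q, W p q * ∑ x, m.Γ x e q * T p x := by
    simp only [Finset.sum_mul, Finset.mul_sum]
    refine Finset.sum_congr rfl fun q _ => ?_
    rw [Finset.sum_comm]
    exact Finset.sum_congr rfl fun _ _ => Finset.sum_congr rfl fun _ _ => by ring
  simp only [add_mul, mul_sub, Finset.sum_add_distrib, Finset.sum_sub_distrib, h1, h2]
  simp only [mul_comm (T _ _)]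
  ring

lemma D_contract₁ (u T : Fin n → R) (e : Fin n) :
    m.D e (∑ q, T q * u q) = ∑ q, (m.nab₁ T e q * u q + T q * m.nabUp₁ u e q) := by
  simp only [map_sum, Derivation.leibniz, smul_eq_mul, nabUp₁, nab₁]
  have h1 : ∑ q, T q * (∑ x, m.Γ q e x * u x) = ∑ q, (∑ x, m.Γ x e q * T x) * u q := by
    simp only [Finset.sum_mul, Finset.mul_sum]
    rw [Finset.sum_comm]
    exact Finset.sum_congr rfl fun _ _ => Finset.sum_congr rfl fun _ _ => by ring
  simp only [sub_mul, mul_add, Finset.sum_add_distrib, Finset.sum_sub_distrib, h1]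
  simp only [mul_comm (u _)]
  ring

/-- Leibniz rule for `W^{pq} T_{pqab}`. -/
lemma nab₂_contract (W : Fin n → Fin n → R) (T : Fin n → Fin n → Fin n → Fin n → R)
    (e a b : Fin n) :
    m.nab₂ (fun a b => ∑ p, ∑ q, W p q * T p q a b) e a b =
      ∑ p, ∑ q, (m.nabUp₂ W e p q * T p q a b + W p q * m.nab₄ T e p q a b) := by
  rw [nab₂, D_contract₂]
  have h : ∀ (f : Fin n → Fin n → Fin n → R) (k : Fin n → R),
      ∑ x, k x * ∑ p, ∑ q, W p q * f p q x = ∑ p, ∑ q, W p q * ∑ x, k x * f p q x := by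
    intro f k
    simp only [Finset.mul_sum]
    rw [Finset.sum_comm]
    refine Finset.sum_congr rfl fun p _ => ?_
    rw [Finset.sum_comm]
    exact Finset.sum_congr rfl fun _ _ => Finset.sum_congr rfl fun _ _ => by ring
  rw [h, h]
  simp only [← Finset.sum_sub_distrib]
  refine Finset.sum_congr rfl fun p _ => Finset.sum_congr rfl fun q _ => ?_
  simp only [nab₄, nab₂]; ring

/-- Leibniz rule for `T_{abcq} u^q`. -/
lemma nab₃_contract (u : Fin n → R) (T : Fin n → Fin n → Fin n → Fin n → R) (e a b c : Fin n) :
    m.nab₃ (fun a b c => ∑ q, T a b c q * u q) e a b c =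
      ∑ q, (m.nab₄ T e a b c q * u q + T a b c q * m.nabUp₁ u e q) := by
  rw [nab₃, D_contract₁]
  have h : ∀ (f : Fin n → Fin n → R) (k : Fin n → R),
      ∑ x, k x * ∑ q, f x q * u q = ∑ q, (∑ x, k x * f x q) * u q := by
    intro f k
    simp only [Finset.mul_sum, Finset.sum_mul]
    rw [Finset.sum_comm]
    exact Finset.sum_congr rfl fun _ _ => Finset.sum_congr rfl fun _ _ => by ring
  rw [h, h, h]
  simp only [← Finset.sum_sub_distrib]
  refine Finset.sum_congr rfl fun q _ => ?_
  simp only [nab₄, nab₁]; ring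

/-- Leibniz rule for `T_{abq} u^q`. -/
lemma nab₂_contract₁ (u : Fin n → R) (T : Fin n → Fin n → Fin n → R) (e a b : Fin n) :
    m.nab₂ (fun a b => ∑ q, T a b q * u q) e a b =
      ∑ q, (m.nab₃ T e a b q * u q + T a b q * m.nabUp₁ u e q) := by
  rw [nab₂, D_contract₁]
  have h : ∀ (f : Fin n → Fin n → R) (k : Fin n → R),
      ∑ x, k x * ∑ q, f x q * u q = ∑ q, (∑ x, k x * f x q) * u q := by
    intro f k
    simp only [Finset.mul_sum, Finset.sum_mul]
    rw [Finset.sum_comm]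
    exact Finset.sum_congr rfl fun _ _ => Finset.sum_congr rfl fun _ _ => by ring
  rw [h, h]
  simp only [← Finset.sum_sub_distrib]
  refine Finset.sum_congr rfl fun q _ => ?_
  simp only [nab₃, nab₁]; ring

lemma D_tr (T : Fin n → Fin n → R) (e : Fin n) : m.D e (m.tr T) = m.tr (m.nab₂ T e) := by
  rw [tr, D_contract₂]
  simp [nabUp₂_gi, tr]

lemma nab₂_tr (T : Fin n → Fin n → Fin n → Fin n → R) (e a b : Fin n) :
    m.nab₂ (fun a b => m.tr fun p q => T p q a b) e a b = m.tr fun p q => m.nab₄ T e p q a b := by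
  have := m.nab₂_contract m.gi T e a b
  simpa [nabUp₂_gi, tr] using this

lemma nabUp₁_up (v : Fin n → R) (e q : Fin n) :
    m.nabUp₁ (m.up v) e q = m.up (m.nab₁ v e) q := by
  have h : ∀ r, m.D e (m.gi q r) = - ∑ x, m.Γ q e x * m.gi x r - ∑ x, m.Γ r e x * m.gi q x := by
    intro r; have := m.nabUp₂_gi e q r; rw [nabUp₂] at this; linear_combination this
  simp only [nabUp₁, up, nab₁, map_sum, Derivation.leibniz, smul_eq_mul, h]
  have h1 : ∑ x, m.Γ q e x * ∑ r, m.gi x r * v r = ∑ r, v r * ∑ x, m.Γ q e x * m.gi x r := by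
    simp only [Finset.mul_sum]
    rw [Finset.sum_comm]
    exact Finset.sum_congr rfl fun _ _ => Finset.sum_congr rfl fun _ _ => by ring
  have h2 : ∑ r, m.gi q r * ∑ x, m.Γ x e r * v x = ∑ r, v r * ∑ x, m.Γ r e x * m.gi q x := by
    simp only [Finset.mul_sum]
    rw [Finset.sum_comm]
    exact Finset.sum_congr rfl fun _ _ => Finset.sum_congr rfl fun _ _ => by ring
  rw [h1]
  simp only [mul_sub, mul_neg, Finset.sum_add_distrib, Finset.sum_sub_distrib,
    Finset.sum_neg_distrib, h2]
  ring

/-- `T^{pq} = g^{pr} g^{qs} T_{rs}`. -/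
def up₂ (T : Fin n → Fin n → R) (p q : Fin n) : R := ∑ r, ∑ s, m.gi p r * m.gi q s * T r s

lemma nabUp₂_up₂ (T : Fin n → Fin n → R) (e p q : Fin n) :
    m.nabUp₂ (m.up₂ T) e p q = m.up₂ (m.nab₂ T e) p q := by
  have h : ∀ q r, m.D e (m.gi q r) =
      - ∑ x, m.Γ q e x * m.gi x r - ∑ x, m.Γ r e x * m.gi q x := by
    intro q r; have := m.nabUp₂_gi e q r; rw [nabUp₂] at this; linear_combination this
  simp only [nabUp₂, up₂, D_contract₂, nab₂]
  have h1 : ∀ r s, m.nabUp₂ (fun r s => m.gi p r * m.gi q s) e r s =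
      - (∑ x, m.Γ p e x * m.gi x r) * m.gi q s - m.gi p r * ∑ x, m.Γ q e x * m.gi x s := by
    intro r s
    simp only [nabUp₂, Derivation.leibniz, smul_eq_mul, h]
    have e1 : ∑ x, m.Γ r e x * (m.gi p x * m.gi q s) = (∑ x, m.Γ r e x * m.gi p x) * m.gi q s := by
      rw [Finset.sum_mul]; exact Finset.sum_congr rfl fun _ _ => by ring
    have e2 : ∑ x, m.Γ s e x * (m.gi p r * m.gi q x) = m.gi p r * ∑ x, m.Γ s e x * m.gi q x := by
      rw [Finset.mul_sum]; exact Finset.sum_congr rfl fun _ _ => by ring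
    rw [e1, e2]; ring
  -- This is `h1` with `nabUp₂` unfolded by definitional equality, the form in which it occurs in
  -- the goal.
  have h0 : ∀ r s, m.D e (m.gi p r * m.gi q s) + _ + _ = _ := h1
  simp only [h0]
  have h2 : ∑ x, m.Γ p e x * ∑ r, ∑ s, m.gi x r * m.gi q s * T r s =
      ∑ r, ∑ s, (∑ x, m.Γ p e x * m.gi x r) * m.gi q s * T r s := by
    simp only [Finset.mul_sum, Finset.sum_mul]
    rw [Finset.sum_comm]
    refine Finset.sum_congr rfl fun r _ => ?_
    rw [Finset.sum_comm]
    exact Finset.sum_congr rfl fun _ _ => Finset.sum_congr rfl fun _ _ => by ring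
  have h3 : ∑ x, m.Γ q e x * ∑ r, ∑ s, m.gi p r * m.gi x s * T r s =
      ∑ r, ∑ s, (m.gi p r * ∑ x, m.Γ q e x * m.gi x s) * T r s := by
    simp only [Finset.mul_sum, Finset.sum_mul]
    rw [Finset.sum_comm]
    refine Finset.sum_congr rfl fun r _ => ?_
    rw [Finset.sum_comm]
    exact Finset.sum_congr rfl fun _ _ => Finset.sum_congr rfl fun _ _ => by ring
  rw [h2, h3]
  simp only [← Finset.sum_add_distrib]
  refine Finset.sum_congr rfl fun r _ => Finset.sum_congr rfl fun s _ => ?_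
  ring


lemma sum_mul_sum_comm {R ι κ : Type*} [CommRing R] [Fintype ι] [Fintype κ] (k : ι → R) (l : κ → R)
    (f : ι → κ → R) : ∑ x, k x * ∑ y, l y * f x y = ∑ y, l y * ∑ x, k x * f x y := by
  simp only [Finset.mul_sum]
  rw [Finset.sum_comm]
  exact Finset.sum_congr rfl fun _ _ => Finset.sum_congr rfl fun _ _ => by ring

lemma sum_sum_mul_assoc {R ι κ : Type*} [CommRing R] [Fintype ι] [Fintype κ] (k : ι → R) (l : ι → κ → R)
    (f : κ → R) : ∑ y, (∑ x, k x * l x y) * f y = ∑ x, k x * ∑ y, l x y * f y := by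
  simp only [Finset.mul_sum, Finset.sum_mul]
  rw [Finset.sum_comm]
  exact Finset.sum_congr rfl fun _ _ => Finset.sum_congr rfl fun _ _ => by ring

variable {n : ℕ} {R : Type*} [CommRing R] [Algebra ℝ R] (m : LocalMetric n R)

/-! ### Curvature -/

/-- `R_{ab}{}^c{}_d`. -/
def Rup (a b c d : Fin n) : R :=
  m.D a (m.Γ c b d) - m.D b (m.Γ c a d)
    + ∑ e, (m.Γ c a e * m.Γ e b d - m.Γ c b e * m.Γ e a d)

/-- `R_{abcd}`. -/
def riem (a b c d : Fin n) : R := ∑ e, m.g c e * m.Rup a b e d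

/-- `Ric_{ab}`. -/
def ric (a b : Fin n) : R := ∑ c, m.Rup c a c b

/-- Brings a contraction with the curvature into the nested form produced by expanding two covariant
derivatives, so that the Ricci identities reduce to `ring`. -/
lemma sum_Rup_mul (a b c : Fin n) (f : Fin n → R) :
    ∑ x, m.Rup a b x c * f x = ∑ x, m.D a (m.Γ x b c) * f x - ∑ x, m.D b (m.Γ x a c) * f x
      + ∑ y, m.Γ y b c * ∑ x, m.Γ x a y * f x - ∑ y, m.Γ y a c * ∑ x, m.Γ x b y * f x := by
  simp only [← sum_sum_mul_assoc, ← Finset.sum_add_distrib, ← Finset.sum_sub_distrib, Rup]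
  refine Finset.sum_congr rfl fun x _ => ?_
  simp only [Finset.sum_sub_distrib, mul_comm (m.Γ x _ _)]
  ring

/-- The Ricci identity for 2-tensors. -/
lemma nab₃_nab₂_comm (T : Fin n → Fin n → R) (a b c d : Fin n) :
    m.nab₃ (m.nab₂ T) a b c d - m.nab₃ (m.nab₂ T) b a c d =
      - ∑ x, m.Rup a b x c * T x d - ∑ x, m.Rup a b x d * T c x := by
  rw [sum_Rup_mul, sum_Rup_mul]
  simp only [nab₃, nab₂, map_sub, map_sum, Derivation.leibniz, smul_eq_mul, mul_sub,
    Finset.sum_sub_distrib, Finset.sum_add_distrib, m.D_comm b a, m.Γ_symm _ b a]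
  -- Products of two Christoffel symbols acting on different indices cancel against those with a and
  -- b exchanged, once the order of summation is normalised.
  have h := fun a b => sum_mul_sum_comm (fun x => m.Γ x a c) (fun y => m.Γ y b d) T
  rw [h a b, h b a]
  simp only [mul_comm (T _ _)]
  ring

/-- The Ricci identity for 3-tensors. -/
lemma nab₄_nab₃_comm (T : Fin n → Fin n → Fin n → R) (a b c d e : Fin n) :
    m.nab₄ (m.nab₃ T) a b c d e - m.nab₄ (m.nab₃ T) b a c d e =
      - ∑ x, m.Rup a b x c * T x d e - ∑ x, m.Rup a b x d * T c x e
        - ∑ x, m.Rup a b x e * T c d x := by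
  rw [sum_Rup_mul, sum_Rup_mul, sum_Rup_mul]
  simp only [nab₄, nab₃, map_sub, map_sum, Derivation.leibniz, smul_eq_mul, mul_sub,
    Finset.sum_sub_distrib, Finset.sum_add_distrib, m.D_comm b a, m.Γ_symm _ b a]
  have h1 := fun a b => sum_mul_sum_comm (fun x => m.Γ x a c) (fun y => m.Γ y b d)
    fun x y => T x y e
  have h2 := fun a b => sum_mul_sum_comm (fun x => m.Γ x a c) (fun y => m.Γ y b e)
    fun x y => T x d y
  have h3 := fun a b => sum_mul_sum_comm (fun x => m.Γ x a d) (fun y => m.Γ y b e)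
    fun x y => T c x y
  rw [h1 a b, h1 b a, h2 a b, h2 b a, h3 a b, h3 b a]
  simp only [mul_comm (T _ _ _)]
  ring

lemma Rup_skew (a b c d : Fin n) : m.Rup a b c d = - m.Rup b a c d := by
  simp only [Rup, Finset.sum_sub_distrib]; ring

lemma Rup_cyclic (a b c d : Fin n) : m.Rup a b c d + m.Rup b d c a + m.Rup d a c b = 0 := by
  simp only [Rup, Finset.sum_sub_distrib, m.Γ_symm _ d a, m.Γ_symm _ d b, m.Γ_symm _ b a]; ring

lemma riem_skew (a b c d : Fin n) : m.riem a b c d = - m.riem b a c d := by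
  simp only [riem, m.Rup_skew a b]; simp

lemma riem_cyclic (a b c d : Fin n) : m.riem a b c d + m.riem b d c a + m.riem d a c b = 0 := by
  simp only [riem, ← Finset.sum_add_distrib, ← mul_add, Rup_cyclic, mul_zero, Finset.sum_const_zero]

/-- The Ricci identity applied to the parallel tensor `g`: the commutator of derivatives vanishes,
and the curvature terms are the two sides. -/
lemma riem_skew' (a b c d : Fin n) : m.riem a b c d = - m.riem a b d c := by
  have h := m.nab₃_nab₂_comm m.g a b c d
  have h0 : ∀ a b c d, m.nab₃ (m.nab₂ m.g) a b c d = 0 := by simp [nab₃, nab₂_g]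
  have e1 : m.riem a b c d = ∑ x, m.Rup a b x d * m.g c x :=
    Finset.sum_congr rfl fun _ _ => mul_comm _ _
  have e2 : m.riem a b d c = ∑ x, m.Rup a b x c * m.g x d :=
    Finset.sum_congr rfl fun _ _ => by rw [m.g_symm d, mul_comm]
  rw [h0, h0] at h
  rw [e1, e2]; linear_combination h

lemma eq_of_two_mul {x y : R} (h : 2 * x = 2 * y) : x = y := by
  linear_combination (y - x) * half_two (R := R) + algebraMap ℝ R (1 / 2) * h

/-- The classical octahedron argument: a signed sum of the four cyclic identities, with both skew
symmetries, leaves twice the difference. -/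
lemma riem_pair (a b c d : Fin n) : m.riem a b c d = m.riem c d a b := by
  apply eq_of_two_mul
  have h1 := m.riem_cyclic a b c d
  have h2 := m.riem_cyclic b c d a
  have h3 := m.riem_cyclic c d a b
  have h4 := m.riem_cyclic d a b c
  have s := m.riem_skew
  have t := m.riem_skew'
  linear_combination h1 - h2 - h3 + h4 + t a b c d - s b d c a + t d b c a
    + t b c d a - t d a c b  - t c d a b + t c a d b - s a c b d

/-! #### The second Bianchi identity -/

/-- Entrywise derivative of a matrix. -/
def Dm (a : Fin n) (M : Matrix (Fin n) (Fin n) R) : Matrix (Fin n) (Fin n) R := M.map (m.D a)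

/-- The matrix of the Levi-Civita connection. -/
def Γm (a : Fin n) : Matrix (Fin n) (Fin n) R := Matrix.of fun c d => m.Γ c a d

lemma Dm_mul (a : Fin n) (M N : Matrix (Fin n) (Fin n) R) :
    m.Dm a (M * N) = m.Dm a M * N + M * m.Dm a N := by
  ext i j
  simp only [Dm, Matrix.map_apply, Matrix.mul_apply, Matrix.add_apply, map_sum,
    Derivation.leibniz, smul_eq_mul, Finset.sum_add_distrib, mul_comm (N _ _)]
  ring

lemma Dm_add (a : Fin n) (M N : Matrix (Fin n) (Fin n) R) :
    m.Dm a (M + N) = m.Dm a M + m.Dm a N := by ext; simp [Dm]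

lemma Dm_sub (a : Fin n) (M N : Matrix (Fin n) (Fin n) R) :
    m.Dm a (M - N) = m.Dm a M - m.Dm a N := by ext; simp [Dm]

lemma Dm_comm (a b : Fin n) (M : Matrix (Fin n) (Fin n) R) :
    m.Dm a (m.Dm b M) = m.Dm b (m.Dm a M) := by
  ext; simp only [Dm, Matrix.map_apply]; exact m.D_comm _ _ _

/-- The curvature as a matrix. -/
def Rm (a b : Fin n) : Matrix (Fin n) (Fin n) R :=
  m.Dm a (m.Γm b) - m.Dm b (m.Γm a) + (m.Γm a * m.Γm b - m.Γm b * m.Γm a)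

lemma Rm_apply (a b c d : Fin n) : m.Rm a b c d = m.Rup a b c d := by
  simp [Rm, Rup, Dm, Γm, Matrix.mul_apply, Finset.sum_sub_distrib]

/-- The covariant derivative of the curvature, disregarding the form indices. -/
def dRm (e a b : Fin n) : Matrix (Fin n) (Fin n) R :=
  m.Dm e (m.Rm a b) + m.Γm e * m.Rm a b - m.Rm a b * m.Γm e

/-- With R = dΓ + Γ∧Γ and commuting derivations this is a formal identity between matrices, the
vanishing of the cyclic sum of D R + [Γ, R]. -/
lemma dRm_cyclic (e a b : Fin n) : m.dRm e a b + m.dRm a b e + m.dRm b e a = 0 := by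
  simp only [dRm, Rm, Dm_add, Dm_sub, Dm_mul, m.Dm_comm b a, m.Dm_comm b e, m.Dm_comm a e]
  noncomm_ring

/-- Lowering an index commutes with ∇. The Christoffel terms of the two form indices are kept apart
because they cancel in the cyclic sum, Γ being symmetric. -/
lemma nab₄_riem (e a b c d : Fin n) :
    m.nab₄ m.riem e a b c d = ∑ x, m.g c x * m.dRm e a b x d
      - ∑ y, m.Γ y e a * m.riem y b c d - ∑ y, m.Γ y e b * m.riem a y c d := by
  have h1 : ∑ x, m.g c x * m.dRm e a b x d = ∑ x, m.g c x * m.D e (m.Rup a b x d)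
      + ∑ x, m.g c x * ∑ y, m.Γ x e y * m.Rup a b y d
      - ∑ x, m.g c x * ∑ y, m.Γ y e d * m.Rup a b x y := by
    simp only [← Finset.sum_add_distrib, ← Finset.sum_sub_distrib, ← mul_add, ← mul_sub]
    refine Finset.sum_congr rfl fun x _ => ?_
    simp only [dRm, Dm, Γm, Matrix.add_apply, Matrix.sub_apply, Matrix.map_apply, Matrix.mul_apply,
      Rm_apply, Matrix.of_apply, mul_comm (m.Rup _ _ _ _)]
  rw [h1, nab₄]
  simp only [riem, map_sum, Derivation.leibniz, smul_eq_mul, D_g, Finset.sum_add_distrib, mul_add]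
  rw [sum_mul_sum_comm (fun x => m.Γ x e d) (m.g c)]
  have h2 : ∑ x, m.Rup a b x d * ∑ y, m.Γ y e x * m.g c y =
      ∑ x, m.g c x * ∑ y, m.Γ x e y * m.Rup a b y d := by
    simp only [Finset.mul_sum]
    rw [Finset.sum_comm]
    exact Finset.sum_congr rfl fun _ _ => Finset.sum_congr rfl fun _ _ => by ring
  have h3 : ∑ x, m.Rup a b x d * ∑ y, m.Γ y e c * m.g y x =
      ∑ x, m.Γ x e c * ∑ y, m.g x y * m.Rup a b y d := by
    simp only [Finset.mul_sum]
    rw [Finset.sum_comm]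
    exact Finset.sum_congr rfl fun _ _ => Finset.sum_congr rfl fun _ _ => by ring
  rw [h2, h3]; ring

lemma nab₄_riem_cyclic (e a b c d : Fin n) :
    m.nab₄ m.riem e a b c d + m.nab₄ m.riem a b e c d + m.nab₄ m.riem b e a c d = 0 := by
  have h : ∑ x, m.g c x * m.dRm e a b x d + ∑ x, m.g c x * m.dRm a b e x d
      + ∑ x, m.g c x * m.dRm b e a x d = 0 := by
    simp only [← Finset.sum_add_distrib, ← mul_add]
    refine Finset.sum_eq_zero fun x _ => ?_
    have := congrFun (congrFun (m.dRm_cyclic e a b) x) d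
    simp only [Matrix.add_apply, Matrix.zero_apply] at this
    rw [this, mul_zero]
  have k : ∀ a b e, ∑ y, m.Γ y e a * m.riem b y c d = - ∑ y, m.Γ y e a * m.riem y b c d := by
    intro a b e
    simp only [m.riem_skew b, mul_neg, Finset.sum_neg_distrib]
  simp only [nab₄_riem, k, m.Γ_symm _ b a, m.Γ_symm _ b e, m.Γ_symm _ a e]
  linear_combination h


variable {n : ℕ} {R : Type*} [CommRing R] [Algebra ℝ R] (m : LocalMetric n R)

lemma tr_congr {S T : Fin n → Fin n → R} (h : ∀ a b, S a b = T a b) : m.tr S = m.tr T :=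
  congrArg m.tr (funext₂ h)

/-! ### Linearity and permutations of covariant derivatives -/

lemma nab₂_add (S T : Fin n → Fin n → R) (e a b : Fin n) :
    m.nab₂ (fun a b => S a b + T a b) e a b = m.nab₂ S e a b + m.nab₂ T e a b := by
  simp only [nab₂, map_add, mul_add, Finset.sum_add_distrib]; ring

lemma nab₃_sub (S T : Fin n → Fin n → Fin n → R) (e a b c : Fin n) :
    m.nab₃ (fun a b c => S a b c - T a b c) e a b c = m.nab₃ S e a b c - m.nab₃ T e a b c := by
  simp only [nab₃, map_sub, mul_sub, Finset.sum_sub_distrib]; ring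

lemma nab₃_add (S T : Fin n → Fin n → Fin n → R) (e a b c : Fin n) :
    m.nab₃ (fun a b c => S a b c + T a b c) e a b c = m.nab₃ S e a b c + m.nab₃ T e a b c := by
  simp only [nab₃, map_add, mul_add, Finset.sum_add_distrib]; ring

lemma nab₃_neg (S : Fin n → Fin n → Fin n → R) (e a b c : Fin n) :
    m.nab₃ (fun a b c => - S a b c) e a b c = - m.nab₃ S e a b c := by
  simp only [nab₃, map_neg, mul_neg, Finset.sum_neg_distrib]; ring

lemma nab₄_sub (S T : Fin n → Fin n → Fin n → Fin n → R) (e a b c d : Fin n) :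
    m.nab₄ (fun a b c d => S a b c d - T a b c d) e a b c d =
      m.nab₄ S e a b c d - m.nab₄ T e a b c d := by
  simp only [nab₄, map_sub, mul_sub, Finset.sum_sub_distrib]; ring

lemma nab₄_add (S T : Fin n → Fin n → Fin n → Fin n → R) (e a b c d : Fin n) :
    m.nab₄ (fun a b c d => S a b c d + T a b c d) e a b c d =
      m.nab₄ S e a b c d + m.nab₄ T e a b c d := by
  simp only [nab₄, map_add, mul_add, Finset.sum_add_distrib]; ring

lemma nab₄_neg (S : Fin n → Fin n → Fin n → Fin n → R) (e a b c d : Fin n) :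
    m.nab₄ (fun a b c d => - S a b c d) e a b c d = - m.nab₄ S e a b c d := by
  simp only [nab₄, map_neg, mul_neg, Finset.sum_neg_distrib]; ring

lemma nab₂_swap (T : Fin n → Fin n → R) (e a b : Fin n) :
    m.nab₂ (fun a b => T b a) e a b = m.nab₂ T e b a := by
  simp only [nab₂]; ring

lemma nab₃_swap₁₂ (T : Fin n → Fin n → Fin n → R) (e a b c : Fin n) :
    m.nab₃ (fun a b c => T b a c) e a b c = m.nab₃ T e b a c := by
  simp only [nab₃]; ring

lemma nab₃_swap₂₃ (T : Fin n → Fin n → Fin n → R) (e a b c : Fin n) :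
    m.nab₃ (fun a b c => T a c b) e a b c = m.nab₃ T e a c b := by
  simp only [nab₃]; ring

lemma nab₃_rotate (T : Fin n → Fin n → Fin n → R) (e a b c : Fin n) :
    m.nab₃ (fun a b c => T b c a) e a b c = m.nab₃ T e b c a := by
  simp only [nab₃]; ring

lemma nab₄_swap₁₂ (T : Fin n → Fin n → Fin n → Fin n → R) (e a b c d : Fin n) :
    m.nab₄ (fun a b c d => T b a c d) e a b c d = m.nab₄ T e b a c d := by
  simp only [nab₄]; ring

lemma nab₄_swap₂₃ (T : Fin n → Fin n → Fin n → Fin n → R) (e a b c d : Fin n) :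
    m.nab₄ (fun a b c d => T a c b d) e a b c d = m.nab₄ T e a c b d := by
  simp only [nab₄]; ring

lemma nab₄_swap₃₄ (T : Fin n → Fin n → Fin n → Fin n → R) (e a b c d : Fin n) :
    m.nab₄ (fun a b c d => T a b d c) e a b c d = m.nab₄ T e a b d c := by
  simp only [nab₄]; ring

lemma nab₄_pair (T : Fin n → Fin n → Fin n → Fin n → R) (e a b c d : Fin n) :
    m.nab₄ (fun a b c d => T c d a b) e a b c d = m.nab₄ T e c d a b := by
  simp only [nab₄]; ring

lemma nab₄_mul (S T : Fin n → Fin n → R) (e a b c d : Fin n) :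
    m.nab₄ (fun a b c d => S a b * T c d) e a b c d =
      m.nab₂ S e a b * T c d + S a b * m.nab₂ T e c d := by
  have h1 : ∀ (k f : Fin n → R) (t : R), ∑ x, k x * (f x * t) = (∑ x, k x * f x) * t := by
    intro k f t; rw [Finset.sum_mul]; exact Finset.sum_congr rfl fun _ _ => by ring
  have h2 : ∀ (k f : Fin n → R) (t : R), ∑ x, k x * (t * f x) = t * ∑ x, k x * f x := by
    intro k f t; rw [Finset.mul_sum]; exact Finset.sum_congr rfl fun _ _ => by ring
  simp only [nab₄, nab₂, Derivation.leibniz, smul_eq_mul]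
  rw [h1 _ (fun x => S x b), h1 _ (fun x => S a x), h2 _ (fun x => T x d), h2 _ (fun x => T c x)]
  ring

lemma nab₄_g_mul (T : Fin n → Fin n → R) (e a b c d : Fin n) :
    m.nab₄ (fun a b c d => m.g a b * T c d) e a b c d = m.g a b * m.nab₂ T e c d := by
  rw [nab₄_mul, nab₂_g]; ring

lemma nab₁_tr (T : Fin n → Fin n → Fin n → R) (e a : Fin n) :
    m.nab₁ (fun a => m.tr fun p q => T a p q) e a = m.tr fun p q => m.nab₃ T e a p q := by
  have h : ∑ x, m.Γ x e a * m.tr (fun p q => T x p q)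
      = m.tr (fun p q => ∑ x, m.Γ x e a * T x p q) := by
    rw [tr_sum]; simp only [tr_mul_left]
  rw [nab₁, D_tr, h, ← tr_sub]
  exact m.tr_congr fun p q => by simp only [nab₃, nab₂]; ring

/-! ### Ricci and Schouten tensors -/

lemma Rup_eq (a b c d : Fin n) : m.Rup a b c d = ∑ y, m.gi c y * m.riem a b y d :=
  (m.sum_gi_g_mul c fun x => m.Rup a b x d).symm

lemma sum_Rup_mul_eq_tr (a b c : Fin n) (f : Fin n → R) :
    ∑ x, m.Rup a b x c * f x = m.tr fun x y => f x * m.riem a b y c := by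
  simp only [Rup_eq, tr, Finset.sum_mul]
  exact Finset.sum_congr rfl fun _ _ => Finset.sum_congr rfl fun _ _ => by ring

lemma ric_eq_tr (a b : Fin n) : m.ric a b = m.tr fun c d => m.riem c a d b := by
  simp only [ric, Rup_eq, tr]

lemma ric_symm (a b : Fin n) : m.ric a b = m.ric b a := by
  rw [ric_eq_tr, ric_eq_tr, ← tr_swap]
  exact m.tr_congr fun c d => m.riem_pair _ _ _ _

lemma tr_riem₂₄ (a c : Fin n) : m.tr (fun b d => m.riem a b c d) = m.ric a c := by
  rw [ric_eq_tr]
  exact m.tr_congr fun b d => by rw [m.riem_skew, m.riem_skew']; ring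

lemma tr_riem₁₄ (b c : Fin n) : m.tr (fun a d => m.riem a b c d) = - m.ric b c := by
  rw [ric_eq_tr, ← tr_neg]
  exact m.tr_congr fun b d => m.riem_skew' _ _ _ _

/-- The trace of the Schouten tensor. -/
def J : R := algebraMap ℝ R (1 / (2 * ((n : ℝ) - 1))) * m.tr m.ric

/-- The Schouten tensor. -/
def P (a b : Fin n) : R := algebraMap ℝ R (1 / ((n : ℝ) - 2)) * (m.ric a b - m.J * m.g a b)

lemma P_symm (a b : Fin n) : m.P a b = m.P b a := by rw [P, P, m.ric_symm, m.g_symm]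

lemma cast_sub_two_mul (hn : 3 ≤ n) : ((n : R) - 2) * algebraMap ℝ R (1 / ((n : ℝ) - 2)) = 1 := by
  have h : ((n : R) - 2) = algebraMap ℝ R ((n : ℝ) - 2) := by simp [map_ofNat]
  have h' : (n : ℝ) - 2 ≠ 0 := by
    have : (3 : ℝ) ≤ n := by exact_mod_cast hn
    linarith
  rw [h, ← map_mul, mul_one_div_cancel h', map_one]

lemma cast_sub_one_mul (hn : 3 ≤ n) : ((n : R) - 1) * algebraMap ℝ R (1 / ((n : ℝ) - 1)) = 1 := by
  have h : ((n : R) - 1) = algebraMap ℝ R ((n : ℝ) - 1) := by simp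
  have h' : (n : ℝ) - 1 ≠ 0 := by
    have : (3 : ℝ) ≤ n := by exact_mod_cast hn
    linarith
  rw [h, ← map_mul, mul_one_div_cancel h', map_one]

lemma eq_of_sub_two_mul (hn : 3 ≤ n) {x y : R} (h : ((n : R) - 2) * x = ((n : R) - 2) * y) : x = y := by
  linear_combination (y - x) * cast_sub_two_mul (R := R) hn
    + algebraMap ℝ R (1 / ((n : ℝ) - 2)) * h

lemma ric_eq (hn : 3 ≤ n) (a b : Fin n) : m.ric a b = ((n : R) - 2) * m.P a b + m.J * m.g a b := by
  rw [P]; linear_combination (-(m.ric a b - m.J * m.g a b)) * cast_sub_two_mul (R := R) hn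

lemma tr_ric (hn : 3 ≤ n) : m.tr m.ric = 2 * ((n : R) - 1) * m.J := by
  have h : 2 * ((n : R) - 1) * algebraMap ℝ R (1 / (2 * ((n : ℝ) - 1))) = 1 := by
    have h : 2 * ((n : R) - 1) = algebraMap ℝ R (2 * ((n : ℝ) - 1)) := by simp [map_ofNat]
    have h' : 2 * ((n : ℝ) - 1) ≠ 0 := by
      have : (3 : ℝ) ≤ n := by exact_mod_cast hn
      linarith
    rw [h, ← map_mul, mul_one_div_cancel h', map_one]
  rw [J]; linear_combination (- m.tr m.ric) * h

lemma tr_P (hn : 3 ≤ n) : m.tr m.P = m.J := by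
  apply eq_of_sub_two_mul hn
  have h : m.tr m.ric = m.tr fun a b => ((n : R) - 2) * m.P a b + m.J * m.g a b :=
    m.tr_congr fun a b => m.ric_eq hn a b
  rw [tr_add, tr_mul_left, tr_mul_left, m.tr_ric hn, tr_g] at h
  linear_combination -h

/-! ### Contracted Bianchi identities -/

lemma nab₂_ric (e a b : Fin n) : m.nab₂ m.ric e a b = m.tr fun c d => m.nab₄ m.riem e c a d b := by
  have h : m.ric = fun a b => m.tr fun p q => m.riem p a q b := funext₂ m.ric_eq_tr
  rw [h, m.nab₂_tr (fun p q a b => m.riem p a q b)]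
  exact m.tr_congr fun p q => by simp only [nab₄]; ring

lemma nab₄_riem_pair (e a b c d : Fin n) :
    m.nab₄ m.riem e a b c d = m.nab₄ m.riem e c d a b := by
  rw [← nab₄_pair]; congr 1; funext a b c d; exact m.riem_pair _ _ _ _

lemma nab₄_riem_skew (e a b c d : Fin n) :
    m.nab₄ m.riem e a b c d = - m.nab₄ m.riem e b a c d := by
  rw [← nab₄_swap₁₂, ← nab₄_neg]; congr 1; funext a b c d; exact m.riem_skew _ _ _ _

lemma nab₄_riem_skew' (e a b c d : Fin n) :
    m.nab₄ m.riem e a b c d = - m.nab₄ m.riem e a b d c := by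
  rw [← nab₄_swap₃₄, ← nab₄_neg]; congr 1; funext a b c d; exact m.riem_skew' _ _ _ _

/-- The trace of the second Bianchi identity after exchanging the index pairs: two of its three
terms become derivatives of the Ricci tensor. -/
lemma div_riem (b c d : Fin n) : m.tr (fun e a => m.nab₄ m.riem e a b c d) =
    m.nab₂ m.ric c d b - m.nab₂ m.ric d c b := by
  rw [nab₂_ric, nab₂_ric, ← tr_sub]
  refine m.tr_congr fun e a => ?_
  have h := m.nab₄_riem_cyclic e c d a b
  rw [m.nab₄_riem_pair e a b c d]
  linear_combination h - m.nab₄_riem_skew c d e a b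

lemma nab₂_ric_symm (e a b : Fin n) : m.nab₂ m.ric e a b = m.nab₂ m.ric e b a := by
  rw [← nab₂_swap]; congr 1; funext a b; exact m.ric_symm _ _

lemma nab₂_P_symm (e a b : Fin n) : m.nab₂ m.P e a b = m.nab₂ m.P e b a := by
  rw [← nab₂_swap]; congr 1; funext a b; exact m.P_symm _ _

/-- The double trace of ∇R is computed in two ways: it is the divergence of Ric, and by `div_riem`
also the gradient of the scalar curvature minus that divergence. -/
lemma div_ric (hn : 3 ≤ n) (c : Fin n) :
    m.tr (fun e a => m.nab₂ m.ric e a c) = ((n : R) - 1) * m.D c m.J := by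
  apply eq_of_two_mul
  have h1 : m.tr (fun b d => m.tr fun e a => m.nab₄ m.riem e a b c d)
      = m.tr (fun e a => m.nab₂ m.ric e a c) := by
    rw [tr_comm]
    refine m.tr_congr fun e a => ?_
    rw [nab₂_ric]
    exact m.tr_congr fun b d => by rw [m.nab₄_riem_skew, m.nab₄_riem_skew']; ring
  have h2 : m.tr (fun b d => m.tr fun e a => m.nab₄ m.riem e a b c d) =
      m.D c (m.tr m.ric) - m.tr (fun e a => m.nab₂ m.ric e a c) := by
    simp only [div_riem, tr_sub, D_tr]
    congr 1
    · exact m.tr_congr fun b d => by rw [m.nab₂_ric_symm]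
    · rw [← tr_swap]
      exact m.tr_congr fun b d => by rw [m.nab₂_ric_symm]
  rw [m.tr_ric hn] at h2
  simp only [Derivation.leibniz, map_sub, Derivation.map_natCast, Derivation.map_one_eq_zero,
    smul_eq_mul] at h2
  have h3 : m.D c (2 : R) = 0 := Derivation.map_natCast (m.D c) 2
  rw [h3] at h2
  linear_combination -h1 + h2

lemma nab₂_ric_eq (hn : 3 ≤ n) (e a b : Fin n) :
    m.nab₂ m.ric e a b = ((n : R) - 2) * m.nab₂ m.P e a b + m.D e m.J * m.g a b := by
  have h : m.ric = fun a b => ((n : R) - 2) * m.P a b + m.J * m.g a b :=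
    funext₂ fun a b => m.ric_eq hn a b
  have h2 : m.D e (2 : R) = 0 := Derivation.map_natCast (m.D e) 2
  have k : ∀ (k f : Fin n → R) (t : R), ∑ x, k x * (t * f x) = t * ∑ x, k x * f x := by
    intro k f t; rw [Finset.mul_sum]; exact Finset.sum_congr rfl fun _ _ => by ring
  rw [h, nab₂_add]
  simp only [nab₂, Derivation.leibniz, smul_eq_mul, map_sub, Derivation.map_natCast, h2]
  rw [k _ (fun x => m.P x b), k _ (fun x => m.P a x), k _ (fun x => m.g x b),
    k _ (fun x => m.g a x)]
  rw [m.D_g]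
  ring

lemma div_P (hn : 3 ≤ n) (c : Fin n) : m.tr (fun e a => m.nab₂ m.P e a c) = m.D c m.J := by
  apply eq_of_sub_two_mul hn
  have h := m.div_ric hn c
  simp only [m.nab₂_ric_eq hn, tr_add, tr_mul_left, tr_mul_g] at h
  linear_combination h

/-! ### Weyl and Cotton tensors -/

/-- The Weyl tensor. -/
def weyl (a b c d : Fin n) : R :=
  m.riem a b c d - (m.g c a * m.P b d - m.g c b * m.P a d)
    - (m.g d b * m.P a c - m.g d a * m.P b c)

/-- The Cotton tensor. -/
def cotton (a b c : Fin n) : R := m.nab₂ m.P a b c - m.nab₂ m.P b a c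

lemma weyl_skew (a b c d : Fin n) : m.weyl a b c d = - m.weyl b a c d := by
  simp only [weyl]; linear_combination m.riem_skew a b c d

lemma weyl_skew' (a b c d : Fin n) : m.weyl a b c d = - m.weyl a b d c := by
  simp only [weyl]; linear_combination m.riem_skew' a b c d

lemma weyl_pair (a b c d : Fin n) : m.weyl a b c d = m.weyl c d a b := by
  simp only [weyl, m.g_symm a c, m.g_symm a d, m.g_symm b c, m.g_symm b d, m.P_symm d b,
    m.P_symm d a, m.P_symm c b, m.P_symm c a]
  linear_combination m.riem_pair a b c d

lemma weyl_cyclic (a b c d : Fin n) : m.weyl a b c d + m.weyl b d c a + m.weyl d a c b = 0 := by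
  simp only [weyl, m.P_symm d b, m.P_symm d a, m.P_symm b a, m.g_symm d b,
    m.g_symm d a, m.g_symm b a]
  linear_combination m.riem_cyclic a b c d

lemma cotton_skew (a b c : Fin n) : m.cotton a b c = - m.cotton b a c := by
  simp only [cotton]; ring

lemma cotton_cyclic (a b c : Fin n) : m.cotton a b c + m.cotton b c a + m.cotton c a b = 0 := by
  simp only [cotton, m.nab₂_P_symm a c b, m.nab₂_P_symm b c a, m.nab₂_P_symm c b a]; ring

lemma tr_weyl₁₃ (hn : 3 ≤ n) (b d : Fin n) : m.tr (fun a c => m.weyl a b c d) = 0 := by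
  simp only [weyl, tr_sub]
  have h1 : m.tr (fun a c => m.g c a * m.P b d) = n * m.P b d := by
    rw [tr_mul_right, tr_swap m m.g, tr_g]
  have h2 : m.tr (fun a c => m.g c b * m.P a d) = m.P b d := by
    rw [← tr_swap, tr_g_mul m b fun a => m.P a d]
  have h3 : m.tr (fun a c => m.g d b * m.P a c) = m.g d b * m.J := by
    rw [tr_mul_left]; congr 1; exact m.tr_P hn
  have h4 : m.tr (fun a c => m.g d a * m.P b c) = m.P b d := m.tr_g_mul' d fun c => m.P b c
  rw [← ric_eq_tr, h1, h2, h3, h4, m.ric_eq hn, m.g_symm d b]; ring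

lemma tr_weyl₂₄ (hn : 3 ≤ n) (a c : Fin n) : m.tr (fun b d => m.weyl a b c d) = 0 := by
  rw [← m.tr_weyl₁₃ hn a c]
  exact m.tr_congr fun b d => by rw [m.weyl_skew, m.weyl_skew']; ring

lemma tr_weyl₁₄ (hn : 3 ≤ n) (b c : Fin n) : m.tr (fun a d => m.weyl a b c d) = 0 := by
  rw [← neg_zero, ← m.tr_weyl₁₃ hn b c, ← tr_neg]
  exact m.tr_congr fun b d => m.weyl_skew' _ _ _ _

lemma tr_weyl₂₃ (hn : 3 ≤ n) (a d : Fin n) : m.tr (fun b c => m.weyl a b c d) = 0 := by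
  rw [← neg_zero, ← m.tr_weyl₁₃ hn a d, ← tr_neg]
  exact m.tr_congr fun b d => m.weyl_skew _ _ _ _

lemma tr_weyl₃₄ (a b : Fin n) : m.tr (fun c d => m.weyl a b c d) = 0 :=
  m.tr_skew _ fun _ _ => m.weyl_skew' _ _ _ _

lemma tr_weyl₁₂ (c d : Fin n) : m.tr (fun a b => m.weyl a b c d) = 0 :=
  m.tr_skew _ fun _ _ => m.weyl_skew _ _ _ _

lemma tr_cotton₂₃ (hn : 3 ≤ n) (a : Fin n) : m.tr (fun b c => m.cotton a b c) = 0 := by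
  simp only [cotton, tr_sub]
  have h : m.tr (fun b c => m.nab₂ m.P b a c) = m.tr (fun e b => m.nab₂ m.P e b a) :=
    m.tr_congr fun b c => m.nab₂_P_symm _ _ _
  rw [h, m.div_P hn, ← m.tr_P hn, D_tr, sub_self]

lemma tr_cotton₁₃ (hn : 3 ≤ n) (b : Fin n) : m.tr (fun a c => m.cotton a b c) = 0 := by
  rw [← neg_zero, ← m.tr_cotton₂₃ hn b, ← tr_neg]
  exact m.tr_congr fun a c => m.cotton_skew _ _ _

lemma tr_cotton₁₂ (c : Fin n) : m.tr (fun a b => m.cotton a b c) = 0 :=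
  m.tr_skew _ fun _ _ => m.cotton_skew _ _ _

lemma nab₄_weyl (e a b c d : Fin n) : m.nab₄ m.weyl e a b c d = m.nab₄ m.riem e a b c d
    - (m.g c a * m.nab₂ m.P e b d - m.g c b * m.nab₂ m.P e a d)
    - (m.g d b * m.nab₂ m.P e a c - m.g d a * m.nab₂ m.P e b c) := by
  have h : m.weyl = fun a b c d =>
    m.riem a b c d - (m.g c a * m.P b d - m.g c b * m.P a d)
    - (m.g d b * m.P a c - m.g d a * m.P b c) := rfl
  rw [h]
  simp only [nab₄_sub m (fun a b c d => m.riem a b c d - (m.g c a * m.P b d - m.g c b * m.P a d))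
    (fun a b c d => m.g d b * m.P a c - m.g d a * m.P b c),
    nab₄_sub m m.riem (fun a b c d => m.g c a * m.P b d - m.g c b * m.P a d),
    nab₄_sub m (fun a b c d => m.g c a * m.P b d) fun a b c d => m.g c b * m.P a d,
    nab₄_sub m (fun a b c d => m.g d b * m.P a c) fun a b c d => m.g d a * m.P b c]
  have h1 : ∀ a b c d, _ = _ := fun a b c d => m.nab₄_g_mul m.P e a b c d
  have k1 : m.nab₄ (fun a b c d => m.g c a * m.P b d) e a b c d
      = m.nab₄ (fun a b c d => m.g a b * m.P c d) e c a b d := by simp only [nab₄]; ring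
  have k2 : m.nab₄ (fun a b c d => m.g c b * m.P a d) e a b c d
      = m.nab₄ (fun a b c d => m.g a b * m.P c d) e c b a d := by simp only [nab₄]; ring
  have k3 : m.nab₄ (fun a b c d => m.g d b * m.P a c) e a b c d
      = m.nab₄ (fun a b c d => m.g a b * m.P c d) e d b a c := by simp only [nab₄]; ring
  have k4 : m.nab₄ (fun a b c d => m.g d a * m.P b c) e a b c d
      = m.nab₄ (fun a b c d => m.g a b * m.P c d) e d a b c := by simp only [nab₄]; ring
  rw [k1, k2, k3, k4, h1, h1, h1, h1]

/-- The Riemann tensor contributes n - 2 Cotton tensors, the Schouten part subtracts one, and the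
gradients of J cancel because the divergence of P is dJ. -/
lemma div_weyl (hn : 3 ≤ n) (b c d : Fin n) :
    m.tr (fun e a => m.nab₄ m.weyl e a b c d) = ((n : R) - 3) * m.cotton c d b := by
  simp only [nab₄_weyl, tr_sub, div_riem]
  have h1 : m.tr (fun e a => m.g c a * m.nab₂ m.P e b d) = m.nab₂ m.P c b d := by
    rw [← tr_swap, tr_g_mul' m c fun e => m.nab₂ m.P e b d]
  have h2 : m.tr (fun e a => m.g c b * m.nab₂ m.P e a d) = m.g c b * m.D d m.J := by
    rw [tr_mul_left, m.div_P hn]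
  have h3 : m.tr (fun e a => m.g d b * m.nab₂ m.P e a c) = m.g d b * m.D c m.J := by
    rw [tr_mul_left, m.div_P hn]
  have h4 : m.tr (fun e a => m.g d a * m.nab₂ m.P e b c) = m.nab₂ m.P d b c := by
    rw [← tr_swap, tr_g_mul' m d fun e => m.nab₂ m.P e b c]
  rw [h1, h2, h3, h4, m.nab₂_ric_eq hn, m.nab₂_ric_eq hn, cotton, m.nab₂_P_symm c b d,
    m.nab₂_P_symm d b c]
  ring

lemma nab₄_weyl_skew (e a b c d : Fin n) :
    m.nab₄ m.weyl e a b c d = - m.nab₄ m.weyl e b a c d := by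
  rw [← nab₄_swap₁₂, ← nab₄_neg]; congr 1; funext a b c d; exact m.weyl_skew _ _ _ _

lemma nab₄_weyl_pair (e a b c d : Fin n) :
    m.nab₄ m.weyl e a b c d = m.nab₄ m.weyl e c d a b := by
  rw [← nab₄_pair]; congr 1; funext a b c d; exact m.weyl_pair _ _ _ _

lemma nab₃_cotton_skew (e a b c : Fin n) :
    m.nab₃ m.cotton e a b c = - m.nab₃ m.cotton e b a c := by
  rw [← nab₃_swap₁₂, ← nab₃_neg]; congr 1; funext a b c; exact m.cotton_skew _ _ _

lemma nab₃_cotton_cyclic (e a b c : Fin n) :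
    m.nab₃ m.cotton e a b c + m.nab₃ m.cotton e b c a + m.nab₃ m.cotton e c a b = 0 := by
  have h : m.nab₃ (fun a b c => m.cotton a b c + m.cotton b c a + m.cotton c a b) e a b c = 0 := by
    simp [cotton_cyclic, nab₃]
  have k : m.nab₃ (fun a b c => m.cotton c a b) e a b c = m.nab₃ m.cotton e c a b := by
    simp only [nab₃]; ring
  rwa [m.nab₃_add (fun a b c => m.cotton a b c + m.cotton b c a) fun a b c => m.cotton c a b,
    m.nab₃_add m.cotton fun a b c => m.cotton b c a, nab₃_rotate m m.cotton, k] at h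


variable {n : ℕ} {R : Type*} [CommRing R] [Algebra ℝ R] (m : LocalMetric n R)

/-! ### Divergence of the Cotton tensor -/

lemma tr_nab₃_cotton₂₃ (hn : 3 ≤ n) (e a : Fin n) :
    m.tr (fun b c => m.nab₃ m.cotton e a b c) = 0 := by
  rw [← nab₁_tr]
  simp [nab₁, m.tr_cotton₂₃ hn]

lemma nab₃_cotton (e a b c : Fin n) :
    m.nab₃ m.cotton e a b c = m.nab₃ (m.nab₂ m.P) e a b c - m.nab₃ (m.nab₂ m.P) e b a c := by
  have h : m.cotton = fun a b c => m.nab₂ m.P a b c - m.nab₂ m.P b a c := rfl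
  rw [h, m.nab₃_sub (m.nab₂ m.P) fun a b c => m.nab₂ m.P b a c,
    nab₃_swap₁₂ m (m.nab₂ m.P)]

lemma tr_tr_skew_symm (S T : Fin n → Fin n → R) (hS : ∀ a b, S a b = - S b a)
    (hT : ∀ a b, T a b = T b a) :
    m.tr (fun p r => m.tr fun q s => T r s * S p q) = 0 := by
  have h : m.tr (fun p r => m.tr fun q s => T r s * S p q) =
      - m.tr (fun p r => m.tr fun q s => T r s * S p q) := by
    conv_lhs => rw [tr_comm]
    rw [← tr_neg]
    refine m.tr_congr fun p r => ?_
    rw [← tr_neg]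
    exact m.tr_congr fun q s => by rw [hT, hS]; ring
  exact eq_of_two_mul (by linear_combination h)

/-- The exterior derivative of the Cotton tensor in its form indices is, by the Ricci identity, the
curvature acting on P; the first Bianchi identity removes the terms acting on form indices. In the
trace, two Cotton terms vanish by trace-freeness, and the curvature terms vanish since P is
symmetric and commutes with Ric. -/
lemma div_cotton₃ (hn : 3 ≤ n) (a b : Fin n) : m.tr (fun e c => m.nab₃ m.cotton e a b c) = 0 := by
  have key : ∀ e c, m.nab₃ m.cotton e a b c + m.nab₃ m.cotton a b e c - m.nab₃ m.cotton b a e c =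
      - m.tr (fun x y => m.P b x * m.riem e a y c) - m.tr (fun x y => m.P e x * m.riem a b y c)
        + m.tr (fun x y => m.P a x * m.riem e b y c) := by
    intro e c
    have h1 := m.nab₃_nab₂_comm m.P e a b c
    have h2 := m.nab₃_nab₂_comm m.P a b e c
    have h3 := m.nab₃_nab₂_comm m.P b e a c
    have h4 : ∑ x, m.Rup e a x b * m.P x c + ∑ x, m.Rup a b x e * m.P x c
        + ∑ x, m.Rup b e x a * m.P x c = 0 := by
      simp only [← Finset.sum_add_distrib, ← add_mul, Rup_cyclic, zero_mul, Finset.sum_const_zero]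
    have h5 : ∑ x, m.Rup b e x c * m.P a x = - ∑ x, m.Rup e b x c * m.P a x := by
      simp only [m.Rup_skew b e, neg_mul, Finset.sum_neg_distrib]
    simp only [nab₃_cotton, ← sum_Rup_mul_eq_tr]
    linear_combination h1 + h2 + h3 - h4 - h5
  have h0 := m.tr_congr key
  simp only [tr_add, tr_sub, tr_neg, m.tr_nab₃_cotton₂₃ hn] at h0
  have t1 : ∀ a b, m.tr (fun e c => m.tr fun x y => m.P b x * m.riem e a y c) =
      - m.tr (fun x y => m.P b x * m.ric a y) := by
    intro a b
    rw [tr_comm, ← tr_neg]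
    refine m.tr_congr fun x y => ?_
    rw [tr_mul_left, tr_riem₁₄]; ring
  have t2 : m.tr (fun e c => m.tr fun x y => m.P e x * m.riem a b y c) = 0 := by
    have := m.tr_tr_skew_symm (fun y c => m.riem a b y c) m.P (fun _ _ => m.riem_skew' _ _ _ _)
      m.P_symm
    rw [← this, tr_comm, ← tr_swap]
    refine m.tr_congr fun x y => ?_
    rw [← tr_swap]
    exact m.tr_congr fun q s => by rw [m.P_symm]
  have t3 : m.tr (fun x y => m.P b x * m.ric a y) = m.tr (fun x y => m.P a x * m.ric b y) := by
    have e1 : ∀ a b, m.tr (fun x y => m.P b x * m.ric a y) =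
        ((n : R) - 2) * m.tr (fun x y => m.P b x * m.P a y) + m.J * m.P b a := by
      intro a b
      rw [← m.tr_mul_g' a fun x => m.P b x, ← tr_mul_left, ← tr_mul_left, ← tr_add]
      exact m.tr_congr fun x y => by rw [m.ric_eq hn]; ring
    rw [e1, e1, m.P_symm a b, ← m.tr_swap fun x y => m.P b x * m.P a y]
    simp only [mul_comm (m.P b _)]
  rw [t1, t1, t2, t3] at h0
  linear_combination h0

/-! ### The Bach tensor -/

lemma sum_up₂_mul (T f : Fin n → Fin n → R) :
    ∑ p, ∑ q, m.up₂ T p q * f p q = m.tr fun p r => m.tr fun q s => T r s * f p q := by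
  simp only [tr, up₂, Finset.sum_mul, Finset.mul_sum]
  refine Finset.sum_congr rfl fun p _ => ?_
  rw [Finset.sum_comm]
  exact Finset.sum_congr rfl fun _ _ => Finset.sum_congr rfl fun _ _ =>
    Finset.sum_congr rfl fun _ _ => by ring

/-- The Bach tensor. -/
def bach (a b : Fin n) : R :=
  m.tr (fun p q => m.nab₃ m.cotton q p a b) + ∑ p, ∑ q, m.up₂ m.P p q * m.weyl p a q b

lemma up₂_symm {T : Fin n → Fin n → R} (hT : ∀ a b, T a b = T b a) (p q : Fin n) :
    m.up₂ T p q = m.up₂ T q p := by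
  simp only [up₂]
  rw [Finset.sum_comm]
  exact Finset.sum_congr rfl fun _ _ => Finset.sum_congr rfl fun _ _ => by rw [hT]; ring

/-- By the cyclic identity of the Cotton tensor the skew part is a divergence on its third index,
which is zero; the Weyl term is symmetric by pair symmetry. -/
lemma bach_symm (hn : 3 ≤ n) (a b : Fin n) : m.bach a b = m.bach b a := by
  have h1 : m.tr (fun p q => m.nab₃ m.cotton q p a b) - m.tr (fun p q => m.nab₃ m.cotton q p b a)
      = - m.tr (fun e c => m.nab₃ m.cotton e a b c) := by
    rw [← tr_sub, ← tr_neg, ← tr_swap]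
    refine m.tr_congr fun e c => ?_
    linear_combination m.nab₃_cotton_cyclic e a b c - m.nab₃_cotton_skew e b c a
  have h2 : ∑ p, ∑ q, m.up₂ m.P p q * m.weyl p a q b = ∑ p, ∑ q, m.up₂ m.P p q * m.weyl p b q a := by
    rw [Finset.sum_comm]
    exact Finset.sum_congr rfl fun _ _ => Finset.sum_congr rfl fun _ _ => by
      rw [m.up₂_symm m.P_symm, m.weyl_pair]
  rw [m.div_cotton₃ hn] at h1
  rw [bach, bach, h2]; linear_combination h1

lemma tr_bach (hn : 3 ≤ n) : m.tr m.bach = 0 := by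
  have h : m.tr m.bach = m.tr fun a b => m.bach a b := rfl
  rw [h]
  simp only [bach, tr_add]
  rw [tr_comm]
  simp only [m.tr_nab₃_cotton₂₃ hn, tr_zero, tr_sum, tr_mul_left]
  have : ∀ p q, m.tr (fun a b => m.weyl p a q b) = 0 := fun p q => m.tr_weyl₂₄ hn p q
  simp [this]

lemma tr_tr_symm_cotton (T : Fin n → Fin n → R) (hT : ∀ a b, T a b = T b a) (c : Fin n) :
    m.tr (fun p r => m.tr fun q s => T r s * m.cotton p q c) = 0 :=
  m.tr_tr_skew_symm _ _ (fun _ _ => m.cotton_skew _ _ _) hT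

/-- The divergence of the Bach tensor. -/
lemma div_bach (hn : 3 ≤ n) (b : Fin n) : m.tr (fun e a => m.nab₂ m.bach e a b) =
    -((n : R) - 4) * ∑ p, ∑ q, m.up₂ m.P p q * m.cotton q b p := by
  have hB : ∀ e a, m.nab₂ m.bach e a b =
      m.tr (fun p q => m.nab₄ (m.nab₃ m.cotton) e q p a b)
      + (m.tr (fun p r => m.tr fun q s => m.nab₂ m.P e r s * m.weyl p a q b)
      + m.tr (fun p r => m.tr fun q s => m.P r s * m.nab₄ m.weyl e p a q b)) := by
    intro e a
    have h : m.bach = fun a b => m.tr (fun p q => m.nab₃ m.cotton q p a b)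
        + ∑ p, ∑ q, m.up₂ m.P p q * m.weyl p a q b := rfl
    rw [h, nab₂_add, m.nab₂_tr (fun p q a b => m.nab₃ m.cotton q p a b),
      m.nab₂_contract (m.up₂ m.P) fun p q a b => m.weyl p a q b]
    simp only [m.nab₄_swap₁₂ (m.nab₃ m.cotton)]
    have h' : ∀ p q, m.nab₄ (fun p q a b => m.weyl p a q b) e p q a b
      = m.nab₄ m.weyl e p a q b := fun p q => m.nab₄_swap₂₃ _ _ _ _ _ _
    simp only [h', nabUp₂_up₂, Finset.sum_add_distrib, sum_up₂_mul]
  -- the second derivative of the Cotton tensor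
  set S := m.tr (fun e a => m.tr fun p q => m.nab₄ (m.nab₃ m.cotton) e q p a b) with hS
  set N := m.tr (fun p r => m.tr fun q s => m.P r s * m.cotton q b p) with hN
  set U := m.tr (fun e a => m.tr fun p q => m.tr fun x y => m.cotton p a x * m.weyl e q y b) with hU
  have skew4 : ∀ e q p a, m.nab₄ (m.nab₃ m.cotton) e q p a b =
      - m.nab₄ (m.nab₃ m.cotton) e q a p b := by
    intro e q p a
    rw [← nab₄_swap₂₃, ← nab₄_neg]
    congr 1; funext q p a b; exact m.nab₃_cotton_skew _ _ _ _
  -- Exchanging the two derivatives amounts to renaming a skew pair of indices, so S changes sign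
  -- and 2S is a commutator, which the Ricci identity evaluates.
  have hS' : m.tr (fun e a => m.tr fun p q => m.nab₄ (m.nab₃ m.cotton) q e p a b) = - S := by
    rw [tr_comm, hS, ← tr_neg, ← tr_swap]
    refine m.tr_congr fun e a => ?_
    rw [← tr_neg, ← tr_swap]
    exact m.tr_congr fun p q => skew4 _ _ _ _
  have hcomm : S - (- S) = - m.tr (fun e a => m.tr fun p q => m.tr fun x y =>
      m.cotton p a x * m.riem e q y b) := by
    have i1 : m.tr (fun e a => m.tr fun p q => m.tr fun x y => m.cotton x a b * m.riem e q y p)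
        = 0 := by
      rw [← m.tr_tr_symm_cotton m.ric m.ric_symm b, ← tr_swap]
      rw [m.tr_comm fun p r q s => m.ric r s * m.cotton p q b]
      have : ∀ e a, m.tr (fun p q => m.tr fun x y => m.cotton x a b * m.riem e q y p)
          = m.tr (fun x y => m.cotton x a b * m.ric e y) := by
        intro e a
        rw [tr_comm]
        refine m.tr_congr fun x y => ?_
        rw [tr_mul_left, ← tr_swap, tr_riem₂₄]
      simp only [this]
      exact m.tr_congr fun e a => m.tr_congr fun x y => by rw [m.ric_symm]; ring
    have i2 : m.tr (fun e a => m.tr fun p q => m.tr fun x y => m.cotton p x b * m.riem e q y a)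
        = 0 := by
      rw [← neg_zero, ← m.tr_tr_symm_cotton m.ric m.ric_symm b, tr_comm, ← tr_neg]
      refine m.tr_congr fun p q => ?_
      rw [tr_comm, ← tr_neg]
      refine m.tr_congr fun x y => ?_
      rw [tr_mul_left, tr_riem₁₄]; ring
    rw [hS, ← hS', ← tr_sub]
    have : ∀ e a, m.tr (fun p q => m.nab₄ (m.nab₃ m.cotton) e q p a b)
        - m.tr (fun p q => m.nab₄ (m.nab₃ m.cotton) q e p a b) =
        - m.tr (fun p q => m.tr fun x y => m.cotton x a b * m.riem e q y p)
        - m.tr (fun p q => m.tr fun x y => m.cotton p x b * m.riem e q y a)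
        - m.tr (fun p q => m.tr fun x y => m.cotton p a x * m.riem e q y b) := by
      intro e a
      simp only [← tr_sub, ← tr_neg]
      refine m.tr_congr fun p q => ?_
      rw [nab₄_nab₃_comm]
      simp only [sum_Rup_mul_eq_tr, tr_sub, tr_neg]
    rw [m.tr_congr this, tr_sub, tr_sub, tr_neg, i1, i2]; ring
  have hN' : m.tr (fun e a => m.tr fun x y => m.cotton b a x * m.P e y) = - N := by
    rw [hN, tr_comm, ← tr_neg]
    refine m.tr_congr fun x y => ?_
    rw [← tr_neg, ← tr_swap]
    exact m.tr_congr fun a e => by rw [m.cotton_skew, m.P_symm]; ring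
  -- Splitting Riemann into Weyl and Schouten parts; of the four Schouten terms two are traces of
  -- the Cotton tensor.
  have hriem : m.tr (fun e a => m.tr fun p q => m.tr fun x y =>
      m.cotton p a x * m.riem e q y b) = U - 2 * N := by
    have e0 : ∀ e a p q x y, m.cotton p a x * m.riem e q y b = m.cotton p a x * m.weyl e q y b
        + (m.cotton p a x * m.g y e * m.P q b - m.cotton p a x * m.g y q * m.P e b)
        + (m.cotton p a x * m.P e y * m.g b q - m.g b e * (m.cotton p a x * m.P q y)) := by
      intro e a p q x y; simp only [weyl]; ring
    simp only [e0, tr_add, tr_sub, tr_mul_right, tr_mul_left, tr_mul_g]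
    have j1 : m.tr (fun e a => m.tr fun p q => m.cotton p a e * m.P q b) = 0 := by
      rw [tr_comm]
      have : ∀ p, m.tr (fun e a => m.cotton p a e) = 0 := fun p => by
        rw [← m.tr_cotton₂₃ hn p]; exact m.tr_swap _
      simp [tr_mul_right, this, tr_zero]
    have j2 : m.tr (fun e a => m.tr (fun p q => m.cotton p a q) * m.P e b) = 0 := by
      simp [m.tr_cotton₁₃ hn, tr_zero]
    have j3 : m.tr (fun e a => m.tr fun p q => m.tr (fun x y => m.cotton p a x * m.P e y) * m.g b q)
        = - N := by
      rw [← hN']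
      refine m.tr_congr fun e a => ?_
      rw [m.tr_mul_g' b fun p => m.tr (fun x y => m.cotton p a x * m.P e y)]
    have j4 : m.tr (fun e a => m.g b e * m.tr fun p q => m.tr fun x y => m.cotton p a x * m.P q y)
        = N := by
      rw [m.tr_g_mul' b fun a => m.tr fun p q => m.tr fun x y => m.cotton p a x * m.P q y]
      rw [hN, tr_comm]
      exact m.tr_congr fun p q => m.tr_congr fun x y => by rw [m.P_symm]; ring
    rw [j1, j2, j3, j4]; ring
  -- The Weyl tensor is skew in the pair contracted with e and r, so only the skew part of ∇P, half
  -- the Cotton tensor, survives.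
  have hP : 2 * m.tr (fun e a => m.tr fun p r => m.tr fun q s =>
      m.nab₂ m.P e r s * m.weyl p a q b) = U := by
    have h1 : m.tr (fun e a => m.tr fun p r => m.tr fun q s => m.nab₂ m.P e r s * m.weyl p a q b)
        = - m.tr (fun e a => m.tr fun p r => m.tr fun q s =>
            m.nab₂ m.P r e s * m.weyl p a q b) := by
      rw [tr_comm, ← tr_neg, ← tr_swap]
      refine m.tr_congr fun e a => ?_
      rw [← tr_neg, ← tr_swap]
      refine m.tr_congr fun p r => ?_
      rw [← tr_neg]
      exact m.tr_congr fun q s => by rw [m.weyl_skew]; ring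
    have h2 : m.tr (fun e a => m.tr fun p r => m.tr fun q s => m.cotton e r s * m.weyl p a q b)
        = U := by
      rw [hU, tr_comm]
      refine m.tr_congr fun p r => m.tr_congr fun e a => ?_
      rw [← tr_swap]
    rw [two_mul]
    conv_lhs => arg 2; rw [h1]
    rw [← h2, ← sub_eq_add_neg, ← tr_sub]
    refine m.tr_congr fun e a => ?_
    rw [← tr_sub]
    refine m.tr_congr fun p r => ?_
    rw [← tr_sub]
    exact m.tr_congr fun q s => by rw [cotton]; ring
  have hC : m.tr (fun e a => m.tr fun p r => m.tr fun q s => m.P r s * m.nab₄ m.weyl e p a q b)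
      = -((n : R) - 3) * N := by
    rw [tr_comm, hN, ← tr_mul_left]
    refine m.tr_congr fun p r => ?_
    rw [tr_comm, ← tr_mul_left]
    refine m.tr_congr fun q s => ?_
    have := m.div_weyl hn p q b
    rw [tr_mul_left]
    have h' : m.tr (fun e a => m.nab₄ m.weyl e p a q b) = - m.tr (fun e a => m.nab₄ m.weyl e a p q b)
        := by rw [← tr_neg]; exact m.tr_congr fun e a => m.nab₄_weyl_skew _ _ _ _ _
    rw [h', this]; ring
  -- The total is S + U/2 - (n - 3)N with 2S = 2N - U.
  rw [sum_up₂_mul, m.tr_congr hB, tr_add, tr_add, hC, ← hN, ← hS]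
  rw [hriem] at hcomm
  apply eq_of_two_mul
  linear_combination hcomm + hP


lemma sum_TIdx {n : ℕ} {R : Type*} [CommRing R] (f : TIdx n → R) :
    ∑ B, f B = f slotY + (∑ b, f (slotZ b) + f slotX) := by
  simp [Fintype.sum_sum_type]

variable {n : ℕ} {R : Type*} [CommRing R] [Algebra ℝ R] (m : LocalMetric n R)

/-! ### The normal tractor connection -/

/-- The connection form of the normal tractor connection. -/
def tform (a : Fin n) : TIdx n → TIdx n → R
  | Sum.inl _, Sum.inr (Sum.inl b) => if b = a then -1 else 0
  | Sum.inr (Sum.inl b), Sum.inl _ => m.P a b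
  | Sum.inr (Sum.inl b), Sum.inr (Sum.inl c) => - m.Γ c a b
  | Sum.inr (Sum.inl b), Sum.inr (Sum.inr _) => m.g a b
  | Sum.inr (Sum.inr _), Sum.inr (Sum.inl b) => - m.up (m.P a) b
  | _, _ => 0

/-- The normal tractor connection on 2-tractors. -/
def tnab (a : Fin n) (F : TIdx n → TIdx n → R) (B C : TIdx n) : R :=
  m.D a (F B C) + ∑ E, m.tform a B E * F E C + ∑ E, m.tform a C E * F B E

/-- The tractor curvature. -/
def tcurv (a b : Fin n) (B E : TIdx n) : R :=
  m.D a (m.tform b B E) - m.D b (m.tform a B E)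
    + ∑ K, (m.tform a B K * m.tform b K E - m.tform b B K * m.tform a K E)

lemma sum_tcurv_mul (a b : Fin n) (B : TIdx n) (f : TIdx n → R) :
    ∑ x, m.tcurv a b B x * f x = ∑ x, m.D a (m.tform b B x) * f x - ∑ x, m.D b (m.tform a B x) * f x
      + ∑ y, m.tform a B y * ∑ x, m.tform b y x * f x
      - ∑ y, m.tform b B y * ∑ x, m.tform a y x * f x := by
  simp only [← sum_sum_mul_assoc, ← Finset.sum_add_distrib, ← Finset.sum_sub_distrib, tcurv]
  refine Finset.sum_congr rfl fun x _ => ?_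
  simp only [Finset.sum_sub_distrib]
  ring

/-- The form index is not differentiated covariantly, but its Christoffel term is symmetric in a and
b, so the commutator is still the full curvature. -/
lemma tnab_comm (a b : Fin n) (F : TIdx n → TIdx n → R) (B C : TIdx n) :
    m.tnab a (m.tnab b F) B C - m.tnab b (m.tnab a F) B C =
      ∑ E, m.tcurv a b B E * F E C + ∑ E, m.tcurv a b C E * F B E := by
  rw [sum_tcurv_mul, sum_tcurv_mul]
  simp only [tnab, map_add, map_sum, Derivation.leibniz, smul_eq_mul, mul_add,
    Finset.sum_add_distrib, m.D_comm b a]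
  have h := fun a b => sum_mul_sum_comm (m.tform a B) (m.tform b C) F
  rw [h a b, h b a]
  simp only [mul_comm (F _ _)]
  ring

section Slots

variable (a : Fin n) (F : TIdx n → TIdx n → R)

lemma tnab_YY : m.tnab a F slotY slotY =
    m.D a (F slotY slotY) - F (slotZ a) slotY - F slotY (slotZ a) := by
  simp [tnab, tform]; ring

lemma tnab_YZ (c : Fin n) : m.tnab a F slotY (slotZ c) =
    m.nab₁ (fun c => F slotY (slotZ c)) a c - F (slotZ a) (slotZ c) + m.P a c * F slotY slotY
      + m.g a c * F slotY slotX := by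
  simp [tnab, tform, nab₁]; ring

lemma tnab_YX : m.tnab a F slotY slotX =
    m.D a (F slotY slotX) - F (slotZ a) slotX - ∑ b, m.up (m.P a) b * F slotY (slotZ b) := by
  simp [tnab, tform]; ring

lemma tnab_ZZ (c d : Fin n) : m.tnab a F (slotZ c) (slotZ d) =
    m.nab₂ (fun c d => F (slotZ c) (slotZ d)) a c d
      + m.P a c * F slotY (slotZ d) + m.g a c * F slotX (slotZ d)
      + m.P a d * F (slotZ c) slotY + m.g a d * F (slotZ c) slotX := by
  simp [tnab, tform, nab₂]; ring

lemma tnab_ZX (c : Fin n) : m.tnab a F (slotZ c) slotX =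
    m.nab₁ (fun c => F (slotZ c) slotX) a c
      + m.P a c * F slotY slotX + m.g a c * F slotX slotX
      - ∑ b, m.up (m.P a) b * F (slotZ c) (slotZ b) := by
  simp [tnab, tform, nab₁]; ring

end Slots

lemma tnab_symm {F : TIdx n → TIdx n → R} (hF : ∀ B C, F B C = F C B) (a : Fin n) (B C : TIdx n) :
    m.tnab a F B C = m.tnab a F C B := by
  simp only [tnab]
  have h₁ : ∑ E, m.tform a B E * F E C = ∑ E, m.tform a B E * F C E :=
    Finset.sum_congr rfl fun E _ => by rw [hF E C]
  have h₂ : ∑ E, m.tform a C E * F B E = ∑ E, m.tform a C E * F E B :=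
    Finset.sum_congr rfl fun E _ => by rw [hF B E]
  rw [h₁, h₂, hF B C]
  ring

lemma tnab_add (a : Fin n) (F G : TIdx n → TIdx n → R) (B C : TIdx n) :
    m.tnab a (fun B C => F B C + G B C) B C = m.tnab a F B C + m.tnab a G B C := by
  simp only [tnab, map_add, mul_add, Finset.sum_add_distrib]; ring

/-! ### The tractor curvature -/

lemma tcurv_Y (a b : Fin n) (E : TIdx n) : m.tcurv a b slotY E = 0 := by
  rcases E with _ | d | _
  · simp [tcurv, tform, m.P_symm a b]
  · have h : ∀ a : Fin n, m.D a (if d = b then (-1 : R) else 0) = 0 := by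
      intro a; split_ifs <;> simp
    have h' : ∀ b : Fin n, m.D b (if d = a then (-1 : R) else 0) = 0 := by
      intro a; split_ifs <;> simp
    simp [tcurv, tform, m.Γ_symm _ a b, h, h']
  · simp [tcurv, tform, m.g_symm a b]

lemma tcurv_ZY (a b c : Fin n) : m.tcurv a b (slotZ c) slotY = m.cotton a b c := by
  simp [tcurv, tform, cotton, nab₂, m.Γ_symm _ b a]; ring

lemma tcurv_ZX (a b c : Fin n) : m.tcurv a b (slotZ c) slotX = 0 := by
  simp only [tcurv, sum_TIdx, tform, m.D_g, m.Γ_symm _ b a]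
  simp only [mul_zero, neg_mul, Finset.sum_sub_distrib, Finset.sum_neg_distrib]
  ring

/-- The products of connection entries passing through the slots Y and X are exactly the Schouten
terms subtracted from Riemann in the Weyl tensor. -/
lemma tcurv_ZZ (a b c d : Fin n) :
    m.tcurv a b (slotZ c) (slotZ d) = m.up (m.weyl a b c) d := by
  have h : m.up (m.weyl a b c) d = - m.Rup a b d c
      - ((m.g c a * m.up (m.P b) d - m.g c b * m.up (m.P a) d)
      + ((if b = d then 1 else 0) * m.P a c - (if a = d then 1 else 0) * m.P b c)) := by
    simp only [eq_comm (b := d), ← m.gi_g d b, ← m.gi_g d a, Rup_eq, up, Finset.mul_sum, Finset.sum_mul,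
      ← Finset.sum_sub_distrib, ← Finset.sum_neg_distrib, ← Finset.sum_add_distrib]
    refine Finset.sum_congr rfl fun q _ => ?_
    rw [weyl, m.riem_skew' a b c q, m.g_symm q b, m.g_symm q a]; ring
  rw [h]
  simp only [tcurv, sum_TIdx, tform, Rup, map_neg, m.g_symm c, eq_comm (b := d)]
  simp only [mul_ite, mul_zero, ite_mul, zero_mul, one_mul, mul_neg, mul_one, neg_mul, neg_neg,
    Finset.sum_sub_distrib, mul_comm (m.Γ d _ _)]
  split_ifs <;> ring

lemma tcurv_XX (a b : Fin n) : m.tcurv a b slotX slotX = 0 := by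
  have h : ∀ a b, ∑ c, m.up (m.P a) c * m.g b c = m.P a b := by
    intro a b
    rw [← m.sum_g_gi_mul b (m.P a)]
    exact Finset.sum_congr rfl fun _ _ => by rw [up]; ring
  simp [tcurv, tform, h, m.P_symm a b]

lemma tcurv_XY (a b : Fin n) : m.tcurv a b slotX slotY = 0 := by
  have h : ∀ a b, ∑ c, m.up (m.P a) c * m.P b c = m.tr fun x y => m.P b x * m.P a y := by
    intro a b
    rw [tr_mul_eq_up]
    exact Finset.sum_congr rfl fun _ _ => by ring
  have h' : m.tr (fun x y => m.P b x * m.P a y) = m.tr fun x y => m.P a x * m.P b y := by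
    rw [← tr_swap]; exact m.tr_congr fun x y => mul_comm _ _
  simp only [tcurv, sum_TIdx, tform]
  simp only [map_zero, mul_zero, neg_mul, Finset.sum_sub_distrib, Finset.sum_neg_distrib, h, h']
  ring

lemma tcurv_XZ (a b d : Fin n) : m.tcurv a b slotX (slotZ d) = - m.up (m.cotton a b) d := by
  have h := fun a b => m.nabUp₁_up (m.P b) a d
  have k : ∀ a b c, m.nab₁ (m.P b) a c = m.nab₂ m.P a b c + ∑ e, m.Γ e a b * m.P e c := by
    intro a b c; simp only [nab₁, nab₂]; ring
  have e : m.up (m.cotton a b) d = m.up (m.nab₁ (m.P b) a) d - m.up (m.nab₁ (m.P a) b) d := by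
    simp only [up, ← Finset.sum_sub_distrib, ← mul_sub, k, cotton]
    refine Finset.sum_congr rfl fun q _ => ?_
    simp only [m.Γ_symm _ b a]; ring
  rw [e, ← h, ← h]
  simp only [tcurv, sum_TIdx, tform, nabUp₁]
  simp only [zero_mul, map_neg, neg_mul, mul_neg, neg_neg, Finset.sum_sub_distrib,
    mul_comm (m.up _ _)]
  ring


variable {n : ℕ} {R : Type*} [CommRing R] [Algebra ℝ R] (m : LocalMetric n R)

/-! ### Raising indices -/

lemma up_add (u v : Fin n → R) (q : Fin n) :
    m.up (fun q => u q + v q) q = m.up u q + m.up v q := by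
  simp [up, mul_add, Finset.sum_add_distrib]

lemma up_zero (q : Fin n) : m.up (fun _ => 0) q = 0 := by simp [up]

lemma up₂_add (S T : Fin n → Fin n → R) (p q : Fin n) :
    m.up₂ (fun p q => S p q + T p q) p q = m.up₂ S p q + m.up₂ T p q := by
  simp [up₂, mul_add, Finset.sum_add_distrib]

lemma up₂_sub (S T : Fin n → Fin n → R) (p q : Fin n) :
    m.up₂ (fun p q => S p q - T p q) p q = m.up₂ S p q - m.up₂ T p q := by
  simp [up₂, mul_sub, Finset.sum_sub_distrib]

lemma up₂_mul_right (S : Fin n → Fin n → R) (k : R) (p q : Fin n) :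
    m.up₂ (fun p q => S p q * k) p q = m.up₂ S p q * k := by
  simp only [up₂, Finset.sum_mul, mul_assoc]

lemma up_g (a p : Fin n) : m.up (m.g a) p = if p = a then 1 else 0 := by
  rw [← m.gi_g p a, up]
  exact Finset.sum_congr rfl fun _ _ => by rw [m.g_symm]

lemma up₂_mul (u v : Fin n → R) (p q : Fin n) :
    m.up₂ (fun p q => u p * v q) p q = m.up u p * m.up v q := by
  simp only [up₂, up, Finset.sum_mul_sum]
  exact Finset.sum_congr rfl fun _ _ => Finset.sum_congr rfl fun _ _ => by ring

lemma up₂_g (p q : Fin n) : m.up₂ m.g p q = m.gi p q := by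
  have h : m.up₂ m.g p q = ∑ r, m.gi p r * m.up (m.g r) q := by
    simp only [up₂, up, Finset.mul_sum, mul_assoc]
  rw [h]; simp [up_g]

lemma tr_sum_mul_up (Y f : Fin n → Fin n → R) :
    m.tr (fun a d => ∑ q, f d q * m.up (Y a) q) = ∑ p, ∑ q, m.up₂ Y p q * f p q := by
  rw [sum_up₂_mul, ← tr_swap]
  refine m.tr_congr fun p r => ?_
  rw [← tr_mul_eq_up]
  exact m.tr_congr fun q s => mul_comm _ _

/-- Against a symmetric tensor only the symmetrised coefficient counts. Coefficients of the ZZ slot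
of a symmetric tractor are compared through this lemma. -/
lemma sum_up₂_mul_eq_zero {T f : Fin n → Fin n → R} (hT : ∀ p q, T p q = T q p)
    (hf : ∀ p q, f p q + f q p = 0) : ∑ p, ∑ q, m.up₂ T p q * f p q = 0 := by
  have h : ∑ p, ∑ q, m.up₂ T p q * f p q = ∑ p, ∑ q, m.up₂ T p q * f q p := by
    rw [Finset.sum_comm]
    exact Finset.sum_congr rfl fun _ _ => Finset.sum_congr rfl fun _ _ => by
      rw [m.up₂_symm hT]
  apply eq_of_two_mul
  rw [two_mul]
  conv_lhs => arg 2; rw [h]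
  simp only [← Finset.sum_add_distrib, ← mul_add, hf]
  simp

/-! ### The modification of the tractor connection -/

/-- The constant `1 / 3`. -/
def third (_ : LocalMetric n R) : R := algebraMap ℝ R (1 / 3)

/-- The constant `1 / n`. -/
def invDim (_ : LocalMetric n R) : R := algebraMap ℝ R (1 / (n : ℝ))

/-- The constant `1 / (n - 1)`. -/
def invDimPred (_ : LocalMetric n R) : R := algebraMap ℝ R (1 / ((n : ℝ) - 1))

lemma three_mul_third : 3 * m.third = 1 := by
  rw [third, ← map_ofNat (algebraMap ℝ R) 3, ← map_mul]; norm_num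

lemma dim_mul_invDim (hn : 3 ≤ n) : n * m.invDim = 1 := by
  have h : (n : ℝ) ≠ 0 := by
    have : (3 : ℝ) ≤ n := by exact_mod_cast hn
    linarith
  rw [invDim, ← map_natCast (algebraMap ℝ R) n, ← map_mul, mul_one_div_cancel h, map_one]

lemma dimPred_mul_invDimPred (hn : 3 ≤ n) : ((n : R) - 1) * m.invDimPred = 1 :=
  cast_sub_one_mul hn

lemma D_third (a : Fin n) : m.D a m.third = 0 := Derivation.map_algebraMap _ _

lemma D_invDim (a : Fin n) : m.D a m.invDim = 0 := Derivation.map_algebraMap _ _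

/-- `2 C_{b(cd)q}`. -/
def weylS (b c d q : Fin n) : R := m.weyl b c d q + m.weyl b d c q

/-- `2 A_{b(cd)}`. -/
def cottonS (b c d : Fin n) : R := m.cotton b c d + m.cotton b d c

/-- `2 A_{b(cq)} + 2 (n - 4) / n A_{q(bc)}`. -/
def cottonE (b c q : Fin n) : R := m.cottonS b c q + (1 - 4 * m.invDim) * m.cottonS q b c

/-- `C_b{}^{(rs)p} C_{krsp}`. -/
def weylWeyl (b k : Fin n) : R :=
  algebraMap ℝ R (1 / 2) * m.tr fun r r' => m.tr fun s s' => m.tr fun p p' =>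
    m.weylS b r' s' p' * m.weyl k r s p

/-- `C_b{}^{(rs)p} A_{prs}`. -/
def weylCotton (b : Fin n) : R :=
  algebraMap ℝ R (1 / 2) * m.tr fun r r' => m.tr fun s s' => m.tr fun p p' =>
    m.weylS b r' s' p' * m.cotton p r s

/-- The `Z Z` slot of the modification. -/
def modZZ (s : R) (μ : Fin n → R) (b c d : Fin n) : R :=
  - m.third * (∑ q, m.weylS b c d q * m.up μ q + m.cottonS b c d * s)

/-- The `Z X` slot of the modification. -/
def modZX (s : R) (μ : Fin n → R) (w : Fin n → Fin n → R) (b c : Fin n) : R :=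
  -(4 * m.third * m.invDim) * (∑ p, ∑ q, m.up₂ w p q * m.weyl b p q c)
    + m.third * (∑ q, m.cottonE b c q * m.up μ q) - m.third * m.invDim * (m.bach b c * s)

/-- The `X X` slot of the modification. -/
def modXX (s : R) (μ : Fin n → R) (w : Fin n → Fin n → R) (b : Fin n) : R :=
  -(8 * m.third * m.invDim) * (∑ p, ∑ q, m.up₂ w p q * m.cotton b p q)
    + 2 * m.third * m.invDim *
      (∑ q, (m.bach b q + 4 * m.third * m.invDimPred * m.weylWeyl b q) * m.up μ q)
    + 8 * m.third ^ 2 * m.invDim * m.invDimPred * (m.weylCotton b * s)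

/-- The modification of the tractor connection. -/
def modif (b : Fin n) (F : TIdx n → TIdx n → R) : TIdx n → TIdx n → R
  | Sum.inr (Sum.inl c), Sum.inr (Sum.inl d) =>
    m.modZZ (F slotY slotY) (fun q => F slotY (slotZ q)) b c d
  | Sum.inr (Sum.inl c), Sum.inr (Sum.inr _) =>
    m.modZX (F slotY slotY) (fun q => F slotY (slotZ q)) (fun p q => F (slotZ p) (slotZ q)) b c
  | Sum.inr (Sum.inr _), Sum.inr (Sum.inl c) =>
    m.modZX (F slotY slotY) (fun q => F slotY (slotZ q)) (fun p q => F (slotZ p) (slotZ q)) b c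
  | Sum.inr (Sum.inr _), Sum.inr (Sum.inr _) =>
    m.modXX (F slotY slotY) (fun q => F slotY (slotZ q)) (fun p q => F (slotZ p) (slotZ q)) b
  | _, _ => 0

lemma modZZ_add (s s' : R) (μ μ' : Fin n → R) (b c d : Fin n) :
    m.modZZ (s + s') (fun q => μ q + μ' q) b c d = m.modZZ s μ b c d + m.modZZ s' μ' b c d := by
  simp only [modZZ, up_add, mul_add, Finset.sum_add_distrib]; ring

lemma modZX_add (s s' : R) (μ μ' : Fin n → R) (w w' : Fin n → Fin n → R) (b c : Fin n) :
    m.modZX (s + s') (fun q => μ q + μ' q) (fun p q => w p q + w' p q) b c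
      = m.modZX s μ w b c + m.modZX s' μ' w' b c := by
  simp only [modZX, up_add, up₂_add, mul_add, add_mul, Finset.sum_add_distrib]; ring

lemma modXX_add (s s' : R) (μ μ' : Fin n → R) (w w' : Fin n → Fin n → R) (b : Fin n) :
    m.modXX (s + s') (fun q => μ q + μ' q) (fun p q => w p q + w' p q) b
      = m.modXX s μ w b + m.modXX s' μ' w' b := by
  simp only [modXX, up_add, up₂_add, mul_add, add_mul, Finset.sum_add_distrib]; ring

lemma modif_add (b : Fin n) (F G : TIdx n → TIdx n → R) (B C : TIdx n) :
    m.modif b (fun B C => F B C + G B C) B C = m.modif b F B C + m.modif b G B C := by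
  rcases B with _ | c | _ <;> rcases C with _ | d | _ <;>
    simp [modif, modZZ_add, modZX_add, modXX_add]

lemma weylS_symm (b c d q : Fin n) : m.weylS b c d q = m.weylS b d c q := add_comm _ _

lemma cottonS_symm (b c d : Fin n) : m.cottonS b c d = m.cottonS b d c := add_comm _ _

lemma modZZ_symm (s : R) (μ : Fin n → R) (b c d : Fin n) :
    m.modZZ s μ b c d = m.modZZ s μ b d c := by
  simp only [modZZ, m.weylS_symm b c d, m.cottonS_symm b c d]

lemma modif_symm (b : Fin n) (F : TIdx n → TIdx n → R) (B C : TIdx n) :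
    m.modif b F B C = m.modif b F C B := by
  rcases B with _ | c | _ <;> rcases C with _ | d | _ <;> simp [modif, m.modZZ_symm]

/-! ### Algebraic identities for the modification -/

lemma tr_weylS₁₃ (hn : 3 ≤ n) (c q : Fin n) : m.tr (fun b d => m.weylS b c d q) = 0 := by
  simp [weylS, tr_add, m.tr_weyl₁₃ hn, m.tr_weyl₁₂]

lemma tr_cottonS₁₃ (hn : 3 ≤ n) (c : Fin n) : m.tr (fun b d => m.cottonS b c d) = 0 := by
  simp [cottonS, tr_add, m.tr_cotton₁₃ hn, m.tr_cotton₁₂]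

/-- Trace-freeness is used twice: it is needed for lying in the image of ∂^*, and it removes from
the traced curvature the terms in which the derivative hits this slot. -/
lemma tr_modZZ₁₃ (hn : 3 ≤ n) (s : R) (μ : Fin n → R) (c : Fin n) :
    m.tr (fun b d => m.modZZ s μ b c d) = 0 := by
  simp only [modZZ, tr_mul_left, tr_add, tr_sum, tr_mul_right, m.tr_weylS₁₃ hn, m.tr_cottonS₁₃ hn]
  simp

lemma tr_modZZ₂₃ (hn : 3 ≤ n) (s : R) (μ : Fin n → R) (b : Fin n) :
    m.tr (fun c d => m.modZZ s μ b c d) = 0 := by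
  have h : ∀ q, m.tr (fun d c => m.weyl b c d q) = 0 := fun q => by
    rw [← m.tr_weyl₂₃ hn b q]; exact m.tr_swap _
  have h' : m.tr (fun d c => m.cotton b c d) = 0 := by
    rw [← m.tr_cotton₂₃ hn b]; exact m.tr_swap _
  simp only [modZZ, tr_mul_left, tr_add, tr_sum, tr_mul_right, weylS, cottonS, m.tr_weyl₂₃ hn,
    m.tr_cotton₂₃ hn, h, h']
  simp

lemma tr_modZX (hn : 3 ≤ n) (s : R) (μ : Fin n → R) (w : Fin n → Fin n → R) :
    m.tr (fun b c => m.modZX s μ w b c) = 0 := by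
  have h' : ∀ q, m.tr (fun b c => m.cotton q c b) = 0 := fun q => by
    rw [← m.tr_cotton₂₃ hn q]; exact m.tr_swap _
  have hB : m.tr (fun b c => m.bach b c) = 0 := m.tr_bach hn
  have hC : ∀ p q, m.tr (fun b c => m.weyl b p q c) = 0 := m.tr_weyl₁₄ hn
  have hA : ∀ q, m.tr (fun b c => m.cotton b c q) = 0 := m.tr_cotton₁₂
  simp only [modZX, tr_mul_left, tr_add, tr_sub, tr_sum, tr_mul_right, cottonE, cottonS, hC,
    m.tr_cotton₂₃ hn, h', hB, hA, m.tr_cotton₁₃ hn]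
  simp

/-- By the first Bianchi identity, skewing a symmetrised Weyl or Cotton tensor returns three copies
of the original, which fixes the factor 1/3. The right-hand side is the YZ slot contribution of the
tractor curvature, which is thereby cancelled. -/
lemma modZZ_skew (s : R) (μ : Fin n → R) (a b c : Fin n) :
    m.modZZ s μ b a c - m.modZZ s μ a b c =
      ∑ q, m.weyl a b c q * m.up μ q + m.cotton a b c * s := by
  have h1 : ∑ q, m.weylS b a c q * m.up μ q - ∑ q, m.weylS a b c q * m.up μ q
      = -3 * ∑ q, m.weyl a b c q * m.up μ q := by
    rw [Finset.mul_sum, ← Finset.sum_sub_distrib]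
    refine Finset.sum_congr rfl fun q _ => ?_
    simp only [weylS]
    linear_combination (m.up μ q) * (m.weyl_skew b a c q - m.weyl_skew a c b q
      + m.weyl_skew' a b c q + m.weyl_skew' b c a q + m.weyl_skew' c a b q - m.weyl_cyclic a b q c)
  have h2 : m.cottonS b a c - m.cottonS a b c = -3 * m.cotton a b c := by
    simp only [cottonS]
    linear_combination m.cotton_skew b a c + m.cotton_cyclic a b c - m.cotton_skew a c b
  simp only [modZZ]
  linear_combination (- m.third) * h1 - m.third * s * h2
    + (∑ q, m.weyl a b c q * m.up μ q + m.cotton a b c * s) * m.three_mul_third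


/-! ### Derivatives of the modification and the curvature of the modified connection -/

variable {n : ℕ} {R : Type*} [CommRing R] [Algebra ℝ R] (m : LocalMetric n R)

lemma nab₃_const_mul (k : R) (T : Fin n → Fin n → Fin n → R) (e a b c : Fin n)
    (hk : m.D e k = 0) :
    m.nab₃ (fun a b c => k * T a b c) e a b c = k * m.nab₃ T e a b c := by
  simp only [nab₃, Derivation.leibniz, smul_eq_mul, hk, mul_left_comm _ k, ← Finset.mul_sum]; ring

lemma nab₂_const_mul (k : R) (T : Fin n → Fin n → R) (e a b : Fin n) (hk : m.D e k = 0) :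
    m.nab₂ (fun a b => k * T a b) e a b = k * m.nab₂ T e a b := by
  simp only [nab₂, Derivation.leibniz, smul_eq_mul, hk, mul_left_comm _ k, ← Finset.mul_sum]; ring

lemma nab₃_mul_fun (T : Fin n → Fin n → Fin n → R) (s : R) (e a b c : Fin n) :
    m.nab₃ (fun a b c => T a b c * s) e a b c = m.nab₃ T e a b c * s + T a b c * m.D e s := by
  simp only [nab₃, Derivation.leibniz, smul_eq_mul, ← mul_assoc, ← Finset.sum_mul]; ring

lemma nab₂_mul_fun (T : Fin n → Fin n → R) (s : R) (e a b : Fin n) :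
    m.nab₂ (fun a b => T a b * s) e a b = m.nab₂ T e a b * s + T a b * m.D e s := by
  simp only [nab₂, Derivation.leibniz, smul_eq_mul, ← mul_assoc, ← Finset.sum_mul]; ring

lemma nab₂_sub (S T : Fin n → Fin n → R) (e a b : Fin n) :
    m.nab₂ (fun a b => S a b - T a b) e a b = m.nab₂ S e a b - m.nab₂ T e a b := by
  simp only [nab₂, map_sub, mul_sub, Finset.sum_sub_distrib]; ring

/-- The derivative of the coefficients of the `Z Z` slot of the modification. -/
def dModZZ (s : R) (μ : Fin n → R) (a b c d : Fin n) : R :=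
  - m.third * (∑ q, m.nab₄ m.weylS a b c d q * m.up μ q + m.nab₃ m.cottonS a b c d * s)

/-- Leibniz rule separating the derivative of the tractor components from that of the curvature
coefficients; the first part will cancel against Φ(∇F). -/
lemma nab₃_modZZ (s : R) (μ : Fin n → R) (a b c d : Fin n) :
    m.nab₃ (m.modZZ s μ) a b c d =
      m.modZZ (m.D a s) (m.nab₁ μ a) b c d + m.dModZZ s μ a b c d := by
  have h : m.modZZ s μ = fun b c d =>
    - m.third * (∑ q, m.weylS b c d q * m.up μ q + m.cottonS b c d * s) := rfl
  rw [h, nab₃_const_mul, nab₃_add, nab₃_contract, nab₃_mul_fun, modZZ, dModZZ]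
  · simp only [nabUp₁_up, Finset.sum_add_distrib]; ring
  · simp [D_third]

/-- The derivative of the coefficients of the `Z X` slot of the modification. -/
def dModZX (s : R) (μ : Fin n → R) (w : Fin n → Fin n → R) (a b c : Fin n) : R :=
  -(4 * m.third * m.invDim) * (∑ p, ∑ q, m.up₂ w p q * m.nab₄ m.weyl a b p q c)
    + m.third * (∑ q, m.nab₃ m.cottonE a b c q * m.up μ q)
    - m.third * m.invDim * (m.nab₂ m.bach a b c * s)

lemma nab₂_modZX (s : R) (μ : Fin n → R) (w : Fin n → Fin n → R) (a b c : Fin n) :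
    m.nab₂ (m.modZX s μ w) a b c =
      m.modZX (m.D a s) (m.nab₁ μ a) (m.nab₂ w a) b c + m.dModZX s μ w a b c := by
  have h : m.modZX s μ w = fun b c =>
    -(4 * m.third * m.invDim) * (∑ p, ∑ q, m.up₂ w p q * m.weyl b p q c)
    + m.third * (∑ q, m.cottonE b c q * m.up μ q)
    - m.third * m.invDim * (m.bach b c * s) := rfl
  have h4 : m.D a (4 : R) = 0 := Derivation.map_natCast (m.D a) 4
  have hp : ∀ p q, m.nab₄ (fun p q b c => m.weyl b p q c) a p q b c = m.nab₄ m.weyl a b p q c := by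
    intro p q; simp only [nab₄]; ring
  rw [h, nab₂_sub m (fun b c => -(4 * m.third * m.invDim) *
    (∑ p, ∑ q, m.up₂ w p q * m.weyl b p q c) + m.third * (∑ q, m.cottonE b c q * m.up μ q)),
    nab₂_add, nab₂_const_mul, nab₂_const_mul, nab₂_const_mul, nab₂_mul_fun, nab₂_contract₁,
    m.nab₂_contract (m.up₂ w) fun p q b c => m.weyl b p q c, modZX, dModZX]
  · simp only [nabUp₁_up, nabUp₂_up₂, Finset.sum_add_distrib, hp]; ring
  · simp [D_third, D_invDim]
  · simp [D_third]
  · simp [D_third, D_invDim, h4]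

/-- The modified connection. -/
def modNab (a : Fin n) (F : TIdx n → TIdx n → R) (B C : TIdx n) : R :=
  m.tnab a F B C + m.modif a F B C

/-- The curvature of the modified connection. -/
def modCurv (a b : Fin n) (F : TIdx n → TIdx n → R) (B C : TIdx n) : R :=
  m.modNab a (m.modNab b F) B C - m.modNab b (m.modNab a F) B C

/-- The usual decomposition into the curvature of ∇, the exterior covariant derivative of Φ, and the
commutator of Φ with itself. -/
lemma modCurv_eq (a b : Fin n) (F : TIdx n → TIdx n → R) (B C : TIdx n) :
    m.modCurv a b F B C = (∑ E, m.tcurv a b B E * F E C + ∑ E, m.tcurv a b C E * F B E)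
      + (m.tnab a (m.modif b F) B C + m.modif a (m.tnab b F) B C)
      - (m.tnab b (m.modif a F) B C + m.modif b (m.tnab a F) B C)
      + (m.modif a (m.modif b F) B C - m.modif b (m.modif a F) B C) := by
  have h : ∀ b, m.modNab b F = fun B C => m.tnab b F B C + m.modif b F B C := fun _ => rfl
  rw [← tnab_comm, modCurv, h, h]
  simp only [modNab, tnab_add, modif_add]
  ring

section Slots

variable {F : TIdx n → TIdx n → R}

lemma modCurv_YY (a b : Fin n) : m.modCurv a b F slotY slotY = 0 := by
  simp [modCurv_eq, tcurv_Y, tnab_YY, modif]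

lemma sum_up_mul (u v : Fin n → R) : ∑ q, m.up u q * v q = ∑ q, u q * m.up v q := by
  rw [← tr_mul_eq_up, ← tr_swap]
  simp only [mul_comm (u _), tr_mul_eq_up]
  exact Finset.sum_congr rfl fun _ _ => mul_comm _ _

lemma modCurv_YZ (a b c : Fin n) : m.modCurv a b F slotY (slotZ c) = 0 := by
  have h := m.modZZ_skew (F slotY slotY) (fun q => F slotY (slotZ q)) a b c
  rw [← sum_up_mul] at h
  simp only [modCurv_eq, tcurv_Y, tnab_YZ, modif, sum_TIdx, tcurv_ZY, tcurv_ZZ, tcurv_ZX, nab₁]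
  simp only [map_zero, mul_zero, zero_mul, Finset.sum_const_zero]
  linear_combination -h

/-- The Weyl and Bach terms are symmetric, so only the Cotton term contributes. Its coefficients 1
and 1 - 4/n matter here only through the first, the second multiplying a symmetric expression. The
result cancels the YX slot of the tractor curvature. -/
lemma modZX_skew (hn : 3 ≤ n) (s : R) (μ : Fin n → R) (w : Fin n → Fin n → R)
    (hw : ∀ p q, w p q = w q p) (a b : Fin n) :
    m.modZX s μ w a b - m.modZX s μ w b a = ∑ q, m.cotton a b q * m.up μ q := by
  have h1 : ∑ p, ∑ q, m.up₂ w p q * m.weyl a p q b = ∑ p, ∑ q, m.up₂ w p q * m.weyl b p q a := by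
    rw [← sub_eq_zero]
    simp only [← Finset.sum_sub_distrib, ← mul_sub]
    refine m.sum_up₂_mul_eq_zero hw fun p q => ?_
    linear_combination m.weyl_pair a p q b + m.weyl_skew q b a p - m.weyl_skew' b q a p
      + m.weyl_pair a q p b + m.weyl_skew p b a q - m.weyl_skew' b p a q
  have h2 : ∑ q, m.cottonE a b q * m.up μ q - ∑ q, m.cottonE b a q * m.up μ q
      = 3 * ∑ q, m.cotton a b q * m.up μ q := by
    rw [Finset.mul_sum, ← Finset.sum_sub_distrib]
    refine Finset.sum_congr rfl fun q _ => ?_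
    simp only [cottonE, cottonS]
    linear_combination (m.up μ q) *
      (m.cotton_skew a q b - m.cotton_skew b a q - m.cotton_cyclic a b q)
  simp only [modZX, m.bach_symm hn b a]
  linear_combination (-(4 * m.third * m.invDim)) * h1 + m.third * h2
    + (∑ q, m.cotton a b q * m.up μ q) * m.three_mul_third

lemma modCurv_YX (hn : 3 ≤ n) (hF : ∀ B C, F B C = F C B) (a b : Fin n) :
    m.modCurv a b F slotY slotX = 0 := by
  have h := m.modZX_skew hn (F slotY slotY) (fun q => F slotY (slotZ q))
    (fun p q => F (slotZ p) (slotZ q)) (fun _ _ => hF _ _) a b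
  rw [← sum_up_mul] at h
  simp only [modCurv_eq, tcurv_Y, tnab_YX, modif, sum_TIdx, tcurv_XY, tcurv_XZ, tcurv_XX]
  simp only [map_zero, mul_zero, zero_mul, Finset.sum_const_zero, neg_mul, Finset.sum_neg_distrib]
  linear_combination h

lemma modZZ_zero (b c d : Fin n) : m.modZZ 0 (fun _ => 0) b c d = 0 := by
  simp [modZZ, up_zero]

lemma modCurv_ZZ (a b c d : Fin n) : m.modCurv a b F (slotZ c) (slotZ d) =
    m.cotton a b c * F slotY (slotZ d) + ∑ e, m.up (m.weyl a b c) e * F (slotZ e) (slotZ d)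
    + (m.cotton a b d * F (slotZ c) slotY + ∑ e, m.up (m.weyl a b d) e * F (slotZ c) (slotZ e))
    + (m.nab₃ (m.modZZ (F slotY slotY) fun q => F slotY (slotZ q)) a b c d
      - m.modif b (m.tnab a F) (slotZ c) (slotZ d)
      + m.g a c * m.modif b F (slotZ d) slotX + m.g a d * m.modif b F (slotZ c) slotX)
    - (m.nab₃ (m.modZZ (F slotY slotY) fun q => F slotY (slotZ q)) b a c d
      - m.modif a (m.tnab b F) (slotZ c) (slotZ d)
      + m.g b c * m.modif a F (slotZ d) slotX + m.g b d * m.modif a F (slotZ c) slotX) := by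
  rw [modCurv_eq, tnab_ZZ, tnab_ZZ]
  -- The ZZ slot of Φ reads only slots containing Y, and these vanish for anything in the image of
  -- Φ; there is no quadratic term here.
  have e1 : m.modif a (m.modif b F) (slotZ c) (slotZ d) = 0 := m.modZZ_zero a c d
  have e2 : m.modif b (m.modif a F) (slotZ c) (slotZ d) = 0 := m.modZZ_zero b c d
  rw [e1, e2]
  simp only [sum_TIdx, tcurv_ZY, tcurv_ZZ, tcurv_ZX]
  -- The Christoffel correction for the form index b is symmetric in a and b and drops out of the
  -- curvature.
  have h : ∀ a b, m.nab₂ (fun c d => m.modif b F (slotZ c) (slotZ d)) a c d =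
      m.nab₃ (m.modZZ (F slotY slotY) fun q => F slotY (slotZ q)) a b c d
      + ∑ e, m.Γ e a b * m.modZZ (F slotY slotY) (fun q => F slotY (slotZ q)) e c d := by
    intro a b; simp only [nab₂, nab₃, modif]; ring
  rw [h, h]
  simp only [m.Γ_symm _ b a]
  have z1 : ∀ b d, m.modif b F slotY (slotZ d) = 0 := fun _ _ => rfl
  have z2 : ∀ b d, m.modif b F (slotZ d) slotY = 0 := fun _ _ => rfl
  have z3 : ∀ b d, m.modif b F slotX (slotZ d) = m.modif b F (slotZ d) slotX := fun _ _ => rfl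
  simp only [z1, z2, z3]
  ring

lemma modCurv_ZX (a b c : Fin n) : m.modCurv a b F (slotZ c) slotX =
    m.cotton a b c * F slotY slotX + ∑ e, m.up (m.weyl a b c) e * F (slotZ e) slotX
    - ∑ e, m.up (m.cotton a b) e * F (slotZ c) (slotZ e)
    + (m.nab₂ (m.modZX (F slotY slotY) (fun q => F slotY (slotZ q))
          fun p q => F (slotZ p) (slotZ q)) a b c
      - m.modif b (m.tnab a F) (slotZ c) slotX
      + m.g a c * m.modif b F slotX slotX
      - ∑ d, m.up (m.P a) d * m.modif b F (slotZ c) (slotZ d))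
    - (m.nab₂ (m.modZX (F slotY slotY) (fun q => F slotY (slotZ q))
          fun p q => F (slotZ p) (slotZ q)) b a c
      - m.modif a (m.tnab b F) (slotZ c) slotX
      + m.g b c * m.modif a F slotX slotX
      - ∑ d, m.up (m.P b) d * m.modif a F (slotZ c) (slotZ d))
    + (m.modif a (m.modif b F) (slotZ c) slotX - m.modif b (m.modif a F) (slotZ c) slotX) := by
  rw [modCurv_eq, tnab_ZX, tnab_ZX]
  simp only [sum_TIdx, tcurv_ZY, tcurv_ZZ, tcurv_ZX, tcurv_XY, tcurv_XZ, tcurv_XX]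
  have h : ∀ a b, m.nab₁ (fun c => m.modif b F (slotZ c) slotX) a c =
      m.nab₂ (m.modZX (F slotY slotY) (fun q => F slotY (slotZ q))
        fun p q => F (slotZ p) (slotZ q)) a b c
      + ∑ e, m.Γ e a b * m.modZX (F slotY slotY) (fun q => F slotY (slotZ q))
        (fun p q => F (slotZ p) (slotZ q)) e c := by
    intro a b; simp only [nab₁, nab₂, modif]; ring
  rw [h, h]
  simp only [m.Γ_symm _ b a]
  have z1 : ∀ b, m.modif b F slotY slotX = 0 := fun _ => rfl
  simp only [z1, neg_mul, Finset.sum_neg_distrib]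
  ring

end Slots


/-! ### The trace of the Z Z slot of the curvature -/

variable {n : ℕ} {R : Type*} [CommRing R] [Algebra ℝ R] (m : LocalMetric n R)

lemma tr_nab₃₁₃ (T : Fin n → Fin n → Fin n → R) (hT : ∀ c, m.tr (fun a d => T a c d) = 0)
    (e c : Fin n) : m.tr (fun a d => m.nab₃ T e a c d) = 0 := by
  have h := m.nab₁_tr (fun c a d => T a c d) e c
  simp only [m.nab₃_swap₁₂ T] at h
  rw [← h]; simp [nab₁, hT]

lemma tr_modif_ZZ₁₃ (hn : 3 ≤ n) (F : TIdx n → TIdx n → R) (c : Fin n) :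
    m.tr (fun a d => m.modif a F (slotZ c) (slotZ d)) = 0 := m.tr_modZZ₁₃ hn _ _ c

lemma tr_modif_ZX (hn : 3 ≤ n) (F : TIdx n → TIdx n → R) :
    m.tr (fun a c => m.modif a F (slotZ c) slotX) = 0 := m.tr_modZX hn _ _ _

lemma nab₄_weylS (a b c d q : Fin n) :
    m.nab₄ m.weylS a b c d q = m.nab₄ m.weyl a b c d q + m.nab₄ m.weyl a b d c q := by
  have h : m.weylS = fun b c d q => m.weyl b c d q + m.weyl b d c q := rfl
  rw [h, m.nab₄_add m.weyl fun b c d q => m.weyl b d c q, nab₄_swap₂₃ m m.weyl]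

lemma nab₃_cottonS (a b c d : Fin n) :
    m.nab₃ m.cottonS a b c d = m.nab₃ m.cotton a b c d + m.nab₃ m.cotton a b d c := by
  have h : m.cottonS = fun b c d => m.cotton b c d + m.cotton b d c := rfl
  rw [h, m.nab₃_add m.cotton fun b c d => m.cotton b d c, nab₃_swap₂₃ m m.cotton]

lemma tr_nab₄_weylS (hn : 3 ≤ n) (b c q : Fin n) : m.tr (fun a d => m.nab₄ m.weylS a b c d q) =
    ((n : R) - 3) * (m.cotton b c q - m.cotton c q b) := by
  have h1 := m.div_weyl hn q b c
  have h2 := m.div_weyl hn b c q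
  rw [mul_sub, ← h1, ← h2, ← tr_sub]
  refine m.tr_congr fun a d => ?_
  rw [nab₄_weylS]
  linear_combination m.nab₄_weyl_pair a b c d q + m.nab₄_weyl_skew a b d c q

/-- The contraction of the Schouten and Weyl tensors in the Bach tensor. -/
def schoutenWeyl (a b : Fin n) : R := ∑ p, ∑ q, m.up₂ m.P p q * m.weyl p a q b

lemma div_cotton₁ (b c : Fin n) :
    m.tr (fun a d => m.nab₃ m.cotton a d b c) = m.bach b c - m.schoutenWeyl b c := by
  rw [bach, schoutenWeyl, ← tr_swap]; ring

lemma div_cotton₂ (b c : Fin n) :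
    m.tr (fun a d => m.nab₃ m.cotton a b d c) = -(m.bach b c - m.schoutenWeyl b c) := by
  rw [← div_cotton₁, ← tr_neg]
  exact m.tr_congr fun a d => m.nab₃_cotton_skew _ _ _ _

/-- Both terms contain the derivatives of F through the same function, so after rewriting these by
the slot formulas for ∇F only zeroth-order terms remain. -/
lemma nab₃_modZZ_sub_modif {F : TIdx n → TIdx n → R} (hF : ∀ B C, F B C = F C B)
    (a b c d : Fin n) :
    m.nab₃ (m.modZZ (F slotY slotY) fun q => F slotY (slotZ q)) a b c d
      - m.modif b (m.tnab a F) (slotZ c) (slotZ d) =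
    m.dModZZ (F slotY slotY) (fun q => F slotY (slotZ q)) a b c d
      + m.modZZ (2 * F slotY (slotZ a)) (fun q => F (slotZ a) (slotZ q) - m.P a q * F slotY slotY
        - m.g a q * F slotY slotX) b c d := by
  have e : m.modZZ (m.D a (F slotY slotY)) (m.nab₁ (fun q => F slotY (slotZ q)) a) b c d =
      m.modZZ (m.tnab a F slotY slotY + 2 * F slotY (slotZ a))
        (fun q => m.tnab a F slotY (slotZ q) + (F (slotZ a) (slotZ q) - m.P a q * F slotY slotY
        - m.g a q * F slotY slotX)) b c d := by
    congr 1
    · rw [tnab_YY, hF (slotZ a) slotY]; ring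
    · funext q; rw [tnab_YZ]; ring
  rw [nab₃_modZZ, e, modZZ_add, modif]; ring

/-- The trace is n times the ZX slot of Φ plus terms from the tractor curvature and the already
known ZZ slot; the ZX slot has been chosen to cancel them. The Schouten–Weyl contractions from the
divergence of the Cotton tensor and from the term P_{aq}σ of ∇F cancel, leaving the Bach tensor. -/
theorem tr_modCurv_ZZ (hn : 3 ≤ n) {F : TIdx n → TIdx n → R} (hF : ∀ B C, F B C = F C B)
    (b c : Fin n) : m.tr (fun a d => m.modCurv a b F (slotZ c) (slotZ d)) = 0 := by
  set s := F slotY slotY with hs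
  set μ : Fin n → R := fun q => F slotY (slotZ q) with hμ
  set w : Fin n → Fin n → R := fun p q => F (slotZ p) (slotZ q) with hw
  have hwS : ∀ p q, w p q = w q p := fun _ _ => hF _ _
  have T1 : m.tr (fun a d => m.cotton a b c * F slotY (slotZ d)) = ∑ q, m.cotton q b c * m.up μ q :=
    m.tr_mul_eq_up (fun a => m.cotton a b c) μ
  have T2 : m.tr (fun a d => ∑ e, m.up (m.weyl a b c) e * F (slotZ e) (slotZ d)) =
      ∑ p, ∑ q, m.up₂ w p q * m.weyl p b c q := by
    rw [← m.tr_sum_mul_up w fun p q => m.weyl p b c q, ← tr_swap]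
    refine m.tr_congr fun a d => ?_
    rw [m.sum_up_mul]
    simp only [hF _ (slotZ a)]
    rfl
  have T3 : m.tr (fun a d => m.cotton a b d * F (slotZ c) slotY) = 0 := by
    rw [tr_mul_right, m.tr_cotton₁₃ hn, zero_mul]
  have T4 : m.tr (fun a d => ∑ e, m.up (m.weyl a b d) e * F (slotZ c) (slotZ e)) = 0 := by
    simp only [m.sum_up_mul, tr_sum, tr_mul_right]
    simp [m.tr_weyl₁₃ hn]
  have T5 : m.tr (fun a d => m.dModZZ s μ a b c d) = - m.third *
      ((∑ q, ((n : R) - 3) * (m.cotton b c q - m.cotton c q b) * m.up μ q)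
        - (m.bach b c - m.schoutenWeyl b c) * s) := by
    have h : m.tr (fun a d => m.nab₃ m.cottonS a b c d) = -(m.bach b c - m.schoutenWeyl b c) := by
      simp only [nab₃_cottonS, tr_add, m.div_cotton₃ hn, div_cotton₂]; ring
    simp only [dModZZ, tr_mul_left, tr_add, tr_sum, tr_mul_right, m.tr_nab₄_weylS hn, h]
    ring
  have hPW : ∑ p, ∑ q, m.up₂ m.P p q * m.weylS b c p q = m.schoutenWeyl b c := by
    have h : ∑ p, ∑ q, m.up₂ m.P p q * m.weyl b c p q = 0 :=
      m.sum_up₂_mul_eq_zero m.P_symm fun p q => by linear_combination m.weyl_skew' b c p q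
    have h' : ∑ p, ∑ q, m.up₂ m.P p q * m.weyl b p c q = m.schoutenWeyl b c :=
      Finset.sum_congr rfl fun p _ => Finset.sum_congr rfl fun q _ => by
        rw [m.weyl_skew, m.weyl_skew' p b c q]; ring
    simp only [weylS, mul_add, Finset.sum_add_distrib, h, h', zero_add]
  have hgW : ∑ p, ∑ q, m.gi p q * m.weylS b c p q = 0 := by
    have h : m.tr (fun p q => m.weylS b c p q) = 0 := by
      have h1 : m.tr (fun p q => m.weyl b c p q) = 0 := m.tr_weyl₃₄ b c
      have h2 : m.tr (fun p q => m.weyl b p c q) = 0 := m.tr_weyl₂₄ hn b c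
      simp [weylS, tr_add, h1, h2]
    exact h
  have T6 : m.tr (fun a d => m.modZZ (2 * F slotY (slotZ a)) (fun q => F (slotZ a) (slotZ q)
      - m.P a q * F slotY slotY - m.g a q * F slotY slotX) b c d) = - m.third *
      (∑ p, ∑ q, m.up₂ w p q * m.weylS b c p q - m.schoutenWeyl b c * s
        + 2 * ∑ q, m.cottonS b c q * m.up μ q) := by
    simp only [modZZ, tr_mul_left, tr_add]
    have h1 := m.tr_sum_mul_up (fun a q => F (slotZ a) (slotZ q)
      - m.P a q * F slotY slotY - m.g a q * F slotY slotX) fun d q => m.weylS b c d q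
    have h2 : m.tr (fun a d => m.cottonS b c d * (2 * F slotY (slotZ a)))
        = 2 * ∑ q, m.cottonS b c q * m.up μ q := by
      rw [← tr_swap, ← tr_mul_eq_up, ← tr_mul_left]
      exact m.tr_congr fun a d => by ring
    rw [h1, h2]
    simp only [m.up₂_sub (fun a q => F (slotZ a) (slotZ q) - m.P a q * F slotY slotY),
      m.up₂_sub (fun a q => F (slotZ a) (slotZ q)), up₂_mul_right, up₂_g]
    have h3 : ∑ p, ∑ q, (m.up₂ (fun a q => F (slotZ a) (slotZ q)) p q
        - m.up₂ m.P p q * F slotY slotY - m.gi p q * F slotY slotX) * m.weylS b c p q =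
        ∑ p, ∑ q, m.up₂ w p q * m.weylS b c p q
        - (∑ p, ∑ q, m.up₂ m.P p q * m.weylS b c p q) * s
        - (∑ p, ∑ q, m.gi p q * m.weylS b c p q) * F slotY slotX := by
      simp only [Finset.sum_mul, ← Finset.sum_sub_distrib]
      exact Finset.sum_congr rfl fun _ _ => Finset.sum_congr rfl fun _ _ => by ring
    rw [h3, hPW, hgW]; ring
  -- The contributions 1, n and -1 of `T7`, `T8` and `T12` add up to n times the ZX slot.
  have T7 : m.tr (fun a d => m.g a c * m.modif b F (slotZ d) slotX) = m.modZX s μ w b c :=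
    m.tr_g_mul c fun d => m.modif b F (slotZ d) slotX
  have T8 : m.tr (fun a d => m.g a d * m.modif b F (slotZ c) slotX) = n * m.modZX s μ w b c := by
    rw [tr_mul_right, show m.tr (fun a d => m.g a d) = n from m.tr_g]; rfl
  have T9 : m.tr (fun a d => m.nab₃ (m.modZZ s μ) b a c d) = 0 :=
    m.tr_nab₃₁₃ _ (fun c => m.tr_modZZ₁₃ hn s μ c) b c
  have T10 : m.tr (fun a d => m.modif a (m.tnab b F) (slotZ c) (slotZ d)) = 0 :=
    m.tr_modif_ZZ₁₃ hn _ _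
  have T11 : m.tr (fun a d => m.g b c * m.modif a F (slotZ d) slotX) = 0 := by
    rw [tr_mul_left, m.tr_modif_ZX hn, mul_zero]
  have T12 : m.tr (fun a d => m.g b d * m.modif a F (slotZ c) slotX) = m.modZX s μ w b c := by
    rw [← tr_swap]; exact m.tr_g_mul' b fun a => m.modif a F (slotZ c) slotX
  simp only [modCurv_ZZ]
  simp only [← hs, ← hμ] at T1 T2 T3 T4 T5 T6 T7 T8 T9 T10 T11 T12 ⊢
  have key : ∀ a d, _ = _ := fun a d => m.nab₃_modZZ_sub_modif hF a b c d
  simp only [← hs, ← hμ] at key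
  simp only [key, tr_add, tr_sub, T1, T2, T3, T4, T5, T6, T7, T8, T9, T10, T11, T12]
  -- Coefficient of the ZZ slot of F, compared after symmetrisation; `hU0` below is the coefficient
  -- of the YZ slot.
  have hW0 : ∑ p, ∑ q, m.up₂ w p q * m.weyl p b c q
      - m.third * ∑ p, ∑ q, m.up₂ w p q * m.weylS b c p q
      - 4 * m.third * ∑ p, ∑ q, m.up₂ w p q * m.weyl b p q c = 0 := by
    rw [← m.sum_up₂_mul_eq_zero hwS (f := fun p q => m.weyl p b c q - m.third * m.weylS b c p q
      - 4 * m.third * m.weyl b p q c)]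
    · simp only [Finset.mul_sum, ← Finset.sum_sub_distrib]
      exact Finset.sum_congr rfl fun _ _ => Finset.sum_congr rfl fun _ _ => by ring
    · intro p q
      simp only [weylS]
      linear_combination m.weyl_skew p b c q - m.weyl_skew' b p c q + m.weyl_skew q b c p
        - m.weyl_skew' b q c p - m.third * (m.weyl_skew' b c p q + m.weyl_skew' b p c q
        + m.weyl_skew' b q c p) + (m.weyl b p q c + m.weyl b q p c) * (-m.three_mul_third)
  have hU0 : ∀ q, m.cotton q b c - m.third * (((n : R) - 3) * (m.cotton b c q - m.cotton c q b)
      + 2 * m.cottonS b c q) + n * m.third * m.cottonE b c q = 0 := by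
    intro q
    simp only [cottonE, cottonS]
    have hd := m.dim_mul_invDim hn
    have h3 := m.three_mul_third
    linear_combination (-4 * m.third * (m.cotton q b c + m.cotton q c b)) * hd
      - (m.cotton q b c) * h3
      + m.third * (m.cotton_cyclic b c q) + (n * m.third - 2 * m.third) * m.cotton_skew b q c
      + (n * m.third - 4 * m.third) * m.cotton_skew q c b
  have hU : ∑ q, m.cotton q b c * m.up μ q - m.third * ∑ q, ((n : R) - 3) *
      (m.cotton b c q - m.cotton c q b) * m.up μ q
      - 2 * m.third * ∑ q, m.cottonS b c q * m.up μ q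
      + n * m.third * ∑ q, m.cottonE b c q * m.up μ q = 0 := by
    simp only [Finset.mul_sum, ← Finset.sum_sub_distrib, ← Finset.sum_add_distrib]
    exact Finset.sum_eq_zero fun q _ => by linear_combination (m.up μ q) * hU0 q
  simp only [modZX]
  linear_combination hW0 + hU + (- 4 * m.third * ∑ p, ∑ q, m.up₂ w p q * m.weyl b p q c
    - m.third * m.bach b c * s) * m.dim_mul_invDim hn


/-! ### The trace of the Z X slot of the curvature -/

variable {n : ℕ} {R : Type*} [CommRing R] [Algebra ℝ R] (m : LocalMetric n R)

lemma tr_nab₄_weyl₄ (hn : 3 ≤ n) (b p q : Fin n) :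
    m.tr (fun a c => m.nab₄ m.weyl a b p q c) = -((n : R) - 3) * m.cotton b p q := by
  rw [neg_mul, ← m.div_weyl hn, ← tr_neg]
  refine m.tr_congr fun a c => ?_
  linear_combination m.nab₄_weyl_pair a b p q c + m.nab₄_weyl_skew a q c b p

lemma nab₃_cottonE (a b c q : Fin n) : m.nab₃ m.cottonE a b c q =
    m.nab₃ m.cottonS a b c q + (1 - 4 * m.invDim) * m.nab₃ m.cottonS a q b c := by
  have h : m.cottonE = fun b c q => m.cottonS b c q + (1 - 4 * m.invDim) * m.cottonS q b c := rfl
  have h4 : m.D a (4 : R) = 0 := Derivation.map_natCast (m.D a) 4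
  have k : m.nab₃ (fun b c q => m.cottonS q b c) a b c q = m.nab₃ m.cottonS a q b c := by
    simp only [nab₃]; ring
  rw [h, m.nab₃_add m.cottonS fun b c q => (1 - 4 * m.invDim) * m.cottonS q b c, nab₃_const_mul, k]
  simp [D_invDim, h4]

lemma schoutenWeyl_symm (a b : Fin n) : m.schoutenWeyl a b = m.schoutenWeyl b a := by
  simp only [schoutenWeyl]
  rw [Finset.sum_comm]
  exact Finset.sum_congr rfl fun _ _ => Finset.sum_congr rfl fun _ _ => by
    rw [m.up₂_symm m.P_symm, m.weyl_pair]

lemma tr_nab₃_cottonE (hn : 3 ≤ n) (b q : Fin n) : m.tr (fun a c => m.nab₃ m.cottonE a b c q) =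
    -(2 - 4 * m.invDim) * (m.bach b q - m.schoutenWeyl b q) := by
  simp only [nab₃_cottonE, nab₃_cottonS, tr_add, tr_mul_left, m.div_cotton₃ hn, div_cotton₂]
  rw [m.bach_symm hn q b, m.schoutenWeyl_symm q b]; ring

lemma nab₂_bach_symm (hn : 3 ≤ n) (e a b : Fin n) :
    m.nab₂ m.bach e a b = m.nab₂ m.bach e b a := by
  rw [← nab₂_swap]; congr 1; funext a b; exact m.bach_symm hn _ _

lemma nab₂_modZX_sub_modif {F : TIdx n → TIdx n → R} (hF : ∀ B C, F B C = F C B)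
    (a b c : Fin n) :
    m.nab₂ (m.modZX (F slotY slotY) (fun q => F slotY (slotZ q))
        fun p q => F (slotZ p) (slotZ q)) a b c
      - m.modif b (m.tnab a F) (slotZ c) slotX =
    m.dModZX (F slotY slotY) (fun q => F slotY (slotZ q)) (fun p q => F (slotZ p) (slotZ q)) a b c
      + m.modZX (2 * F slotY (slotZ a)) (fun q => F (slotZ a) (slotZ q) - m.P a q * F slotY slotY
        - m.g a q * F slotY slotX) (fun p q => 0 - (m.P a p * F slotY (slotZ q)
        + m.g a p * F (slotZ q) slotX + F slotY (slotZ p) * m.P a q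
        + F (slotZ p) slotX * m.g a q)) b c := by
  have e : m.modZX (m.D a (F slotY slotY)) (m.nab₁ (fun q => F slotY (slotZ q)) a)
        (m.nab₂ (fun p q => F (slotZ p) (slotZ q)) a) b c =
      m.modZX (m.tnab a F slotY slotY + 2 * F slotY (slotZ a))
        (fun q => m.tnab a F slotY (slotZ q) + (F (slotZ a) (slotZ q) - m.P a q * F slotY slotY
        - m.g a q * F slotY slotX))
        (fun p q => m.tnab a F (slotZ p) (slotZ q) + (0 - (m.P a p * F slotY (slotZ q)
        + m.g a p * F (slotZ q) slotX + F slotY (slotZ p) * m.P a q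
        + F (slotZ p) slotX * m.g a q))) b c := by
    congr 1
    · rw [tnab_YY, hF (slotZ a) slotY]; ring
    · funext q; rw [tnab_YZ]; ring
    · funext p q; rw [tnab_ZZ, hF (slotZ p) slotY, hF slotX (slotZ q)]; ring
  rw [nab₂_modZX, e, modZX_add, modif]; ring

/-- Moves a symmetrisation from one factor of a full contraction to the other, which brings the
quadratic terms of Φ∘Φ to the form in which they appear in Ψ̃. -/
lemma tr_tr_tr_symm_mul (f h : Fin n → Fin n → Fin n → R) :
    m.tr (fun a c => m.tr fun p r => m.tr fun q s => (f a r s + f a s r) * h p q c) =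
      m.tr fun r r' => m.tr fun s s' => m.tr fun p p' => (h r' s' p' + h s' r' p') * f p r s := by
  have h1 : ∀ f : Fin n → Fin n → Fin n → R,
      m.tr (fun a c => m.tr fun p r => m.tr fun q s => f a r s * h p q c) =
      m.tr fun r r' => m.tr fun s s' => m.tr fun p p' => h r' s' p' * f p r s := by
    intro f
    rw [tr_comm, ← tr_swap]
    refine m.tr_congr fun r r' => ?_
    rw [tr_comm, ← tr_swap]
    refine m.tr_congr fun s s' => m.tr_congr fun p p' => mul_comm _ _
  have h2 : m.tr (fun r r' => m.tr fun s s' => m.tr fun p p' => h r' s' p' * f p s r) =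
      m.tr (fun r r' => m.tr fun s s' => m.tr fun p p' => h s' r' p' * f p r s) := by
    rw [tr_comm]
  simp only [add_mul, tr_add, h1, h2]

lemma tr_weylS_mul_weyl (b k : Fin n) :
    m.tr (fun a c => m.tr fun p r => m.tr fun q s => m.weylS a r s k * m.weyl b p q c) =
      2 * m.weylWeyl b k := by
  have h := m.tr_tr_tr_symm_mul (fun a r s => m.weyl k r s a) fun p q c => m.weyl b p q c
  have e : ∀ a r s, m.weylS a r s k = m.weyl k r s a + m.weyl k s r a := by
    intro a r s
    simp only [weylS]
    linear_combination m.weyl_pair a r s k + m.weyl_skew s k a r - m.weyl_skew' k s a r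
      + m.weyl_pair a s r k + m.weyl_skew r k a s - m.weyl_skew' k r a s
  simp only [e, h, weylWeyl]
  rw [← mul_assoc, mul_comm (2 : R), half_two, one_mul]
  rfl

lemma tr_cottonS_mul_weyl (b : Fin n) :
    m.tr (fun a c => m.tr fun p r => m.tr fun q s => m.cottonS a r s * m.weyl b p q c) =
      2 * m.weylCotton b := by
  have h := m.tr_tr_tr_symm_mul m.cotton fun p q c => m.weyl b p q c
  simp only [cottonS, h, weylCotton]
  rw [← mul_assoc, mul_comm (2 : R), half_two, one_mul]
  rfl

/-- The trace contains n - 1 times the XX slot of Φ, chosen to cancel everything else: divergences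
of the Weyl, Cotton and Bach tensors, algebraic terms with P, and the quadratic contribution of Φ∘Φ.
-/
theorem tr_modCurv_ZX (hn : 3 ≤ n) {F : TIdx n → TIdx n → R} (hF : ∀ B C, F B C = F C B)
    (b : Fin n) : m.tr (fun a c => m.modCurv a b F (slotZ c) slotX) = 0 := by
  set s := F slotY slotY with hs
  set μ : Fin n → R := fun q => F slotY (slotZ q) with hμ
  set w : Fin n → Fin n → R := fun p q => F (slotZ p) (slotZ q) with hw
  set ν : Fin n → R := fun q => F (slotZ q) slotX with hν
  have hwS : ∀ p q, w p q = w q p := fun _ _ => hF _ _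
  have U1 : m.tr (fun a c => m.cotton a b c * F slotY slotX) = 0 := by
    rw [tr_mul_right, m.tr_cotton₁₃ hn, zero_mul]
  have U2 : m.tr (fun a c => ∑ e, m.up (m.weyl a b c) e * F (slotZ e) slotX) = 0 := by
    simp only [m.sum_up_mul, tr_sum, tr_mul_right]
    simp [m.tr_weyl₁₃ hn]
  have U3 : m.tr (fun a c => ∑ e, m.up (m.cotton a b) e * F (slotZ c) (slotZ e)) =
      ∑ p, ∑ q, m.up₂ w p q * m.cotton p b q := by
    rw [← m.tr_sum_mul_up w fun p q => m.cotton p b q, ← tr_swap]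
    exact m.tr_congr fun a d => m.sum_up_mul _ _
  set N := ∑ p, ∑ q, m.up₂ m.P p q * m.cotton q b p with hN
  have U4 : m.tr (fun a c => m.dModZX s μ w a b c) =
      -(4 * m.third * m.invDim) * (-((n : R) - 3) * ∑ p, ∑ q, m.up₂ w p q * m.cotton b p q)
      + m.third * (-(2 - 4 * m.invDim) *
        ∑ q, (m.bach b q - m.schoutenWeyl b q) * m.up μ q)
      - m.third * m.invDim * (-((n : R) - 4) * N * s) := by
    -- The divergence of the Bach tensor is what makes the remaining Schouten–Cotton terms in the YY
    -- slot cancel; see `hE`.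
    have h : m.tr (fun a c => m.nab₂ m.bach a b c) = -((n : R) - 4) * N := by
      rw [← m.div_bach hn]; exact m.tr_congr fun a c => m.nab₂_bach_symm hn _ _ _
    simp only [dModZX, tr_sub, tr_add, tr_mul_left, tr_mul_right, tr_sum, h, m.tr_nab₄_weyl₄ hn,
      m.tr_nab₃_cottonE hn, Finset.mul_sum]
    simp only [← mul_assoc, mul_comm (m.up₂ _ _ _)]
  have hQ : ∀ q, ∑ x, ∑ p, m.up₂ m.P x p * m.weyl b p q x = m.schoutenWeyl b q := by
    intro q
    rw [Finset.sum_comm]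
    exact Finset.sum_congr rfl fun _ _ => Finset.sum_congr rfl fun _ _ => by
      rw [m.up₂_symm m.P_symm, m.weyl_skew, m.weyl_skew' _ b]; ring
  have hQ' : ∀ p, ∑ x, ∑ q, m.up₂ m.P x q * m.weyl b p q x = 0 := fun p =>
    m.sum_up₂_mul_eq_zero m.P_symm fun x q => by linear_combination m.weyl_skew' b p q x
  have U5a : m.tr (fun a c => ∑ p, ∑ q, m.up₂ (fun p q => 0 - (m.P a p * μ q
        + m.g a p * ν q + μ p * m.P a q + ν p * m.g a q)) p q * m.weyl b p q c) =
      - ∑ q, m.schoutenWeyl b q * m.up μ q := by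
    have h1 : ∀ a c, ∑ p, ∑ q, m.up₂ (fun p q => 0 - (m.P a p * μ q
        + m.g a p * ν q + μ p * m.P a q + ν p * m.g a q)) p q * m.weyl b p q c =
        - (∑ q, m.up μ q * ∑ p, m.weyl b p q c * m.up (m.P a) p)
        - (∑ q, m.up ν q * m.weyl b a q c)
        - (∑ p, m.up μ p * ∑ q, m.weyl b p q c * m.up (m.P a) q)
        - (∑ p, m.up ν p * m.weyl b p a c) := by
      intro a c
      have e : ∀ p q, m.up₂ (fun p q => 0 - (m.P a p * μ q
        + m.g a p * ν q + μ p * m.P a q + ν p * m.g a q)) p q =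
          - (m.up (m.P a) p * m.up μ q) - (if p = a then 1 else 0) * m.up ν q
          - m.up μ p * m.up (m.P a) q - m.up ν p * (if q = a then 1 else 0) := by
        intro p q
        have e0 : m.up₂ (fun _ _ => (0 : R)) p q = 0 := by simp [up₂]
        rw [m.up₂_sub (fun _ _ => 0), e0,
          m.up₂_add (fun p q => m.P a p * μ q + m.g a p * ν q + μ p * m.P a q),
          m.up₂_add (fun p q => m.P a p * μ q + m.g a p * ν q),
          m.up₂_add (fun p q => m.P a p * μ q), up₂_mul, up₂_mul, up₂_mul, up₂_mul, up_g, up_g]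
        ring
      simp only [e, sub_mul, Finset.sum_sub_distrib]
      congr 1
      · congr 1
        · congr 1
          · rw [Finset.sum_comm]
            simp only [Finset.mul_sum, neg_mul, Finset.sum_neg_distrib]
            congr 1
            exact Finset.sum_congr rfl fun _ _ => Finset.sum_congr rfl fun _ _ => by ring
          · simp
        · simp only [Finset.mul_sum]
          exact Finset.sum_congr rfl fun _ _ => Finset.sum_congr rfl fun _ _ => by ring
      · simp
    have h2 : ∀ q, m.tr (fun a c => m.weyl b a q c) = 0 := fun q => m.tr_weyl₂₄ hn b q
    have h3 : ∀ q, m.tr (fun a c => m.weyl b q a c) = 0 := fun q => m.tr_weyl₃₄ b q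
    have h4 : ∀ q, m.tr (fun a c => ∑ p, m.weyl b p q c * m.up (m.P a) p) = m.schoutenWeyl b q :=
      fun q => (m.tr_sum_mul_up m.P fun c p => m.weyl b p q c).trans (hQ q)
    have h5 : ∀ p, m.tr (fun a c => ∑ q, m.weyl b p q c * m.up (m.P a) q) = 0 :=
      fun p => (m.tr_sum_mul_up m.P fun c q => m.weyl b p q c).trans (hQ' p)
    rw [m.tr_congr h1]
    simp only [tr_sub, tr_neg, tr_sum (s := Finset.univ)
      (S := fun q a c => m.up μ q * ∑ p, m.weyl b p q c * m.up (m.P a) p), tr_sum (s := Finset.univ)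
      (S := fun p a c => m.up μ p * ∑ q, m.weyl b p q c * m.up (m.P a) q), tr_sum (s := Finset.univ)
      (S := fun q a c => m.up ν q * m.weyl b a q c), tr_sum (s := Finset.univ)
      (S := fun q a c => m.up ν q * m.weyl b q a c), tr_mul_left, h2, h3, h4, h5]
    simp [mul_comm]
  have hE0 : ∑ p, ∑ q, m.gi p q * m.cottonE b p q = 0 := by
    have h : m.tr (fun p q => m.cottonE b p q) = 0 := by
      have h1 : m.tr (fun p q => m.cotton b q p) = 0 := by
        rw [← m.tr_cotton₂₃ hn b]; exact m.tr_swap _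
      have h2 : m.tr (fun p q => m.cotton q b p) = 0 := by
        rw [← m.tr_cotton₁₃ hn b]; exact m.tr_swap fun q p => m.cotton q b p
      have h3 : m.tr (fun p q => m.cotton q p b) = 0 := by
        rw [← m.tr_cotton₁₂ b]; exact m.tr_swap fun q p => m.cotton q p b
      simp [cottonE, cottonS, tr_add, tr_mul_left, m.tr_cotton₂₃ hn, h1, h2, h3]
    exact h
  have U5b : m.tr (fun a c => ∑ q, m.cottonE b c q * m.up (fun q => F (slotZ a) (slotZ q)
      - m.P a q * s - m.g a q * F slotY slotX) q) =
      ∑ p, ∑ q, m.up₂ w p q * m.cottonE b p q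
        - (∑ p, ∑ q, m.up₂ m.P p q * m.cottonE b p q) * s := by
    have h1 := m.tr_sum_mul_up (fun a q => F (slotZ a) (slotZ q)
      - m.P a q * s - m.g a q * F slotY slotX) fun d q => m.cottonE b d q
    rw [h1]
    simp only [m.up₂_sub (fun a q => F (slotZ a) (slotZ q) - m.P a q * s),
      m.up₂_sub (fun a q => F (slotZ a) (slotZ q)), up₂_mul_right, up₂_g]
    have h3 : ∑ p, ∑ q, (m.up₂ (fun a q => F (slotZ a) (slotZ q)) p q
        - m.up₂ m.P p q * s - m.gi p q * F slotY slotX) * m.cottonE b p q =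
        ∑ p, ∑ q, m.up₂ w p q * m.cottonE b p q
        - (∑ p, ∑ q, m.up₂ m.P p q * m.cottonE b p q) * s
        - (∑ p, ∑ q, m.gi p q * m.cottonE b p q) * F slotY slotX := by
      simp only [Finset.sum_mul, ← Finset.sum_sub_distrib]
      exact Finset.sum_congr rfl fun _ _ => Finset.sum_congr rfl fun _ _ => by ring
    rw [h3, hE0]; ring
  have U5c : m.tr (fun a c => m.bach b c * (2 * F slotY (slotZ a))) =
      2 * ∑ q, m.bach b q * m.up μ q := by
    rw [← tr_swap, ← tr_mul_eq_up, ← tr_mul_left]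
    exact m.tr_congr fun a d => by ring
  have U6 : m.tr (fun a c => m.g a c * m.modif b F slotX slotX) = n * m.modXX s μ w b := by
    rw [tr_mul_right, show m.tr (fun a d => m.g a d) = n from m.tr_g]; rfl
  have U7 : m.tr (fun a c => ∑ d, m.up (m.P a) d * m.modif b F (slotZ c) (slotZ d)) =
      - m.third * (-2 * ∑ k, m.schoutenWeyl b k * m.up μ k
        + (∑ p, ∑ q, m.up₂ m.P p q * m.cottonS b p q) * s) := by
    have h1 := m.tr_sum_mul_up m.P fun c d => m.modif b F (slotZ c) (slotZ d)
    simp only [mul_comm (m.up (m.P _) _)]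
    rw [h1]
    have h2 : ∀ k, ∑ p, ∑ q, m.up₂ m.P p q * m.weylS b p q k = -2 * m.schoutenWeyl b k := by
      intro k
      have e1 : ∑ p, ∑ q, m.up₂ m.P p q * m.weyl b p q k = - m.schoutenWeyl b k := by
        simp only [schoutenWeyl, ← Finset.sum_neg_distrib]
        exact Finset.sum_congr rfl fun _ _ => Finset.sum_congr rfl fun _ _ => by
          rw [m.weyl_skew]; ring
      have e2 : ∑ p, ∑ q, m.up₂ m.P p q * m.weyl b q p k = - m.schoutenWeyl b k := by
        rw [← e1, Finset.sum_comm]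
        exact Finset.sum_congr rfl fun _ _ => Finset.sum_congr rfl fun _ _ => by
          rw [m.up₂_symm m.P_symm]
      simp only [weylS, mul_add, Finset.sum_add_distrib, e1, e2]; ring
    have h3 : ∑ p, ∑ q, m.up₂ m.P p q * m.modif b F (slotZ p) (slotZ q) =
        - m.third * (∑ k, (∑ p, ∑ q, m.up₂ m.P p q * m.weylS b p q k) * m.up μ k
          + (∑ p, ∑ q, m.up₂ m.P p q * m.cottonS b p q) * s) := by
      have e : ∑ k, (∑ p, ∑ q, m.up₂ m.P p q * m.weylS b p q k) * m.up μ k =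
          ∑ p, ∑ q, m.up₂ m.P p q * ∑ k, m.weylS b p q k * m.up μ k := by
        simp only [Finset.sum_mul, Finset.mul_sum]
        rw [Finset.sum_comm]
        refine Finset.sum_congr rfl fun _ _ => ?_
        rw [Finset.sum_comm]
        exact Finset.sum_congr rfl fun _ _ => Finset.sum_congr rfl fun _ _ => by ring
      rw [e, Finset.sum_mul, ← Finset.sum_add_distrib, Finset.mul_sum]
      refine Finset.sum_congr rfl fun p _ => ?_
      rw [Finset.sum_mul, ← Finset.sum_add_distrib, Finset.mul_sum]
      exact Finset.sum_congr rfl fun q _ => by simp only [modif, modZZ]; ring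
    rw [h3]
    simp only [h2, mul_assoc, Finset.mul_sum]
  have V1 : m.tr (fun a c => m.nab₂ (m.modZX s μ w) b a c) = 0 := by
    have h := m.D_tr (m.modZX s μ w) b
    have h' : m.tr (m.modZX s μ w) = 0 := m.tr_modZX hn s μ w
    rw [h', map_zero] at h
    exact h.symm
  have V2 : m.tr (fun a c => m.modif a (m.tnab b F) (slotZ c) slotX) = 0 := m.tr_modif_ZX hn _
  -- Together with `U6` this leaves n - 1 times the XX slot.
  have V3 : m.tr (fun a c => m.g b c * m.modif a F slotX slotX) = m.modXX s μ w b := by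
    rw [← tr_swap]; exact m.tr_g_mul' b fun a => m.modif a F slotX slotX
  have V4 : m.tr (fun a c => ∑ d, m.up (m.P b) d * m.modif a F (slotZ c) (slotZ d)) = 0 := by
    have h : ∀ d, m.tr (fun a c => m.modif a F (slotZ c) (slotZ d)) = 0 := by
      intro d
      rw [← m.tr_modif_ZZ₁₃ hn F d]
      exact m.tr_congr fun a c => m.modif_symm _ _ _ _
    simp only [tr_sum, tr_mul_left, h]; simp
  have W1 : m.tr (fun a c => m.modif a (m.modif b F) (slotZ c) slotX) = 0 := m.tr_modif_ZX hn _
  -- The only surviving part of Φ∘Φ, since the inner Φ has no Y slots; divided by n - 1 it becomes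
  -- the quadratic terms of the XX slot.
  have W2 : m.tr (fun a c => m.modif b (m.modif a F) (slotZ c) slotX) =
      (4 * m.third * m.invDim) * (m.third * (2 * ∑ k, m.weylWeyl b k * m.up μ k
        + 2 * m.weylCotton b * s)) := by
    have e : ∀ a c, m.modif b (m.modif a F) (slotZ c) slotX = -(4 * m.third * m.invDim) *
        m.tr (fun p r => m.tr fun q t => m.modZZ s μ a r t * m.weyl b p q c) := by
      intro a c
      rw [← sum_up₂_mul]
      have : m.modif b (m.modif a F) (slotZ c) slotX = m.modZX 0 (fun _ => 0) (m.modZZ s μ a) b c :=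
        rfl
      rw [this, modZX]
      simp [up_zero]
    have e2 : ∀ a r t p q c, m.modZZ s μ a r t * m.weyl b p q c = - m.third *
        (∑ k, m.weylS a r t k * m.weyl b p q c * m.up μ k
          + m.cottonS a r t * m.weyl b p q c * s) := by
      intro a r t p q c
      have : ∑ k, m.weylS a r t k * m.weyl b p q c * m.up μ k =
          (∑ k, m.weylS a r t k * m.up μ k) * m.weyl b p q c := by
        rw [Finset.sum_mul]; exact Finset.sum_congr rfl fun _ _ => by ring
      rw [this, modZZ]; ring
    simp only [e, e2, tr_mul_left, tr_add, tr_sum, tr_mul_right, tr_weylS_mul_weyl,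
      tr_cottonS_mul_weyl]
    have e3 : ∑ k, 2 * m.weylWeyl b k * m.up μ k = 2 * ∑ k, m.weylWeyl b k * m.up μ k := by
      rw [Finset.mul_sum]; exact Finset.sum_congr rfl fun _ _ => by ring
    rw [e3]
    ring
  simp only [modCurv_ZX]
  have key : ∀ a c, _ = _ := fun a c => m.nab₂_modZX_sub_modif hF a b c
  -- The pattern unfolds only the zeroth-order remainder, whose first argument is a multiple of two.
  simp only [modZX.eq_1 m (2 * _)] at key
  simp only [← hs, ← hμ, ← hw] at key U1 U2 U3 U4 U5a U5b U5c U6 U7 V1 V2 V3 V4 W1 W2 ⊢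
  have U5a' : m.tr (fun a c => ∑ p, ∑ q, m.up₂ (fun p q => 0 - (m.P a p * F slotY (slotZ q)
        + m.g a p * F (slotZ q) slotX + F slotY (slotZ p) * m.P a q + F (slotZ p) slotX * m.g a q))
        p q * m.weyl b p q c) = - ∑ q, m.schoutenWeyl b q * m.up μ q := U5a
  simp only [key, tr_add, tr_sub, tr_mul_left, U1, U2, U3, U4, U5a', U5b, U5c, U6, U7, V1, V2, V3,
    V4, W1, W2]
  have hd := m.dim_mul_invDim hn
  have h3 := m.three_mul_third
  have hp := m.dimPred_mul_invDimPred hn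
  have hW0 : - ∑ p, ∑ q, m.up₂ w p q * m.cotton p b q
      + (4 * m.third * m.invDim * ((n : R) - 3) - 8 * ((n : R) - 1) * m.third * m.invDim) *
        ∑ p, ∑ q, m.up₂ w p q * m.cotton b p q
      + m.third * ∑ p, ∑ q, m.up₂ w p q * m.cottonE b p q = 0 := by
    rw [← m.sum_up₂_mul_eq_zero hwS (f := fun p q => - m.cotton p b q
      + (4 * m.third * m.invDim * ((n : R) - 3) - 8 * ((n : R) - 1) * m.third * m.invDim)
        * m.cotton b p q + m.third * m.cottonE b p q)]
    · simp only [Finset.mul_sum, ← Finset.sum_add_distrib,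
        ← Finset.sum_neg_distrib]
      exact Finset.sum_congr rfl fun _ _ => Finset.sum_congr rfl fun _ _ => by ring
    · intro p q
      simp only [cottonE, cottonS]
      linear_combination (-1 : R) * m.cotton_skew p b q - m.cotton_skew q b p
        + m.third * (1 - 4 * m.invDim) * (m.cotton_skew q b p + m.cotton_skew p b q
          + m.cotton_skew q p b)
        - 4 * m.third * (m.cotton b p q + m.cotton b q p) * hd
        - (m.cotton b p q + m.cotton b q p) * h3
  have hE : ∑ p, ∑ q, m.up₂ m.P p q * m.cottonE b p q =
      ∑ p, ∑ q, m.up₂ m.P p q * m.cottonS b p q + (1 - 4 * m.invDim) * N := by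
    have h : ∑ p, ∑ q, m.up₂ m.P p q * m.cotton q p b = 0 :=
      m.sum_up₂_mul_eq_zero m.P_symm fun p q => by linear_combination m.cotton_skew q p b
    have h' : N = ∑ p, ∑ q, m.up₂ m.P p q * (m.cotton q b p + m.cotton q p b) := by
      simp only [mul_add, Finset.sum_add_distrib, h, hN, add_zero]
    rw [h', Finset.mul_sum, ← Finset.sum_add_distrib]
    refine Finset.sum_congr rfl fun p _ => ?_
    rw [Finset.mul_sum, ← Finset.sum_add_distrib]
    exact Finset.sum_congr rfl fun q _ => by simp only [cottonE, cottonS]; ring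
  have hX : ∑ q, (m.bach b q + 4 * m.third * m.invDimPred * m.weylWeyl b q) * m.up μ q =
      ∑ q, m.bach b q * m.up μ q + 4 * m.third * m.invDimPred *
        ∑ q, m.weylWeyl b q * m.up μ q := by
    rw [Finset.mul_sum, ← Finset.sum_add_distrib]
    exact Finset.sum_congr rfl fun _ _ => by ring
  have hY : ∑ q, (m.bach b q - m.schoutenWeyl b q) * m.up μ q =
      ∑ q, m.bach b q * m.up μ q - ∑ q, m.schoutenWeyl b q * m.up μ q := by
    rw [← Finset.sum_sub_distrib]
    exact Finset.sum_congr rfl fun _ _ => by ring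
  rw [hE, hY, modXX, hX]
  linear_combination hW0 + (2 * m.third * ∑ q, m.bach b q * m.up μ q + m.third * N * s) * hd
    + (8 * m.third ^ 2 * m.invDim * ∑ q, m.weylWeyl b q * m.up μ q
      + 8 * m.third ^ 2 * m.invDim * m.weylCotton b * s) * hp

end LocalMetric

/-! ### Smooth functions on an open set of coordinate space -/

/-- The functions on coordinate space that are smooth on `U`. -/
def smoothOn {n : ℕ} (U : Set (Coord n)) : Subalgebra ℝ (Coord n → ℝ) where
  carrier := {f | ContDiffOn ℝ ∞ f U}
  mul_mem' hf hg := ContDiffOn.mul hf hg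
  add_mem' hf hg := ContDiffOn.add hf hg
  algebraMap_mem' _ := contDiffOn_const

section SmoothOn

variable {n : ℕ} {U : Set (Coord n)}

lemma pd_congr (hU : IsOpen U) {f f' : Coord n → ℝ} (h : ∀ z ∈ U, f z = f' z) {y : Coord n}
    (hy : y ∈ U) (a : Fin n) : pd a f y = pd a f' y := by
  rw [pd, pd, Filter.EventuallyEq.fderiv_eq]
  exact Filter.eventually_of_mem (hU.mem_nhds hy) h

lemma contDiffOn_pd (hU : IsOpen U) {f : Coord n → ℝ} (hf : ContDiffOn ℝ ∞ f U) (a : Fin n) :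
    ContDiffOn ℝ ∞ (pd a f) U :=
  ((contDiffOn_infty_iff_fderiv_of_isOpen hU).1 hf).2.clm_apply contDiffOn_const

lemma differentiableAt_of_contDiffOn (hU : IsOpen U) {f : Coord n → ℝ} (hf : ContDiffOn ℝ ∞ f U)
    {y : Coord n} (hy : y ∈ U) : DifferentiableAt ℝ f y :=
  (hf.contDiffAt (hU.mem_nhds hy)).differentiableAt (by simp)

lemma pd_add {f f' : Coord n → ℝ} {y : Coord n} (hf : DifferentiableAt ℝ f y)
    (hf' : DifferentiableAt ℝ f' y) (a : Fin n) :
    pd a (fun z => f z + f' z) y = pd a f y + pd a f' y := by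
  simp only [pd]
  rw [fderiv_fun_add hf hf']; rfl

lemma pd_sub {f f' : Coord n → ℝ} {y : Coord n} (hf : DifferentiableAt ℝ f y)
    (hf' : DifferentiableAt ℝ f' y) (a : Fin n) :
    pd a (fun z => f z - f' z) y = pd a f y - pd a f' y := by
  simp only [pd]
  rw [fderiv_fun_sub hf hf']; rfl

lemma pd_comm (hU : IsOpen U) {f : Coord n → ℝ} (hf : ContDiffOn ℝ ∞ f U) {y : Coord n}
    (hy : y ∈ U) (a b : Fin n) : pd a (pd b f) y = pd b (pd a f) y := by
  have hd : DifferentiableAt ℝ (fderiv ℝ f) y :=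
    ((((contDiffOn_infty_iff_fderiv_of_isOpen hU).1 hf).2).contDiffAt
      (hU.mem_nhds hy)).differentiableAt (by simp)
  have h : ∀ a b : Fin n, pd a (pd b f) y = fderiv ℝ (fderiv ℝ f) y (EuclideanSpace.single a 1)
      (EuclideanSpace.single b 1) := by
    intro a b
    rw [pd]
    have : pd b f = fun z => fderiv ℝ f z (EuclideanSpace.single b 1) := rfl
    rw [this, fderiv_clm_apply hd (differentiableAt_const _)]
    simp
  rw [h, h]
  exact ((hf.contDiffAt (hU.mem_nhds hy)).isSymmSndFDerivAt (by
    simpa using WithTop.coe_le_coe.2 (le_top : (2 : ℕ∞) ≤ ⊤))).eq _ _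

/-- The partial derivatives as derivations. -/
def smoothD (hU : IsOpen U) (a : Fin n) : Derivation ℝ (smoothOn U) (smoothOn U) :=
  Derivation.mk'
    -- Ring elements are arbitrary outside `U`; setting derivatives to zero there makes the Leibniz
    -- rule and commutation hold as identities in the ring.
    { toFun := fun f => ⟨U.indicator (pd a f.1), (contDiffOn_pd hU f.2 a).congr
        fun _ hz => Set.indicator_of_mem hz _⟩
      map_add' := fun f f' => by
        ext y
        by_cases hy : y ∈ U
        · have := pd_add (differentiableAt_of_contDiffOn hU f.2 hy)
            (differentiableAt_of_contDiffOn hU f'.2 hy) a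
          simp only [Set.indicator_of_mem hy, Subalgebra.coe_add, Pi.add_apply]
          exact this
        · simp [hy]
      map_smul' := fun r f => by
        ext y
        by_cases hy : y ∈ U
        · have := fderiv_const_smul (differentiableAt_of_contDiffOn hU f.2 hy) r
          simp [hy, pd, this]
        · simp [hy] }
    fun f f' => by
      ext y
      by_cases hy : y ∈ U
      · have := fderiv_mul (differentiableAt_of_contDiffOn hU f.2 hy)
          (differentiableAt_of_contDiffOn hU f'.2 hy)
        simp [hy, pd, this]
      · simp [hy]

lemma smoothD_apply (hU : IsOpen U) (a : Fin n) (f : smoothOn U) {y : Coord n} (hy : y ∈ U) :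
    (smoothD hU a f).1 y = pd a f.1 y := Set.indicator_of_mem hy _

lemma smoothD_comm (hU : IsOpen U) (a b : Fin n) (f : smoothOn U) :
    smoothD hU a (smoothD hU b f) = smoothD hU b (smoothD hU a f) := by
  have h : ∀ a b, ∀ y ∈ U, (smoothD hU a (smoothD hU b f)).1 y = pd a (pd b f.1) y := by
    intro a b y hy
    rw [smoothD_apply hU a _ hy]
    exact pd_congr hU (fun z hz => smoothD_apply hU b f hz) hy a
  ext y
  by_cases hy : y ∈ U
  · rw [h a b y hy, h b a y hy, pd_comm hU f.2 hy]
  · exact (Set.indicator_of_notMem hy _).trans (Set.indicator_of_notMem hy _).symm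

/-- Evaluation at a point. -/
def smoothEval (y : Coord n) : smoothOn U →ₐ[ℝ] ℝ :=
  (Pi.evalAlgHom ℝ (fun _ : Coord n => ℝ) y).comp (smoothOn U).val

/-- As `U` is open, partial derivatives on `U` depend only on the values on `U`; evaluation
therefore passes through iterated derivatives. -/
lemma smoothEval_D (hU : IsOpen U) (a : Fin n) {f : smoothOn U} {f' : Coord n → ℝ}
    (h : ∀ z ∈ U, smoothEval z f = f' z) {y : Coord n} (hy : y ∈ U) :
    smoothEval y (smoothD hU a f) = pd a f' y :=
  (smoothD_apply hU a f hy).trans (pd_congr hU h hy a)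

/-- Smoothness of a component formula is read off from its being the value of a ring element. -/
lemma contDiffOn_of_smoothEval {f : smoothOn U} {f' : Coord n → ℝ}
    (h : ∀ z ∈ U, smoothEval z f = f' z) : ContDiffOn ℝ ∞ f' U :=
  f.2.congr fun z hz => (h z hz).symm

/-- A function that is smooth on `U`, cut off outside of `U`. -/
def smoothLift {f : Coord n → ℝ} (hf : ContDiffOn ℝ ∞ f U) : smoothOn U :=
  ⟨U.indicator f, hf.congr fun _ hz => Set.indicator_of_mem hz _⟩

lemma smoothEval_lift {f : Coord n → ℝ} (hf : ContDiffOn ℝ ∞ f U) {y : Coord n} (hy : y ∈ U) :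
    smoothEval y (smoothLift hf) = f y := Set.indicator_of_mem hy _

/-- The cut-off is what turns equality on `U`, for instance symmetry of a section, into equality in
the ring. -/
lemma smoothLift_congr {f f' : Coord n → ℝ} (hf : ContDiffOn ℝ ∞ f U) (hf' : ContDiffOn ℝ ∞ f' U)
    (h : ∀ z ∈ U, f z = f' z) : smoothLift hf = smoothLift hf' := by
  ext y
  by_cases hy : y ∈ U
  · exact (smoothEval_lift hf hy).trans ((h y hy).trans (smoothEval_lift hf' hy).symm)
  · exact (Set.indicator_of_notMem hy _).trans (Set.indicator_of_notMem hy _).symm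

end SmoothOn

/-! ### Metrics on an open set -/

/-- `g` is the matrix of a smooth pseudo-Riemannian metric on the open set `U`. -/
structure IsMetricOn {n : ℕ} (g : MetricMatrix n) (U : Set (Coord n)) : Prop where
  isOpen : IsOpen U
  smooth : ∀ a b, ContDiffOn ℝ ∞ (fun y => g y a b) U
  symm : ∀ y ∈ U, ∀ a b, g y a b = g y b a
  isUnit : ∀ y ∈ U, IsUnit (g y).det

section Metric

variable {n : ℕ} {g : MetricMatrix n} {U : Set (Coord n)}

lemma contDiffOn_det {ι : Type*} [Fintype ι] [DecidableEq ι] {A : Coord n → Matrix ι ι ℝ}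
    (hA : ∀ i j, ContDiffOn ℝ ∞ (fun y => A y i j) U) :
    ContDiffOn ℝ ∞ (fun y => (A y).det) U := by
  simp only [Matrix.det_apply]
  refine ContDiffOn.sum fun σ _ => ?_
  exact (contDiffOn_prod fun i _ => hA _ _).const_smul _

lemma contDiffOn_inv (hg : IsMetricOn g U) (a b : Fin n) :
    ContDiffOn ℝ ∞ (fun y => (g y)⁻¹ a b) U := by
  simp only [Matrix.inv_def, Ring.inverse_eq_inv', Matrix.smul_apply, smul_eq_mul,
    Matrix.adjugate_apply]
  refine ((contDiffOn_det hg.smooth).inv fun y hy => (hg.isUnit y hy).ne_zero).mul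
    (contDiffOn_det fun i j => ?_)
  simp only [Matrix.updateRow_apply]
  split_ifs
  · exact contDiffOn_const
  · exact hg.smooth _ _

lemma inv_symm_of_symm {G : Matrix (Fin n) (Fin n) ℝ} (h : ∀ a b, G a b = G b a) (a b : Fin n) :
    G⁻¹ a b = G⁻¹ b a := by
  have hT : G.transpose = G := by ext i j; exact h j i
  have : (G⁻¹).transpose = G⁻¹ := by rw [Matrix.transpose_nonsing_inv, hT]
  exact congrFun (congrFun this b) a

open Classical in
/-- The metric over the ring of smooth functions; outside of `U` it is replaced by the identity. -/
def IsMetricOn.toLocal (hg : IsMetricOn g U) : LocalMetric n (smoothOn U) where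
  D := smoothD hg.isOpen
  D_comm := smoothD_comm hg.isOpen
  g a b := ⟨fun y => if y ∈ U then g y a b else (1 : Matrix (Fin n) (Fin n) ℝ) a b,
    (hg.smooth a b).congr fun _ hy => if_pos hy⟩
  gi a b := ⟨fun y => if y ∈ U then (g y)⁻¹ a b else (1 : Matrix (Fin n) (Fin n) ℝ) a b,
    (contDiffOn_inv hg a b).congr fun _ hy => if_pos hy⟩
  g_symm a b := by
    ext y
    by_cases hy : y ∈ U
    · simp [hy, hg.symm y hy a b]
    · simp [hy, Matrix.one_apply, eq_comm]
  gi_symm a b := by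
    ext y
    by_cases hy : y ∈ U
    · simp [hy, inv_symm_of_symm (hg.symm y hy) a b]
    · simp [hy, Matrix.one_apply, eq_comm]
  g_gi a c := by
    ext y
    have h : ((if a = c then 1 else 0 : smoothOn U) : Coord n → ℝ) y
        = (1 : Matrix (Fin n) (Fin n) ℝ) a c := by
      rw [Matrix.one_apply]; split_ifs <;> rfl
    rw [h]
    by_cases hy : y ∈ U
    · rw [← Matrix.mul_nonsing_inv _ (hg.isUnit y hy), Matrix.mul_apply]
      simp [hy]
    · rw [← Matrix.one_mul (1 : Matrix (Fin n) (Fin n) ℝ), Matrix.mul_apply]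
      simp [hy]

/-- The metric at a point. -/
def pointMetric (G : Matrix (Fin n) (Fin n) ℝ) (hs : ∀ a b, G a b = G b a) (hd : IsUnit G.det) :
    LocalMetric n ℝ where
  -- At a point only the trace calculus is used, so trivial derivations suffice.
  D _ := 0
  D_comm _ _ _ := rfl
  g := G
  gi := (G⁻¹ : Matrix (Fin n) (Fin n) ℝ)
  g_symm := hs
  gi_symm := inv_symm_of_symm hs
  g_gi a c := by
    rw [← Matrix.one_apply, ← Matrix.mul_nonsing_inv _ hd, Matrix.mul_apply]

variable (hg : IsMetricOn g U) {y : Coord n}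

lemma IsMetricOn.eval_g (hy : y ∈ U) (a b : Fin n) : smoothEval y (hg.toLocal.g a b) = g y a b := if_pos hy

lemma IsMetricOn.eval_gi (hy : y ∈ U) (a b : Fin n) : 
    smoothEval y (hg.toLocal.gi a b) = (g y)⁻¹ a b := if_pos hy

end Metric

/-! ### Evaluation of the tensors over the ring of smooth functions -/

namespace IsMetricOn

variable {n : ℕ} {g : MetricMatrix n} {U : Set (Coord n)} (hg : IsMetricOn g U) {y : Coord n}

lemma eval_D (a : Fin n) {f : smoothOn U} {f' : Coord n → ℝ}
    (h : ∀ z ∈ U, smoothEval z f = f' z) (hy : y ∈ U) :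
    smoothEval y (hg.toLocal.D a f) = pd a f' y :=
  smoothEval_D hg.isOpen a h hy

lemma eval_algebraMap (r : ℝ) : smoothEval y (algebraMap ℝ (smoothOn U) r) = r :=
  (smoothEval y).commutes r

lemma eval_D_g (a b c : Fin n) (hy : y ∈ U) :
    smoothEval y (hg.toLocal.D a (hg.toLocal.g b c)) = pd a (fun z => g z b c) y :=
  hg.eval_D a (fun _ hz => hg.eval_g hz b c) hy

lemma eval_tr (T : Fin n → Fin n → smoothOn U) (hy : y ∈ U) :
    smoothEval y (hg.toLocal.tr T) = ∑ a, ∑ b, (g y)⁻¹ a b * smoothEval y (T a b) := by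
  simp only [LocalMetric.tr, map_sum, map_mul, hg.eval_gi hy]

lemma eval_up (T : Fin n → smoothOn U) (q : Fin n) (hy : y ∈ U) :
    smoothEval y (hg.toLocal.up T q) = ∑ r, (g y)⁻¹ q r * smoothEval y (T r) := by
  simp only [LocalMetric.up, map_sum, map_mul, hg.eval_gi hy]

lemma eval_up₂ (T : Fin n → Fin n → smoothOn U) (p q : Fin n) (hy : y ∈ U) :
    smoothEval y (hg.toLocal.up₂ T p q)
      = ∑ r, ∑ s, (g y)⁻¹ p r * (g y)⁻¹ q s * smoothEval y (T r s) := by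
  simp only [LocalMetric.up₂, map_sum, map_mul, hg.eval_gi hy]

lemma eval_Γ (c a b : Fin n) (hy : y ∈ U) :
    smoothEval y (hg.toLocal.Γ c a b) = christoffel g y c a b := by
  simp only [LocalMetric.Γ, christoffel, map_sum, map_mul, map_add, map_sub, eval_algebraMap,
    hg.eval_gi hy, hg.eval_D_g _ _ _ hy]

lemma eval_Rup (a b c d : Fin n) (hy : y ∈ U) :
    smoothEval y (hg.toLocal.Rup a b c d) = riemannUp g y a b c d := by
  have h : ∀ a b c d, smoothEval y (hg.toLocal.D a (hg.toLocal.Γ c b d))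
      = pd a (fun z => christoffel g z c b d) y := fun a b c d =>
    hg.eval_D a (fun _ hz => hg.eval_Γ c b d hz) hy
  simp only [LocalMetric.Rup, riemannUp, map_sum, map_mul, map_add, map_sub, h,
    hg.eval_Γ _ _ _ hy]

lemma eval_riem (a b c d : Fin n) (hy : y ∈ U) :
    smoothEval y (hg.toLocal.riem a b c d) = riemann g y a b c d := by
  simp only [LocalMetric.riem, riemann, map_sum, map_mul, hg.eval_Rup _ _ _ _ hy, hg.eval_g hy]

lemma eval_ric (a b : Fin n) (hy : y ∈ U) :
    smoothEval y (hg.toLocal.ric a b) = ricci g y a b := by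
  simp only [LocalMetric.ric, ricci, map_sum, hg.eval_Rup _ _ _ _ hy]

lemma eval_J (hy : y ∈ U) : smoothEval y hg.toLocal.J = schoutenTrace g y := by
  simp only [LocalMetric.J, schoutenTrace, map_mul, eval_algebraMap, hg.eval_tr _ hy,
    hg.eval_ric _ _ hy]
  ring

lemma eval_P (a b : Fin n) (hy : y ∈ U) :
    smoothEval y (hg.toLocal.P a b) = schouten g y a b := by
  simp only [LocalMetric.P, schouten, map_mul, map_sub, eval_algebraMap, hg.eval_J hy,
    hg.eval_ric _ _ hy, hg.eval_g hy]
  ring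

lemma eval_weyl (a b c d : Fin n) (hy : y ∈ U) :
    smoothEval y (hg.toLocal.weyl a b c d) = weyl g y a b c d := by
  simp only [LocalMetric.weyl, weyl, map_mul, map_sub, hg.eval_riem _ _ _ _ hy,
    hg.eval_P _ _ hy, hg.eval_g hy]

lemma eval_nab₂ {T : Fin n → Fin n → smoothOn U} {T' : Coord n → Fin n → Fin n → ℝ}
    (h : ∀ z ∈ U, ∀ a b, smoothEval z (T a b) = T' z a b) (a b c : Fin n) (hy : y ∈ U) :
    smoothEval y (hg.toLocal.nab₂ T a b c) = nabla₂ g T' y a b c := by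
  simp only [LocalMetric.nab₂, nabla₂, map_sub, map_sum, map_mul, hg.eval_Γ _ _ _ hy, h y hy,
    hg.eval_D a (fun z hz => h z hz b c) hy]

lemma eval_nab₃ {T : Fin n → Fin n → Fin n → smoothOn U}
    {T' : Coord n → Fin n → Fin n → Fin n → ℝ}
    (h : ∀ z ∈ U, ∀ a b c, smoothEval z (T a b c) = T' z a b c) (a b c d : Fin n) (hy : y ∈ U) :
    smoothEval y (hg.toLocal.nab₃ T a b c d) = nabla₃ g T' y a b c d := by
  simp only [LocalMetric.nab₃, nabla₃, map_sub, map_sum, map_mul, hg.eval_Γ _ _ _ hy, h y hy,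
    hg.eval_D a (fun z hz => h z hz b c d) hy]

lemma eval_cotton (a b c : Fin n) (hy : y ∈ U) :
    smoothEval y (hg.toLocal.cotton a b c) = cotton g y a b c := by
  have h : ∀ a b c, smoothEval y (hg.toLocal.nab₂ hg.toLocal.P a b c)
      = nabla₂ g (schouten g) y a b c :=
    fun a b c => hg.eval_nab₂ (fun z hz a b => hg.eval_P a b hz) a b c hy
  simp only [LocalMetric.cotton, cotton, map_sub, h]

lemma eval_bach (a b : Fin n) (hy : y ∈ U) :
    smoothEval y (hg.toLocal.bach a b) = bach g y a b := by
  have h : ∀ a b c d, smoothEval y (hg.toLocal.nab₃ hg.toLocal.cotton a b c d)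
      = nabla₃ g (cotton g) y a b c d :=
    fun a b c d => hg.eval_nab₃ (fun z hz a b c => hg.eval_cotton a b c hz) a b c d hy
  simp only [LocalMetric.bach, bach, map_add, map_sum, map_mul, hg.eval_tr _ hy, h,
    hg.eval_up₂ _ _ _ hy, hg.eval_P _ _ hy, hg.eval_weyl _ _ _ _ hy, Finset.sum_mul]

lemma eval_weylS (a b c d : Fin n) (hy : y ∈ U) :
    smoothEval y (hg.toLocal.weylS a b c d) = 2 * weylSym g y a b c d := by
  simp only [LocalMetric.weylS, weylSym, map_add, hg.eval_weyl _ _ _ _ hy]; ring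

lemma eval_cottonS (a b c : Fin n) (hy : y ∈ U) :
    smoothEval y (hg.toLocal.cottonS a b c) = 2 * cottonSym g y a b c := by
  simp only [LocalMetric.cottonS, cottonSym, map_add, hg.eval_cotton _ _ _ hy]; ring

lemma sum_six_eq (G : Matrix (Fin n) (Fin n) ℝ) (S T : Fin n → Fin n → Fin n → ℝ) :
    ∑ r, ∑ s, ∑ p, ∑ r', ∑ s', ∑ p', G r r' * G s s' * G p p' * S r' s' p' * T r s p
      = (1 / 2) * ∑ r, ∑ r', G r r' * ∑ s, ∑ s', G s s' * ∑ p, ∑ p', G p p' *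
        (2 * S r' s' p' * T r s p) := by
  simp only [Finset.mul_sum]
  refine Finset.sum_congr rfl fun r _ => ?_
  have h : ∀ s, ∑ p, ∑ r', ∑ s', ∑ p', G r r' * G s s' * G p p' * S r' s' p' * T r s p
      = ∑ r', ∑ s', ∑ p, ∑ p', G r r' * G s s' * G p p' * S r' s' p' * T r s p := by
    intro s
    rw [Finset.sum_comm]
    exact Finset.sum_congr rfl fun _ _ => Finset.sum_comm
  simp only [h]
  rw [Finset.sum_comm]
  refine Finset.sum_congr rfl fun _ _ => Finset.sum_congr rfl fun _ _ =>
    Finset.sum_congr rfl fun _ _ => Finset.sum_congr rfl fun _ _ =>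
    Finset.sum_congr rfl fun _ _ => by ring

lemma eval_weylWeyl (a q : Fin n) (hy : y ∈ U) :
    smoothEval y (hg.toLocal.weylWeyl a q) = weylWeyl g y a q := by
  rw [weylWeyl, sum_six_eq]
  simp only [LocalMetric.weylWeyl, map_mul, eval_algebraMap, hg.eval_tr _ hy,
    hg.eval_weylS _ _ _ _ hy, hg.eval_weyl _ _ _ _ hy]

lemma eval_weylCotton (a : Fin n) (hy : y ∈ U) :
    smoothEval y (hg.toLocal.weylCotton a) = weylCotton g y a := by
  rw [weylCotton, sum_six_eq (g y)⁻¹ (weylSym g y a) fun r s p => cotton g y p r s]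
  simp only [LocalMetric.weylCotton, map_mul, eval_algebraMap, hg.eval_tr _ hy,
    hg.eval_weylS _ _ _ _ hy, hg.eval_cotton _ _ _ hy]

lemma eval_tform (a : Fin n) (B C : TIdx n) (hy : y ∈ U) :
    smoothEval y (hg.toLocal.tform a B C) = tractorForm g y a B C := by
  rcases B with _ | b | _ <;> rcases C with _ | c | _ <;>
    simp [LocalMetric.tform, tractorForm, hg.eval_P _ _ hy, hg.eval_Γ _ _ _ hy, hg.eval_g hy,
      hg.eval_up _ _ hy, apply_ite (smoothEval y)]

lemma eval_tnab {F : TIdx n → TIdx n → smoothOn U} {F' : Coord n → Tractor₂ n}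
    (h : ∀ z ∈ U, ∀ B C, smoothEval z (F B C) = F' z B C) (a : Fin n) (B C : TIdx n)
    (hy : y ∈ U) :
    smoothEval y (hg.toLocal.tnab a F B C) = tractorNabla g a F' y B C := by
  simp only [LocalMetric.tnab, tractorNabla, map_add, map_sum, map_mul, hg.eval_tform _ _ _ hy,
    h y hy, hg.eval_D a (fun z hz => h z hz B C) hy]

end IsMetricOn

namespace LocalMetric

variable {n : ℕ} {R : Type*} [CommRing R] [Algebra ℝ R] (m : LocalMetric n R)

lemma modif_const_mul (k : R) (b : Fin n) (F : TIdx n → TIdx n → R) (B C : TIdx n) :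
    m.modif b (fun B C => k * F B C) B C = k * m.modif b F B C := by
  have hu : ∀ (v : Fin n → R) q, m.up (fun r => k * v r) q = k * m.up v q := fun v q => by
    simp only [up, Finset.mul_sum, mul_left_comm k]
  have hu₂ : ∀ (T : Fin n → Fin n → R) p q,
      m.up₂ (fun r s => k * T r s) p q = k * m.up₂ T p q := fun T p q => by
    simp only [up₂, Finset.mul_sum, mul_left_comm k]
  rcases B with _ | c | _ <;> rcases C with _ | d | _ <;>
    simp only [modif, mul_zero, modZZ, modZX, modXX, hu, hu₂, mul_left_comm _ k, mul_assoc k,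
      ← Finset.mul_sum] <;> ring

end LocalMetric

/-! ### Contraction of Ψ̃ with a symmetric 2-tractor -/

section Pointwise

variable {n : ℕ}

lemma sum_tractorIndex (f : TIdx n → ℝ) :
    ∑ B, f B = f slotY + (∑ b, f (slotZ b) + f slotX) := LocalMetric.sum_TIdx f

lemma Xup_eq (G : Matrix (Fin n) (Fin n) ℝ) (P : TIdx n) :
    Xup G P = if P = slotY then 1 else 0 := by
  rcases P with _ | p | _ <;> simp [Xup, hUp, Xlow]

lemma sum_Xup_mul (G : Matrix (Fin n) (Fin n) ℝ) (f : TIdx n → ℝ) :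
    ∑ P, Xup G P * f P = f slotY := by simp [Xup_eq]

lemma sum_Zup_mul (G : Matrix (Fin n) (Fin n) ℝ) (q : Fin n) (f : TIdx n → ℝ) :
    ∑ P, Zup G q P * f P = ∑ p, G⁻¹ p q * f (slotZ p) := by
  have h : ∀ P : TIdx n, Zup G q P = hUp G P (slotZ q) := fun P => by simp [Zup, Zlow]
  rw [sum_tractorIndex]
  simp [h, hUp]

lemma sum_sym_mul {f : Tractor₂ n} (hf : ∀ B C, f B C = f C B) (u v : TIdx n → ℝ) :
    ∑ P, ∑ Q, sym u v P Q * f P Q = ∑ P, u P * ∑ Q, v Q * f P Q := by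
  have h : ∑ P, ∑ Q, u Q * v P * f P Q = ∑ P, ∑ Q, u P * v Q * f P Q := by
    rw [Finset.sum_comm]
    exact Finset.sum_congr rfl fun P _ => Finset.sum_congr rfl fun Q _ => by rw [hf Q P]
  have h' : ∑ P, u P * ∑ Q, v Q * f P Q = ∑ P, ∑ Q, u P * v Q * f P Q := by
    simp only [Finset.mul_sum, mul_assoc]
  have h2 : ∑ P, ∑ Q, sym u v P Q * f P Q
      = (1 / 2) * (∑ P, ∑ Q, u P * v Q * f P Q + ∑ P, ∑ Q, u Q * v P * f P Q) := by
    simp only [← Finset.sum_add_distrib, Finset.mul_sum, sym]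
    exact Finset.sum_congr rfl fun P _ => Finset.sum_congr rfl fun Q _ => by ring
  rw [h2, h, h']
  ring

/-- Contraction with `f`, as a linear functional. -/
def contraction (f : Tractor₂ n) : Tractor₂ n →ₗ[ℝ] ℝ where
  toFun k := ∑ P, ∑ Q, k P Q * f P Q
  map_add' k k' := by simp [add_mul, Finset.sum_add_distrib]
  map_smul' r k := by
    simp only [Pi.smul_apply, smul_eq_mul, RingHom.id_apply, Finset.mul_sum, mul_assoc]

lemma contraction_XX (G : Matrix (Fin n) (Fin n) ℝ) (f : Tractor₂ n) :
    contraction f (fun P Q => Xup G P * Xup G Q) = f slotY slotY := by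
  have : contraction f (fun P Q => Xup G P * Xup G Q)
      = ∑ P, Xup G P * ∑ Q, Xup G Q * f P Q := by
    simp only [contraction, LinearMap.coe_mk, AddHom.coe_mk, Finset.mul_sum, mul_assoc]
  simp only [this, sum_Xup_mul]

lemma contraction_XZ (G : Matrix (Fin n) (Fin n) ℝ) {f : Tractor₂ n}
    (hf : ∀ B C, f B C = f C B) (q : Fin n) :
    contraction f (sym (Xup G) (Zup G q)) = ∑ p, G⁻¹ p q * f slotY (slotZ p) := by
  have : contraction f (sym (Xup G) (Zup G q)) = _ := sum_sym_mul hf _ _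
  simp only [this, sum_Xup_mul, sum_Zup_mul]

lemma contraction_ZZ (G : Matrix (Fin n) (Fin n) ℝ) {f : Tractor₂ n}
    (hf : ∀ B C, f B C = f C B) (p q : Fin n) :
    contraction f (sym (Zup G p) (Zup G q))
      = ∑ r, ∑ s, G⁻¹ r p * G⁻¹ s q * f (slotZ r) (slotZ s) := by
  have : contraction f (sym (Zup G p) (Zup G q)) = _ := sum_sym_mul hf _ _
  simp only [this, sum_Zup_mul]
  simp only [Finset.mul_sum, mul_assoc]

/-- Displays Ψ̃ as a linear combination of products of injectors, so that the linear functional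
`contraction` can be applied term by term. -/
lemma psi_eq (g : MetricMatrix n) (y : Coord n) (a : Fin n) (B C : TIdx n) :
    psi g y a B C =
    -(∑ b, ∑ c, sym (Zlow b) (Zlow c) B C •
      ((∑ q, weylSym g y a b c q • sym (Xup (g y)) (Zup (g y) q))
        + cottonSym g y a b c • fun P Q => Xup (g y) P * Xup (g y) Q))
    + ∑ c, sym Xlow (Zlow c) B C •
      (-(4 / (n : ℝ)) • (∑ p, ∑ q, weylSym g y a p q c • sym (Zup (g y) p) (Zup (g y) q))
        + (2 : ℝ) • (∑ q, (cottonSym g y a c q + (((n : ℝ) - 4) / n) * cottonSym g y q a c) •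
            sym (Xup (g y)) (Zup (g y) q))
        - (1 / (n : ℝ)) • (bach g y a c • fun P Q => Xup (g y) P * Xup (g y) Q))
    + (Xlow B * Xlow C) •
      (-(4 / (n : ℝ)) • (∑ p, ∑ q, cottonSym g y a p q • sym (Zup (g y) p) (Zup (g y) q))
        + (1 / (n : ℝ)) • (∑ q, (bach g y a q + (4 / (3 * ((n : ℝ) - 1))) * weylWeyl g y a q) •
            sym (Xup (g y)) (Zup (g y) q))
        + (4 / (3 * (n : ℝ) * ((n : ℝ) - 1))) •
          (weylCotton g y a • fun P Q => Xup (g y) P * Xup (g y) Q)) := by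
  funext P Q
  simp only [psi, Finset.sum_apply, Pi.add_apply, Pi.sub_apply, Pi.neg_apply, Pi.smul_apply,
    smul_eq_mul, mul_comm (weylSym _ _ _ _ _ _), mul_comm (cottonSym _ _ _ _ _),
    mul_comm (bach _ _ _ _), mul_comm (weylCotton _ _ _), mul_comm (_ + _) (sym _ _ _ _)]

lemma psiAct_eq (g : MetricMatrix n) (y : Coord n) (a : Fin n) {f : Tractor₂ n}
    (hf : ∀ B C, f B C = f C B) (B C : TIdx n) :
    psiAct g y a f B C =
    -(∑ b, ∑ c, sym (Zlow b) (Zlow c) B C *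
      ((∑ q, weylSym g y a b c q * ∑ p, (g y)⁻¹ p q * f slotY (slotZ p))
        + cottonSym g y a b c * f slotY slotY))
    + ∑ c, sym Xlow (Zlow c) B C *
      (-(4 / (n : ℝ)) * (∑ p, ∑ q, weylSym g y a p q c *
          ∑ r, ∑ s, (g y)⁻¹ r p * (g y)⁻¹ s q * f (slotZ r) (slotZ s))
        + 2 * (∑ q, (cottonSym g y a c q + (((n : ℝ) - 4) / n) * cottonSym g y q a c) *
            ∑ p, (g y)⁻¹ p q * f slotY (slotZ p))
        - (1 / (n : ℝ)) * (bach g y a c * f slotY slotY))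
    + (Xlow B * Xlow C) *
      (-(4 / (n : ℝ)) * (∑ p, ∑ q, cottonSym g y a p q *
          ∑ r, ∑ s, (g y)⁻¹ r p * (g y)⁻¹ s q * f (slotZ r) (slotZ s))
        + (1 / (n : ℝ)) * (∑ q, (bach g y a q + (4 / (3 * ((n : ℝ) - 1))) * weylWeyl g y a q) *
            ∑ p, (g y)⁻¹ p q * f slotY (slotZ p))
        + (4 / (3 * (n : ℝ) * ((n : ℝ) - 1))) * (weylCotton g y a * f slotY slotY)) := by
  have : psiAct g y a f B C = contraction f (psi g y a B C) := rfl
  rw [this, psi_eq]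
  simp only [map_add, map_sub, map_neg, map_sum, map_smul, smul_eq_mul, contraction_XX,
    contraction_XZ _ hf, contraction_ZZ _ hf]

lemma sum_sym_ZlowZlow (k : Fin n → Fin n → ℝ) (c d : Fin n) :
    ∑ b, ∑ b', sym (Zlow b) (Zlow b') (slotZ c) (slotZ d) * k b b' = (k c d + k d c) / 2 := by
  have h : ∀ b b', sym (Zlow b) (Zlow b') (slotZ c) (slotZ d) * k b b' =
      (1 / 2) * ((if c = b then 1 else 0) * ((if d = b' then 1 else 0) * k b b')
        + (if d = b then 1 else 0) * ((if c = b' then 1 else 0) * k b b')) := by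
    intro b b'; simp only [sym, Zlow, Sum.inr.injEq, Sum.inl.injEq]; ring
  simp only [h, ← Finset.mul_sum, Finset.sum_add_distrib]
  simp
  ring

/-- The factor 1/2 from the symmetrised product X Z explains why the constants of `modXX` are twice
those one would read off from `modZX`. -/
lemma sum_sym_XlowZlow (k : Fin n → ℝ) (c : Fin n) :
    ∑ b, sym Xlow (Zlow b) (slotZ c) slotX * k b = k c / 2 := by
  have h : ∀ b, sym Xlow (Zlow b) (slotZ c) slotX * k b
      = (1 / 2) * ((if c = b then 1 else 0) * k b) := by
    intro b; split_ifs <;> simp_all [sym, Zlow, Xlow]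
  simp only [h, ← Finset.mul_sum]
  simp
  ring

lemma sym_comm (u v : TIdx n → ℝ) (B C : TIdx n) : sym u v B C = sym u v C B := by
  rw [sym, sym, add_comm]

/-- Reconciles the unsymmetrised Weyl and Cotton tensors of `modZX` and `modXX` with the symmetrised
ones of Ψ̃. -/
lemma sum_mul_of_symm {S : Fin n → Fin n → ℝ} (hS : ∀ p q, S p q = S q p)
    (k : Fin n → Fin n → ℝ) :
    ∑ p, ∑ q, S p q * k p q = ∑ p, ∑ q, (k p q + k q p) / 2 * S p q := by
  have h : ∑ p, ∑ q, S p q * k q p = ∑ p, ∑ q, S p q * k p q := by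
    rw [Finset.sum_comm]
    exact Finset.sum_congr rfl fun p _ => Finset.sum_congr rfl fun q _ => by rw [hS q p]
  have h' : ∑ p, ∑ q, (k p q + k q p) / 2 * S p q
      = (1 / 2) * (∑ p, ∑ q, S p q * k p q + ∑ p, ∑ q, S p q * k q p) := by
    simp only [← Finset.sum_add_distrib, Finset.mul_sum]
    exact Finset.sum_congr rfl fun p _ => Finset.sum_congr rfl fun q _ => by ring
  rw [h', h]; ring

lemma psiAct_symm (g : MetricMatrix n) (y : Coord n) (a : Fin n) (f : Tractor₂ n) (B C : TIdx n) :
    psiAct g y a f B C = psiAct g y a f C B := by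
  have h : psi g y a B C = psi g y a C B := by
    funext P Q
    simp only [psi, sym_comm _ _ B C, mul_comm (Xlow B)]
  rw [psiAct, psiAct, h]

end Pointwise

/-! ### Evaluation of the modification and its identification with (2/3)Ψ̃ -/

namespace IsMetricOn

variable {n : ℕ} {g : MetricMatrix n} {U : Set (Coord n)} (hg : IsMetricOn g U) {y : Coord n}

lemma eval_third : smoothEval y hg.toLocal.third = 1 / 3 := eval_algebraMap _

lemma eval_invDim : smoothEval y hg.toLocal.invDim = 1 / (n : ℝ) := eval_algebraMap _

lemma eval_invDimPred : smoothEval y hg.toLocal.invDimPred = 1 / ((n : ℝ) - 1) :=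
  eval_algebraMap _

lemma eval_modZZ (s : smoothOn U) (μ : Fin n → smoothOn U) (b c d : Fin n) (hy : y ∈ U) :
    smoothEval y (hg.toLocal.modZZ s μ b c d) = -(1 / 3) *
      (∑ q, 2 * weylSym g y b c d q * ∑ p, (g y)⁻¹ q p * smoothEval y (μ p)
        + 2 * cottonSym g y b c d * smoothEval y s) := by
  simp only [LocalMetric.modZZ, map_mul, map_neg, map_add, map_sum, eval_third,
    hg.eval_weylS _ _ _ _ hy, hg.eval_cottonS _ _ _ hy, hg.eval_up _ _ hy]

lemma eval_modZX (s : smoothOn U) (μ : Fin n → smoothOn U) (w : Fin n → Fin n → smoothOn U)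
    (b c : Fin n) (hy : y ∈ U) :
    smoothEval y (hg.toLocal.modZX s μ w b c) =
      -(4 * (1 / 3) * (1 / (n : ℝ))) * (∑ p, ∑ q,
        (∑ r, ∑ t, (g y)⁻¹ p r * (g y)⁻¹ q t * smoothEval y (w r t)) * weyl g y b p q c)
      + (1 / 3) * (∑ q, (2 * cottonSym g y b c q + (1 - 4 * (1 / (n : ℝ))) *
          (2 * cottonSym g y q b c)) * ∑ p, (g y)⁻¹ q p * smoothEval y (μ p))
      - (1 / 3) * (1 / (n : ℝ)) * (bach g y b c * smoothEval y s) := by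
  simp only [LocalMetric.modZX, LocalMetric.cottonE, map_mul, map_neg, map_add, map_sub, map_sum,
    map_one, map_ofNat, eval_third, eval_invDim, hg.eval_weyl _ _ _ _ hy, hg.eval_cottonS _ _ _ hy,
    hg.eval_up _ _ hy, hg.eval_up₂ _ _ _ hy, hg.eval_bach _ _ hy]

lemma eval_modXX (s : smoothOn U) (μ : Fin n → smoothOn U) (w : Fin n → Fin n → smoothOn U)
    (b : Fin n) (hy : y ∈ U) :
    smoothEval y (hg.toLocal.modXX s μ w b) =
      -(8 * (1 / 3) * (1 / (n : ℝ))) * (∑ p, ∑ q,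
        (∑ r, ∑ t, (g y)⁻¹ p r * (g y)⁻¹ q t * smoothEval y (w r t)) * cotton g y b p q)
      + 2 * (1 / 3) * (1 / (n : ℝ)) * (∑ q, (bach g y b q + 4 * (1 / 3) * (1 / ((n : ℝ) - 1)) *
          weylWeyl g y b q) * ∑ p, (g y)⁻¹ q p * smoothEval y (μ p))
      + 8 * (1 / 3) ^ 2 * (1 / (n : ℝ)) * (1 / ((n : ℝ) - 1)) *
        (weylCotton g y b * smoothEval y s) := by
  simp only [LocalMetric.modXX, map_mul, map_neg, map_add, map_sum, map_pow, map_ofNat,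
    eval_third, eval_invDim, eval_invDimPred, hg.eval_cotton _ _ _ hy, hg.eval_weylWeyl _ _ hy,
    hg.eval_weylCotton _ hy, hg.eval_up _ _ hy, hg.eval_up₂ _ _ _ hy, hg.eval_bach _ _ hy]

/-- The modification, acting on components at a point. -/
def modAct (a : Fin n) (y : Coord n) : Tractor₂ n →ₗ[ℝ] Tractor₂ n where
  toFun f B C := smoothEval y (hg.toLocal.modif a (fun B C => algebraMap ℝ _ (f B C)) B C)
  map_add' f f' := by
    funext B C
    simp only [Pi.add_apply, map_add, LocalMetric.modif_add]
  map_smul' r f := by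
    funext B C
    have h : (fun B C => algebraMap ℝ (smoothOn U) ((r • f) B C))
        = fun B C => algebraMap ℝ (smoothOn U) r * algebraMap ℝ (smoothOn U) (f B C) := by
      funext B C; simp
    rw [h, hg.toLocal.modif_const_mul, map_mul, eval_algebraMap]
    rfl

/-- No derivative of F enters the modification, so replacing F by constants with the same value at
the point changes nothing there. -/
lemma modAct_eval (F : TIdx n → TIdx n → smoothOn U) (a : Fin n) (hy : y ∈ U) :
    hg.modAct a y (fun B C => smoothEval y (F B C))
      = fun B C => smoothEval y (hg.toLocal.modif a F B C) := by
  funext B C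
  simp only [modAct, LinearMap.coe_mk, AddHom.coe_mk]
  rcases B with _ | c | _ <;> rcases C with _ | d | _ <;>
    simp only [LocalMetric.modif, eval_algebraMap, hg.eval_modZZ _ _ _ _ _ hy,
      hg.eval_modZX _ _ _ _ _ hy, hg.eval_modXX _ _ _ _ hy]

lemma modAct_symm (a : Fin n) (y : Coord n) (f : Tractor₂ n) (B C : TIdx n) :
    hg.modAct a y f B C = hg.modAct a y f C B := by
  simp only [modAct, LinearMap.coe_mk, AddHom.coe_mk]
  rw [LocalMetric.modif_symm]

/-- Both sides are symmetric with vanishing Y slots, so ZZ, ZX and XX remain. Symmetry of f is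
essential, as Ψ̃ symmetrises its upper indices. -/
lemma modAct_eq_psiAct (hn : 3 ≤ n) {f : Tractor₂ n} (hf : ∀ B C, f B C = f C B) (a : Fin n)
    (hy : y ∈ U) : hg.modAct a y f = (2 / 3 : ℝ) • psiAct g y a f := by
  have hi := inv_symm_of_symm (hg.symm y hy)
  have hn0 : (n : ℝ) ≠ 0 := by positivity
  have hn1 : (n : ℝ) - 1 ≠ 0 := by
    have : (3 : ℝ) ≤ n := by exact_mod_cast hn
    linarith
  have hS : ∀ p q, ∑ r, ∑ t, (g y)⁻¹ p r * (g y)⁻¹ q t * f (slotZ r) (slotZ t) =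
      ∑ r, ∑ t, (g y)⁻¹ q r * (g y)⁻¹ p t * f (slotZ r) (slotZ t) := by
    intro p q
    rw [Finset.sum_comm]
    exact Finset.sum_congr rfl fun r _ => Finset.sum_congr rfl fun t _ => by
      rw [hf (slotZ t)]; ring
  have h₁ : ∀ q, ∑ p, (g y)⁻¹ p q * f slotY (slotZ p) = ∑ p, (g y)⁻¹ q p * f slotY (slotZ p) :=
    fun q => Finset.sum_congr rfl fun p _ => by rw [hi p q]
  have h₂ : ∀ p q, ∑ r, ∑ s, (g y)⁻¹ r p * (g y)⁻¹ s q * f (slotZ r) (slotZ s) =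
      ∑ r, ∑ s, (g y)⁻¹ p r * (g y)⁻¹ q s * f (slotZ r) (slotZ s) :=
    fun p q => Finset.sum_congr rfl fun r _ => Finset.sum_congr rfl fun s _ => by
      rw [hi r p, hi s q]
  have hZX : ∀ c, hg.modAct a y f (slotZ c) slotX
      = ((2 / 3 : ℝ) • psiAct g y a f) (slotZ c) slotX := by
    intro c
    rw [Pi.smul_apply, Pi.smul_apply, psiAct_eq g y a hf, sum_sym_XlowZlow]
    have hZ : ∀ b b' : Fin n, sym (Zlow b) (Zlow b') (slotZ c) slotX = 0 := by simp [sym, Zlow]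
    have hX : Xlow (slotZ c) = 0 := by simp [Xlow]
    simp only [modAct, LinearMap.coe_mk, AddHom.coe_mk, smul_eq_mul, LocalMetric.modif,
      hg.eval_modZX _ _ _ _ _ hy, hZ, hX, h₁, h₂, eval_algebraMap, sum_mul_of_symm hS]
    have hW : ∀ p q, (weyl g y a p q c + weyl g y a q p c) / 2 = weylSym g y a p q c :=
      fun _ _ => rfl
    simp only [hW, zero_mul, Finset.sum_const_zero]
    have hE : ∀ k : Fin n → ℝ, ∑ q, (2 * cottonSym g y a c q + (1 - 4 * (1 / (n : ℝ))) *
        (2 * cottonSym g y q a c)) * k q = 2 * ∑ q, (cottonSym g y a c q + ((n : ℝ) - 4) / n *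
        cottonSym g y q a c) * k q := by
      intro k
      rw [Finset.mul_sum]
      refine Finset.sum_congr rfl fun q _ => ?_
      field_simp
    rw [hE]
    field_simp
    ring
  have hsymm : ∀ B C, ((2 / 3 : ℝ) • psiAct g y a f) B C = ((2 / 3 : ℝ) • psiAct g y a f) C B := by
    intro B C
    simp only [Pi.smul_apply, psiAct_symm g y a f B C]
  have hY : ∀ C, hg.modAct a y f slotY C = ((2 / 3 : ℝ) • psiAct g y a f) slotY C := by
    intro C
    rw [Pi.smul_apply, Pi.smul_apply, psiAct_eq g y a hf]
    rcases C with _ | d | _ <;> simp [modAct, LocalMetric.modif, sym, Zlow, Xlow]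
  funext B C
  rcases B with _ | c | _
  · exact hY C
  · rcases C with _ | d | _
    · rw [modAct_symm, hsymm, hY]
    · rw [Pi.smul_apply, Pi.smul_apply, psiAct_eq g y a hf, sum_sym_ZlowZlow]
      have hX : ∀ c : Fin n, Xlow (slotZ c) = 0 := by simp [Xlow]
      have hX' : ∀ b, sym Xlow (Zlow b) (slotZ c) (slotZ d) = 0 := by simp [sym, Xlow]
      have hw : ∀ q, weylSym g y a d c q = weylSym g y a c d q := fun q => by
        rw [weylSym, weylSym, add_comm]
      have hc : cottonSym g y a d c = cottonSym g y a c d := by rw [cottonSym, cottonSym, add_comm]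
      simp only [modAct, LinearMap.coe_mk, AddHom.coe_mk, smul_eq_mul, LocalMetric.modif,
        hg.eval_modZZ _ _ _ _ _ hy, hX, hX', h₁, eval_algebraMap, hw, hc, mul_assoc (2 : ℝ),
        ← Finset.mul_sum, zero_mul, Finset.sum_const_zero]
      ring
    · exact hZX c
  · rcases C with _ | d | _
    · rw [modAct_symm, hsymm, hY]
    · rw [modAct_symm, hsymm, hZX]
    · rw [Pi.smul_apply, Pi.smul_apply, psiAct_eq g y a hf]
      have hZ : ∀ b b' : Fin n, sym (Zlow b) (Zlow b') slotX slotX = 0 := by simp [sym, Zlow]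
      have hX : ∀ b : Fin n, sym Xlow (Zlow b) slotX slotX = 0 := by simp [sym, Zlow]
      have hX' : Xlow (slotX : TIdx n) = 1 := by simp [Xlow]
      have hA : ∀ p q, (cotton g y a p q + cotton g y a q p) / 2 = cottonSym g y a p q :=
        fun _ _ => rfl
      have hE : ∀ k : Fin n → ℝ, ∑ q, (bach g y a q + 4 * (1 / 3) * (1 / ((n : ℝ) - 1)) *
          weylWeyl g y a q) * k q = ∑ q, (bach g y a q + 4 / (3 * ((n : ℝ) - 1)) *
          weylWeyl g y a q) * k q := by
        intro k
        refine Finset.sum_congr rfl fun q _ => ?_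
        field_simp
      simp only [modAct, LinearMap.coe_mk, AddHom.coe_mk, smul_eq_mul, LocalMetric.modif,
        hg.eval_modXX _ _ _ _ hy, hZ, hX, hX', h₁, h₂, eval_algebraMap, sum_mul_of_symm hS, hA,
        zero_mul, Finset.sum_const_zero, hE]
      generalize ∑ q, (bach g y a q + 4 / (3 * ((n : ℝ) - 1)) * weylWeyl g y a q) *
        ∑ p, (g y)⁻¹ q p * f slotY (slotZ p) = S
      field_simp
      ring

end IsMetricOn

section Codifferential

variable {n : ℕ}

/-! ### The Kostant codifferential in slots -/

lemma sharp_iota (G : Matrix (Fin n) (Fin n) ℝ) (a : Fin n) (f : Tractor₂ n) (B C : TIdx n) :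
    sharp G (iota a) f B C =
      Zlow a B * f slotY C - Xlow B * ∑ p, G⁻¹ p a * f (slotZ p) C
      + (Zlow a C * f B slotY - Xlow C * ∑ p, G⁻¹ p a * f B (slotZ p)) := by
  have h : ∀ P B, ∑ E, hUp G P E * iota a E B = Xlow B * Zup G a P - Zlow a B * Xup G P := by
    intro P B
    simp only [Zup, Xup, Finset.mul_sum, ← Finset.sum_sub_distrib, iota]
    exact Finset.sum_congr rfl fun E _ => by ring
  have h' : ∀ B (k : TIdx n → ℝ), ∑ P, (Xlow B * Zup G a P - Zlow a B * Xup G P) * k P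
      = Xlow B * ∑ p, G⁻¹ p a * k (slotZ p) - Zlow a B * k slotY := by
    intro B k
    rw [← sum_Zup_mul, ← sum_Xup_mul G k]
    simp only [Finset.mul_sum, ← Finset.sum_sub_distrib]
    exact Finset.sum_congr rfl fun P _ => by ring
  simp only [sharp, h, h']
  ring

lemma codiff_apply (G : Matrix (Fin n) (Fin n) ℝ) (K : Fin n → Fin n → Tractor₂ n) (b : Fin n)
    (B C : TIdx n) : codiff G K b B C =
      (∑ a, Zlow a B * K a b slotY C - Xlow B * ∑ a, ∑ p, G⁻¹ p a * K a b (slotZ p) C)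
      + (∑ a, Zlow a C * K a b B slotY - Xlow C * ∑ a, ∑ p, G⁻¹ p a * K a b B (slotZ p)) := by
  simp only [codiff, Finset.sum_apply, sharp_iota, Finset.sum_add_distrib, Finset.sum_sub_distrib,
    Finset.mul_sum]

variable {G : Matrix (Fin n) (Fin n) ℝ} (K : Fin n → Fin n → Tractor₂ n) (b : Fin n)

lemma codiff_symm {K : Fin n → Fin n → Tractor₂ n} (hK : ∀ a b B C, K a b B C = K a b C B)
    (b : Fin n) (B C : TIdx n) : codiff G K b B C = codiff G K b C B := by
  rw [codiff_apply, codiff_apply, add_comm]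
  simp only [hK _ _ _ B, hK _ _ C _]

lemma codiff_YY : codiff G K b slotY slotY = 0 := by simp [codiff_apply, Zlow, Xlow]

lemma codiff_YZ (c : Fin n) : codiff G K b slotY (slotZ c) = K c b slotY slotY := by
  simp [codiff_apply, Zlow, Xlow]

lemma codiff_ZZ (c d : Fin n) :
    codiff G K b (slotZ c) (slotZ d) = K c b slotY (slotZ d) + K d b (slotZ c) slotY := by
  simp [codiff_apply, Zlow, Xlow]

end Codifferential

section Codifferential

variable {n : ℕ} (m : LocalMetric n ℝ) {G : Matrix (Fin n) (Fin n) ℝ}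

lemma sum_inv_mul_eq_tr (hG : ∀ a b, m.gi a b = G⁻¹ a b) (T : Fin n → Fin n → ℝ) :
    ∑ a, ∑ p, G⁻¹ p a * T a p = m.tr T := by
  simp only [LocalMetric.tr, ← hG, m.gi_symm]

lemma codiff_YX (hG : ∀ a b, m.gi a b = G⁻¹ a b) (K : Fin n → Fin n → Tractor₂ n) (b : Fin n) :
    codiff G K b slotY slotX = - m.tr fun a p => K a b slotY (slotZ p) := by
  rw [← sum_inv_mul_eq_tr m hG]
  simp [codiff_apply, Zlow, Xlow]

lemma codiff_ZX (hG : ∀ a b, m.gi a b = G⁻¹ a b) (K : Fin n → Fin n → Tractor₂ n) (b c : Fin n) :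
    codiff G K b (slotZ c) slotX
      = K c b slotY slotX - m.tr fun a p => K a b (slotZ c) (slotZ p) := by
  rw [← sum_inv_mul_eq_tr m hG]
  simp [codiff_apply, Zlow, Xlow, sub_eq_add_neg]

lemma codiff_XX (hG : ∀ a b, m.gi a b = G⁻¹ a b) {K : Fin n → Fin n → Tractor₂ n}
    (hK : ∀ a b B C, K a b B C = K a b C B) (b : Fin n) :
    codiff G K b slotX slotX = - 2 * m.tr fun a p => K a b (slotZ p) slotX := by
  rw [← sum_inv_mul_eq_tr m hG]
  simp only [codiff_apply, hK _ _ slotX]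
  simp [Zlow, Xlow]
  ring

/-- Contraction with X_{[E}Z_{F]} either uses a Y slot or takes a trace against Z; once the Y slots
vanish, only two traces are visible to ∂^*. -/
lemma codiff_eq_zero (hG : ∀ a b, m.gi a b = G⁻¹ a b) {K : Fin n → Fin n → Tractor₂ n}
    (hK : ∀ a b B C, K a b B C = K a b C B)
    (hYY : ∀ a b, K a b slotY slotY = 0) (hYZ : ∀ a b c, K a b slotY (slotZ c) = 0)
    (hYX : ∀ a b, K a b slotY slotX = 0)
    (hZZ : ∀ b c, m.tr (fun a d => K a b (slotZ c) (slotZ d)) = 0)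
    (hZX : ∀ b, m.tr (fun a c => K a b (slotZ c) slotX) = 0) (b : Fin n) :
    codiff G K b = 0 := by
  funext B C
  have h := codiff_symm (G := G) hK b
  have h1 : ∀ c, codiff G K b slotY (slotZ c) = 0 := fun c => by rw [codiff_YZ, hYY]
  have h2 : codiff G K b slotY slotX = 0 := by
    simp only [codiff_YX m hG, hYZ, LocalMetric.tr_zero, neg_zero]
  have h3 : ∀ c, codiff G K b (slotZ c) slotX = 0 := fun c => by
    rw [codiff_ZX m hG, hYX, hZZ, sub_zero]
  rcases B with _ | c | _ <;> rcases C with _ | d | _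
  · exact codiff_YY K b
  · exact h1 d
  · exact h2
  · exact (h _ _).trans (h1 c)
  · change codiff G K b (slotZ c) (slotZ d) = 0
    rw [codiff_ZZ, hYZ, hK, hYZ, add_zero]
  · exact h3 c
  · exact (h _ _).trans h2
  · exact (h _ _).trans (h3 d)
  · change codiff G K b slotX slotX = 0
    rw [codiff_XX m hG hK, hZX, mul_zero]

/-- The components of 1-forms in the image of the codifferential. -/
structure IsCoexact (m : LocalMetric n ℝ) (f : Fin n → Tractor₂ n) : Prop where
  symm : ∀ b B C, f b B C = f b C B
  YY : ∀ b, f b slotY slotY = 0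
  YZ : ∀ b c, f b slotY (slotZ c) = - f c slotY (slotZ b)
  ZZ_cyclic : ∀ b c d, f b (slotZ c) (slotZ d) + f c (slotZ d) (slotZ b)
    + f d (slotZ b) (slotZ c) = 0
  ZZ_tr : ∀ b, m.tr (fun c d => f b (slotZ c) (slotZ d)) = -2 * f b slotY slotX
  ZX_tr : m.tr (fun b c => f b (slotZ c) slotX) = 0

/-- Each relation is the cancellation of the skew form indices of the 2-form against a
symmetrisation, except the trace of ZZ, which repeats the YX slot. -/
lemma isCoexact_codiff (hG : ∀ a b, m.gi a b = G⁻¹ a b) {K : Fin n → Fin n → Tractor₂ n}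
    (hK : ∀ a b B C, K a b B C = K a b C B) (hs : ∀ a b, K a b = - K b a) :
    IsCoexact m (codiff G K) where
  symm := codiff_symm hK
  YY := codiff_YY K
  YZ b c := by rw [codiff_YZ, codiff_YZ, hs c b]; rfl
  ZZ_cyclic b c d := by
    have h : ∀ a b B C, K a b B C = - K b a B C := fun a b B C => by rw [hs a b]; rfl
    simp only [codiff_ZZ, hK _ _ (slotZ _) slotY]
    rw [h c b, h d b, h d c]
    ring
  ZZ_tr b := by
    simp only [codiff_ZZ, hK _ _ (slotZ _) slotY, codiff_YX m hG, LocalMetric.tr_add]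
    rw [m.tr_swap fun a p => K a b slotY (slotZ p)]
    ring
  ZX_tr := by
    have h : ∀ a b B C, K a b B C = - K b a B C := fun a b B C => by rw [hs a b]; rfl
    simp only [codiff_ZX m hG, LocalMetric.tr_sub]
    have h1 : m.tr (fun b c => K c b slotY slotX) = 0 := m.tr_skew _ fun b c => h c b _ _
    have h2 : m.tr (fun b c => m.tr fun a p => K a b (slotZ c) (slotZ p)) = 0 := by
      have e : m.tr (fun b c => m.tr fun a p => K a b (slotZ c) (slotZ p))
          = - m.tr (fun b c => m.tr fun a p => K a b (slotZ c) (slotZ p)) := by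
        conv_lhs => rw [m.tr_comm]
        rw [← m.tr_neg]
        refine m.tr_congr fun a p => ?_
        rw [← m.tr_neg]
        refine m.tr_congr fun b c => ?_
        rw [h a b, hK]
      linarith
    rw [h1, h2, sub_zero]

end Codifferential

/-! ### Uniqueness, slot by slot -/

section Slots

variable {n : ℕ} (m : LocalMetric n ℝ) {G : Matrix (Fin n) (Fin n) ℝ}

namespace IsCoexact

variable {m} {d : Fin n → Tractor₂ n} {N : Fin n → Fin n → Tractor₂ n}

/-- In this and the next lemmas `hN` records the algebraic part of ∇δ in the leading slot. Here both
the equation and coexactness concern the same skew 2-tensor, with nonzero coefficient. -/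
lemma YZ_eq_zero (hd : IsCoexact m d)
    (hN : ∀ a b, N a b slotY slotY = -2 * d b slotY (slotZ a))
    (h : ∀ b, codiff G (fun a b => N a b - N b a) b = 0) (b c : Fin n) :
    d b slotY (slotZ c) = 0 := by
  have h1 := congrFun (congrFun (h b) slotY) (slotZ c)
  rw [codiff_YZ] at h1
  simp only [Pi.sub_apply, Pi.zero_apply, hN] at h1
  linarith [hd.YZ b c]

/-- The traces of the ZZ slot are tied to the YX slot by coexactness, so tracing the equation leaves
n + 2 times the unknown. -/
lemma YX_eq_zero (hd : IsCoexact m d) (hG : ∀ a b, m.gi a b = G⁻¹ a b)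
    (hN : ∀ a b c, N a b slotY (slotZ c)
      = - d b (slotZ a) (slotZ c) + m.g a c * d b slotY slotX)
    (h : ∀ b, codiff G (fun a b => N a b - N b a) b = 0) (b : Fin n) : d b slotY slotX = 0 := by
  have h1 := congrFun (congrFun (h b) slotY) slotX
  rw [codiff_YX m hG] at h1
  simp only [Pi.sub_apply, Pi.zero_apply, hN, LocalMetric.tr_sub, LocalMetric.tr_add,
    LocalMetric.tr_neg, LocalMetric.tr_mul_right, hd.ZZ_tr] at h1
  have h2 : m.tr (fun a c => m.g b c * d a slotY slotX) = d b slotY slotX := by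
    rw [← m.tr_swap]; exact m.tr_g_mul' b fun a => d a slotY slotX
  have h3 : m.tr (fun a c => d a (slotZ b) (slotZ c)) = d b slotY slotX := by
    have e : m.tr (fun a c => d a (slotZ b) (slotZ c) + d b (slotZ c) (slotZ a)
        + d c (slotZ a) (slotZ b)) = 0 := by
      simp only [hd.ZZ_cyclic, LocalMetric.tr_zero]
    simp only [LocalMetric.tr_add] at e
    have e1 := m.tr_swap fun a c => d a (slotZ b) (slotZ c)
    simp only [hd.symm _ (slotZ b)] at e1
    have e2 := m.tr_swap fun a c => d b (slotZ a) (slotZ c)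
    have e3 := hd.ZZ_tr b
    simp only [hd.symm _ (slotZ b)] at e ⊢
    linarith
  have h4 : m.tr m.g = n := m.tr_g
  rw [h2, h3, h4] at h1
  have h5 : ((n : ℝ) + 2) * d b slotY slotX = 0 := by linarith
  have : (n : ℝ) + 2 ≠ 0 := by positivity
  exact (mul_eq_zero.1 h5).resolve_left this

/-- The equation expresses twice the unknown through two of its index permutations, and the cyclic
identity turns their sum into minus the unknown. -/
lemma ZZ_eq_zero (hd : IsCoexact m d)
    (hN : ∀ a b c, N a b slotY (slotZ c) = - d b (slotZ a) (slotZ c))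
    (hs : ∀ a b B C, N a b B C = N a b C B)
    (h : ∀ b, codiff G (fun a b => N a b - N b a) b = 0) (b c e : Fin n) :
    d b (slotZ c) (slotZ e) = 0 := by
  have h1 := congrFun (congrFun (h b) (slotZ c)) (slotZ e)
  rw [codiff_ZZ] at h1
  simp only [Pi.sub_apply, Pi.zero_apply, hN, hs _ _ (slotZ _) slotY] at h1
  linarith [hd.ZZ_cyclic b c e, hd.symm b (slotZ c) (slotZ e), hd.symm c (slotZ e) (slotZ b)]

lemma ZX_eq_zero (hn : 3 ≤ n) (hd : IsCoexact m d) (hG : ∀ a b, m.gi a b = G⁻¹ a b)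
    (hN : ∀ a b, N a b slotY slotX = - d b (slotZ a) slotX)
    (hN' : ∀ a b c p, N a b (slotZ c) (slotZ p)
      = m.g a c * d b (slotZ p) slotX + m.g a p * d b (slotZ c) slotX)
    (h : ∀ b, codiff G (fun a b => N a b - N b a) b = 0) (b c : Fin n) :
    d b (slotZ c) slotX = 0 := by
  have key : ∀ b c, d c (slotZ b) slotX = (n + 1) * d b (slotZ c) slotX := by
    intro b c
    have h1 := congrFun (congrFun (h b) (slotZ c)) slotX
    rw [codiff_ZX m hG] at h1
    simp only [Pi.sub_apply, Pi.zero_apply, hN, hN', LocalMetric.tr_sub, LocalMetric.tr_add,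
      LocalMetric.tr_mul_right, LocalMetric.tr_mul_left, m.tr_g_mul, hd.ZX_tr] at h1
    have h2 : m.tr (fun a p => m.g b p * d a (slotZ c) slotX) = d b (slotZ c) slotX := by
      rw [← m.tr_swap]; exact m.tr_g_mul' b fun a => d a (slotZ c) slotX
    have h4 : m.tr m.g = n := m.tr_g
    rw [h2, h4] at h1
    linarith
  have h2 : ((n : ℝ) * (n + 2)) * d b (slotZ c) slotX = 0 := by
    linear_combination -key c b - ((n : ℝ) + 1) * key b c
  have : (n : ℝ) * (n + 2) ≠ 0 := by positivity
  exact (mul_eq_zero.1 h2).resolve_left this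

end IsCoexact

/-- Skewing g_{ac} d_b and tracing leaves n - 1 times the unknown. -/
lemma XX_eq_zero (hn : 3 ≤ n) {d : Fin n → ℝ} {N : Fin n → Fin n → Tractor₂ n}
    (hG : ∀ a b, m.gi a b = G⁻¹ a b)
    (hN : ∀ a b c, N a b (slotZ c) slotX = m.g a c * d b)
    (hs : ∀ a b B C, N a b B C = N a b C B)
    (h : ∀ b, codiff G (fun a b => N a b - N b a) b = 0) (b : Fin n) : d b = 0 := by
  have h1 := congrFun (congrFun (h b) slotX) slotX
  rw [codiff_XX m hG fun a b B C => by simp only [Pi.sub_apply, hs _ _ B C]] at h1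
  simp only [Pi.sub_apply, Pi.zero_apply, hN, LocalMetric.tr_sub, LocalMetric.tr_mul_right] at h1
  have h2 : m.tr (fun a p => m.g b p * d a) = d b := by
    rw [← m.tr_swap]; exact m.tr_g_mul' b d
  have h4 : m.tr m.g = n := m.tr_g
  rw [h2, h4] at h1
  have h5 : ((n : ℝ) - 1) * d b = 0 := by linarith
  have : (3 : ℝ) ≤ n := by exact_mod_cast hn
  exact (mul_eq_zero.1 h5).resolve_left (by linarith)

end Slots

/-! ### Uniqueness of the prolongation connection -/

section Uniqueness

variable {n : ℕ} {g : MetricMatrix n} {U : Set (Coord n)}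
  {V : Matrix (Fin n) (Fin n) ℝ → Submodule ℝ (Tractor₂ n)}

/-- The properties of the bundle with fibres `V (g y)` used below. -/
structure IsTractorSubbundle (g : MetricMatrix n) (U : Set (Coord n))
    (V : Matrix (Fin n) (Fin n) ℝ → Submodule ℝ (Tractor₂ n)) : Prop where
  traceFree_le : ∀ G, traceFreeSymTractors G ≤ V G
  symm : ∀ G, ∀ f ∈ V G, ∀ B C, f B C = f C B
  exists_section : ∀ y ∈ U, ∀ f ∈ V (g y), ∃ F, IsSectionOn g V U F ∧ F y = f
  tractorNabla : ∀ F, IsSectionOn g V U F → ∀ a, IsSectionOn g V U (tractorNabla g a F)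

/-- The metric at a point of `U`. -/
def IsMetricOn.atPoint (hg : IsMetricOn g U) {y : Coord n} (hy : y ∈ U) : LocalMetric n ℝ :=
  pointMetric (g y) (hg.symm y hy) (hg.isUnit y hy)

lemma IsSectionOn.add {F F' : Coord n → Tractor₂ n} (hF : IsSectionOn g V U F)
    (hF' : IsSectionOn g V U F') : IsSectionOn g V U (F + F') :=
  ⟨fun B C => (hF.1 B C).add (hF'.1 B C), fun y hy => (V (g y)).add_mem (hF.2 y hy) (hF'.2 y hy)⟩

/-- Smoothness of φ is known on constant tractors only, so the section is expanded in the constant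
basis with smooth coefficients. -/
lemma IsEndFormOn.isSectionOn {φ : EndForm n} (hφ : IsEndFormOn g V U φ)
    {F : Coord n → Tractor₂ n} (hF : IsSectionOn g V U F) (a : Fin n) :
    IsSectionOn g V U (fun y => φ a y (F y)) := by
  refine ⟨fun B C => ?_, fun y hy => hφ.2 a y hy _ (hF.2 y hy)⟩
  have h : ∀ y, φ a y (F y) B C
      = ∑ P, ∑ Q, F y P Q * φ a y (Pi.single P (Pi.single Q 1)) B C := by
    intro y
    have e : F y = ∑ P, ∑ Q, F y P Q • Pi.single P (Pi.single Q (1 : ℝ)) := by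
      funext B' C'
      simp only [Finset.sum_apply, Pi.smul_apply, Pi.single_apply, apply_ite]
      simp [Pi.single_apply, apply_ite (fun f : TIdx n → ℝ => f C')]
    conv_lhs => rw [e]
    simp only [map_sum, map_smul, Finset.sum_apply, Pi.smul_apply, smul_eq_mul]
  simp only [h]
  exact ContDiffOn.sum fun P _ => ContDiffOn.sum fun Q _ => (hF.1 P Q).mul (hφ.1 _ _ _ _)

lemma tractorNabla_sub {F F' : Coord n → Tractor₂ n} {y : Coord n}
    (hF : ∀ B C, DifferentiableAt ℝ (fun z => F z B C) y)
    (hF' : ∀ B C, DifferentiableAt ℝ (fun z => F' z B C) y) (a : Fin n) :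
    tractorNabla g a (fun z => F z - F' z) y = tractorNabla g a F y - tractorNabla g a F' y := by
  funext B C
  simp only [tractorNabla, Pi.sub_apply, pd_sub (hF B C) (hF' B C), mul_sub,
    Finset.sum_sub_distrib]
  ring

lemma tractorNabla_symm {F : Coord n → Tractor₂ n} (hF : ∀ z ∈ U, ∀ B C, F z B C = F z C B)
    (hU : IsOpen U) {y : Coord n} (hy : y ∈ U) (a : Fin n) (B C : TIdx n) :
    tractorNabla g a F y B C = tractorNabla g a F y C B := by
  simp only [tractorNabla, pd_congr hU (fun z hz => hF z hz B C) hy, hF y hy _ C, hF y hy B _]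
  ring

lemma codiff_sub (G : Matrix (Fin n) (Fin n) ℝ) (K K' : Fin n → Fin n → Tractor₂ n) (b : Fin n) :
    codiff G (fun a b => K a b - K' a b) b = codiff G K b - codiff G K' b := by
  funext B C
  simp only [codiff_apply, Pi.sub_apply, mul_sub, Finset.sum_sub_distrib]
  ring

lemma pd_eq_zero (hU : IsOpen U) {f : Coord n → ℝ} (h : ∀ z ∈ U, f z = 0) {y : Coord n}
    (hy : y ∈ U) (a : Fin n) : pd a f y = 0 := by
  rw [pd_congr hU h hy]
  simp [pd]

/-- The difference of the two modifications is shown to vanish slot by slot in order of increasing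
degree. The curvature condition concerns sections, so every vector of a fibre is first extended to
one. -/
theorem IsProlongation.unique (hn : 3 ≤ n) (hg : IsMetricOn g U) (hV : IsTractorSubbundle g U V)
    {φ φ' : EndForm n} (hφ : IsProlongation g V U φ) (hφ' : IsProlongation g V U φ') :
    ∀ b, ∀ y ∈ U, ∀ f ∈ V (g y), φ b y f = φ' b y f := by
  set δ : EndForm n := fun b y => φ b y - φ' b y with hδ
  have hcoex : ∀ y, ∀ hy : y ∈ U, ∀ f ∈ V (g y), IsCoexact (hg.atPoint hy) (fun b => δ b y f) := by
    intro y hy f hf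
    obtain ⟨K, hK, hKs, hK'⟩ := hφ.2.2.1 y hy f hf
    obtain ⟨L, hL, hLs, hL'⟩ := hφ'.2.2.1 y hy f hf
    have e : (fun b => δ b y f) = codiff (g y) (fun a b => K a b - L a b) := by
      funext b
      rw [codiff_sub, ← hK', ← hL']; rfl
    rw [e]
    refine isCoexact_codiff _ (fun _ _ => rfl) (fun a b B C => ?_) (fun a b => ?_)
    · simp only [Pi.sub_apply, hV.symm _ _ (hK a b) B C, hV.symm _ _ (hL a b) B C]
    · rw [hKs a b, hLs a b]; abel
  have hδV : ∀ y ∈ U, ∀ f ∈ V (g y), ∀ b, δ b y f ∈ V (g y) := fun y hy f hf b =>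
    (V (g y)).sub_mem (hφ.1.2 b y hy f hf) (hφ'.1.2 b y hy f hf)
  -- N is the difference of the two second covariant derivatives, arranged so that δ stands in every
  -- summand; its skew part is the difference of curvatures.
  set N : (Coord n → Tractor₂ n) → Coord n → Fin n → Fin n → Tractor₂ n := fun F y a b =>
    tractorNabla g a (fun z => δ b z (F z)) y + δ a y (modNabla g φ b F y)
      + φ' a y (δ b y (F y)) with hNdef
  have hmod : ∀ {φ : EndForm n}, IsProlongation g V U φ → ∀ F, IsSectionOn g V U F → ∀ b,
      IsSectionOn g V U (modNabla g φ b F) := fun hφ F hF b =>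
    (hV.tractorNabla F hF b).add (hφ.1.isSectionOn hF b)
  have hsec : ∀ F, IsSectionOn g V U F → ∀ b, ∀ z ∈ U, δ b z (F z) ∈ V (g z) :=
    fun F hF b z hz => hδV z hz _ (hF.2 z hz) b
  have hNs : ∀ F, IsSectionOn g V U F → ∀ y ∈ U, ∀ a b B C, N F y a b B C = N F y a b C B := by
    intro F hF y hy a b B C
    simp only [hNdef, Pi.add_apply]
    rw [tractorNabla_symm (fun z hz => hV.symm _ _ (hsec F hF b z hz)) hg.isOpen hy,
      hV.symm _ _ (hδV y hy _ ((hmod hφ F hF b).2 y hy) a) B C,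
      hV.symm _ _ (hφ'.1.2 a y hy _ (hsec F hF b y hy)) B C]
  have hN : ∀ F, IsSectionOn g V U F → ∀ y ∈ U, ∀ b,
      codiff (g y) (fun a b => N F y a b - N F y b a) b = 0 := by
    intro F hF y hy b
    have e : (fun a b => N F y a b - N F y b a)
        = fun a b => modCurvature g φ F y a b - modCurvature g φ' F y a b := by
      have e' : ∀ a b, N F y a b = modNabla g φ a (modNabla g φ b F) y
          - modNabla g φ' a (modNabla g φ' b F) y := by
        intro a b
        have hd : ∀ {φ : EndForm n}, IsProlongation g V U φ → ∀ B C,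
            DifferentiableAt ℝ (fun z => modNabla g φ b F z B C) y := fun hφ B C =>
          differentiableAt_of_contDiffOn hg.isOpen ((hmod hφ F hF b).1 B C) hy
        have hb : ∀ z, δ b z (F z) = modNabla g φ b F z - modNabla g φ' b F z := fun z => by
          simp only [hδ, modNabla, LinearMap.sub_apply]; abel
        simp only [hNdef, hb, tractorNabla_sub (hd hφ) (hd hφ'), map_sub]
        simp only [hδ, LinearMap.sub_apply]
        rw [modNabla.eq_1 g φ a, modNabla.eq_1 g φ' a]
        abel
      funext a b
      rw [e', e', modCurvature, modCurvature]
      abel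
    rw [e, codiff_sub, hφ.2.2.2 F hF y hy b, hφ'.2.2.2 F hF y hy b, sub_zero]
  -- Homogeneity of degree at least one compensates the degree -1 of TM, so Φ' preserves the
  -- filtration and Φ'δF has no component below those of δF.
  have hfil : ∀ i, ∀ y ∈ U, ∀ f ∈ V (g y), ∀ a, InFiltration i f → InFiltration i (φ' a y f) := by
    intro i y hy f hf a h
    have := hφ'.2.1 a y hy i f hf h
    rwa [sub_add_cancel] at this
  have hYY : ∀ y ∈ U, ∀ f ∈ V (g y), ∀ b, δ b y f slotY slotY = 0 :=
    fun y hy f hf b => (hcoex y hy f hf).YY b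
  have hφ'YY : ∀ y ∈ U, ∀ f ∈ V (g y), ∀ b, φ' b y f slotY slotY = 0 := by
    intro y hy f hf b
    obtain ⟨L, -, -, hL⟩ := hφ'.2.2.1 y hy f hf
    rw [hL, codiff_YY]
  have hδs : ∀ y ∈ U, ∀ f ∈ V (g y), ∀ b B C, δ b y f B C = δ b y f C B :=
    fun y hy f hf b => hV.symm _ _ (hδV y hy f hf b)
  have hYZ : ∀ y ∈ U, ∀ f ∈ V (g y), ∀ b c, δ b y f slotY (slotZ c) = 0 := by
    intro y hy f hf
    obtain ⟨F, hF, rfl⟩ := hV.exists_section y hy f hf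
    refine (hcoex y hy _ hf).YZ_eq_zero (N := N F y) (fun a b => ?_) (hN F hF y hy)
    -- The YY slot of δ is identically zero on U, so its derivative and its value on ∇̃F drop out;
    -- only the algebraic part of ∇ remains. The later slots follow the same pattern.
    simp only [hNdef, Pi.add_apply, hYY y hy _ ((hmod hφ F hF b).2 y hy),
      hφ'YY y hy _ (hsec F hF b y hy), tractorNabla,
      pd_eq_zero hg.isOpen (fun z hz => hYY z hz _ (hF.2 z hz) b) hy, sum_tractorIndex,
      tractorForm, hδs y hy _ hf b (slotZ _) slotY]
    simp
    ring
  have hfil₀ : ∀ y ∈ U, ∀ f ∈ V (g y), ∀ b, InFiltration 0 (δ b y f) := by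
    intro y hy f hf b B C h
    rcases B with _ | c | _ <;> rcases C with _ | d | _ <;> simp [slotDegree] at h
    · exact hYY y hy f hf b
    · exact hYZ y hy f hf b d
    · exact (hδs y hy f hf b _ _).trans (hYZ y hy f hf b c)
  have hNYZ : ∀ y, ∀ hy : y ∈ U, ∀ F, IsSectionOn g V U F → ∀ a b c, N F y a b slotY (slotZ c)
      = - δ b y (F y) (slotZ a) (slotZ c) + (hg.atPoint hy).g a c * δ b y (F y) slotY slotX := by
    intro y hy F hF a b c
    have h := hfil 0 y hy _ (hsec F hF b y hy) a (hfil₀ y hy _ (hF.2 y hy) b) slotY (slotZ c)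
      (by simp [slotDegree])
    simp only [hNdef, Pi.add_apply, h, hYZ y hy _ ((hmod hφ F hF b).2 y hy), tractorNabla,
      pd_eq_zero hg.isOpen (fun z hz => hYZ z hz _ (hF.2 z hz) b c) hy, sum_tractorIndex,
      tractorForm, hYY y hy _ (hF.2 y hy), hYZ y hy _ (hF.2 y hy)]
    simp [IsMetricOn.atPoint, pointMetric]
  have hYX : ∀ y ∈ U, ∀ f ∈ V (g y), ∀ b, δ b y f slotY slotX = 0 := by
    intro y hy f hf
    obtain ⟨F, hF, rfl⟩ := hV.exists_section y hy f hf
    exact (hcoex y hy _ hf).YX_eq_zero (fun _ _ => rfl) (hNYZ y hy F hF) (hN F hF y hy)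
  have hZZ : ∀ y ∈ U, ∀ f ∈ V (g y), ∀ b c d, δ b y f (slotZ c) (slotZ d) = 0 := by
    intro y hy f hf
    obtain ⟨F, hF, rfl⟩ := hV.exists_section y hy f hf
    refine (hcoex y hy _ hf).ZZ_eq_zero (fun a b c => ?_) (hNs F hF y hy) (hN F hF y hy)
    rw [hNYZ y hy F hF, hYX y hy _ hf, mul_zero, add_zero]
  have hfil₁ : ∀ y ∈ U, ∀ f ∈ V (g y), ∀ b, InFiltration 1 (δ b y f) := by
    intro y hy f hf b B C h
    rcases B with _ | c | _ <;> rcases C with _ | d | _ <;> simp [slotDegree] at h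
    · exact hYY y hy f hf b
    · exact hYZ y hy f hf b d
    · exact hYX y hy f hf b
    · exact (hδs y hy f hf b _ _).trans (hYZ y hy f hf b c)
    · exact hZZ y hy f hf b c d
    · exact (hδs y hy f hf b _ _).trans (hYX y hy f hf b)
  have hZX : ∀ y ∈ U, ∀ f ∈ V (g y), ∀ b c, δ b y f (slotZ c) slotX = 0 := by
    intro y hy f hf
    obtain ⟨F, hF, rfl⟩ := hV.exists_section y hy f hf
    have h := fun b a => hfil 1 y hy _ (hsec F hF b y hy) a (hfil₁ y hy _ (hF.2 y hy) b)
    refine (hcoex y hy _ hf).ZX_eq_zero hn (N := N F y) (fun _ _ => rfl) (fun a b => ?_)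
      (fun a b c p => ?_) (hN F hF y hy)
    · simp only [hNdef, Pi.add_apply, h b a slotY slotX (by simp [slotDegree]),
        hYX y hy _ ((hmod hφ F hF b).2 y hy), tractorNabla,
        pd_eq_zero hg.isOpen (fun z hz => hYX z hz _ (hF.2 z hz) b) hy, sum_tractorIndex,
        tractorForm, hYY y hy _ (hF.2 y hy), hYZ y hy _ (hF.2 y hy)]
      simp
    · simp only [hNdef, Pi.add_apply, h b a (slotZ c) (slotZ p) (by simp [slotDegree]),
        hZZ y hy _ ((hmod hφ F hF b).2 y hy), tractorNabla,
        pd_eq_zero hg.isOpen (fun z hz => hZZ z hz _ (hF.2 z hz) b c p) hy, sum_tractorIndex,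
        tractorForm, hZZ y hy _ (hF.2 y hy), hYZ y hy _ (hF.2 y hy),
        hδs y hy _ hf b (slotZ _) slotY, hδs y hy _ hf b slotX (slotZ _)]
      simp [IsMetricOn.atPoint, pointMetric]
  have hfil₂ : ∀ y ∈ U, ∀ f ∈ V (g y), ∀ b, InFiltration 2 (δ b y f) := by
    intro y hy f hf b B C h
    rcases B with _ | c | _ <;> rcases C with _ | d | _
    · exact hYY y hy f hf b
    · exact hYZ y hy f hf b d
    · exact hYX y hy f hf b
    · exact (hδs y hy f hf b _ _).trans (hYZ y hy f hf b c)
    · exact hZZ y hy f hf b c d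
    · exact hZX y hy f hf b c
    · exact (hδs y hy f hf b _ _).trans (hYX y hy f hf b)
    · exact (hδs y hy f hf b _ _).trans (hZX y hy f hf b d)
    · simp [slotDegree] at h
  have hXX : ∀ y ∈ U, ∀ f ∈ V (g y), ∀ b, δ b y f slotX slotX = 0 := by
    intro y hy f hf
    obtain ⟨F, hF, rfl⟩ := hV.exists_section y hy f hf
    have h := fun b a => hfil 2 y hy _ (hsec F hF b y hy) a (hfil₂ y hy _ (hF.2 y hy) b)
    refine XX_eq_zero (hg.atPoint hy) hn (N := N F y) (fun _ _ => rfl) (fun a b c => ?_)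
      (hNs F hF y hy) (hN F hF y hy)
    simp only [hNdef, Pi.add_apply, h b a (slotZ c) slotX (by simp [slotDegree]),
      hZX y hy _ ((hmod hφ F hF b).2 y hy), tractorNabla,
      pd_eq_zero hg.isOpen (fun z hz => hZX z hz _ (hF.2 z hz) b c) hy, sum_tractorIndex,
      tractorForm, hZZ y hy _ (hF.2 y hy), hYX y hy _ (hF.2 y hy), hZX y hy _ (hF.2 y hy)]
    simp [IsMetricOn.atPoint, pointMetric]
  intro b y hy f hf
  have h0 : δ b y f = 0 := by
    funext B C
    by_cases h : slotDegree B + slotDegree C < 2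
    · exact hfil₂ y hy f hf b B C h
    · rcases B with _ | c | _ <;> rcases C with _ | d | _ <;> simp [slotDegree] at h
      exact hXX y hy f hf b
  exact sub_eq_zero.1 h0

end Uniqueness

namespace LocalMetric

variable {n : ℕ} {R : Type*} [CommRing R] [Algebra ℝ R] (m : LocalMetric n R)

/-- The tensors are skew in the first two indices and symmetrised in the next two, so the six terms
cancel in pairs. -/
lemma modZZ_cyclic (s : R) (μ : Fin n → R) (b c d : Fin n) :
    m.modZZ s μ b c d + m.modZZ s μ c d b + m.modZZ s μ d b c = 0 := by
  have h : ∑ q, m.weylS b c d q * m.up μ q + ∑ q, m.weylS c d b q * m.up μ q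
      + ∑ q, m.weylS d b c q * m.up μ q = 0 := by
    simp only [← Finset.sum_add_distrib]
    refine Finset.sum_eq_zero fun q _ => ?_
    simp only [weylS]
    linear_combination (m.weyl_skew b c d q + m.weyl_skew b d c q + m.weyl_skew c d b q)
      * m.up μ q
  simp only [modZZ, cottonS]
  linear_combination (-m.third) * h
    - m.third * s * (m.cotton_skew b c d + m.cotton_skew b d c + m.cotton_skew c d b)

/-- The tractor metric is parallel. -/
lemma trace_tnab {F : TIdx n → TIdx n → R} (hF : ∀ B C, F B C = F C B) (a : Fin n) :
    2 * m.tnab a F slotY slotX + m.tr (fun c d => m.tnab a F (slotZ c) (slotZ d))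
      = m.D a (2 * F slotY slotX + m.tr fun c d => F (slotZ c) (slotZ d)) := by
  have h1 : m.tr (fun c d => m.P a d * F (slotZ c) slotY)
      = ∑ b, m.up (m.P a) b * F slotY (slotZ b) := by
    rw [sum_up_mul, ← tr_mul_eq_up, ← tr_swap]
    exact m.tr_congr fun c d => by rw [hF slotY]
  have h2 : m.tr (fun c d => m.P a c * F slotY (slotZ d))
      = ∑ b, m.up (m.P a) b * F slotY (slotZ b) := by
    rw [sum_up_mul, ← tr_mul_eq_up]
  have h3 : m.tr (fun c d => m.g a d * F (slotZ c) slotX) = F (slotZ a) slotX := by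
    rw [← tr_swap]; exact m.tr_g_mul' a fun c => F (slotZ c) slotX
  have h4 : m.tr (fun c d => m.g a c * F slotX (slotZ d)) = F (slotZ a) slotX := by
    rw [m.tr_g_mul' a fun c => F slotX (slotZ c), hF]
  simp only [tnab_ZZ, tnab_YX, tr_add, h1, h2, h3, h4, map_add, D_tr, two_mul]
  ring

end LocalMetric

/-! ### The image of the codifferential -/

section Image

variable {n : ℕ} (m : LocalMetric n ℝ) {G : Matrix (Fin n) (Fin n) ℝ}

lemma sum_hUp_mul (G : Matrix (Fin n) (Fin n) ℝ) (f : Tractor₂ n) :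
    ∑ B, ∑ C, hUp G B C * f B C
      = f slotY slotX + ∑ c, ∑ d, G⁻¹ c d * f (slotZ c) (slotZ d) + f slotX slotY := by
  simp [hUp]
  ring

/-- The components of a symmetric 2-tractor with vanishing `Y Y` and `X X` slots. -/
def symTractor (μ : Fin n → ℝ) (ρ : ℝ) (w : Fin n → Fin n → ℝ) (ν : Fin n → ℝ) : Tractor₂ n
  | Sum.inl _, Sum.inr (Sum.inl c) => μ c
  | Sum.inr (Sum.inl c), Sum.inl _ => μ c
  | Sum.inl _, Sum.inr (Sum.inr _) => ρ
  | Sum.inr (Sum.inr _), Sum.inl _ => ρ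
  | Sum.inr (Sum.inl c), Sum.inr (Sum.inl d) => w c d
  | Sum.inr (Sum.inl c), Sum.inr (Sum.inr _) => ν c
  | Sum.inr (Sum.inr _), Sum.inr (Sum.inl c) => ν c
  | _, _ => 0

lemma symTractor_symm {μ : Fin n → ℝ} {ρ : ℝ} {w : Fin n → Fin n → ℝ} {ν : Fin n → ℝ}
    (hw : ∀ c d, w c d = w d c) (B C : TIdx n) :
    symTractor μ ρ w ν B C = symTractor μ ρ w ν C B := by
  rcases B with _ | c | _ <;> rcases C with _ | d | _ <;> simp [symTractor]
  exact hw c d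

/-- The codifferential is inverted explicitly, slot by slot, by an ansatz linear in f; the trace and
cyclic hypotheses are what makes the ansatz consistent. The preimage is trace-free, so it serves for
both bundles. -/
lemma exists_eq_codiff (hn : 3 ≤ n) (hG : ∀ a b, m.gi a b = G⁻¹ a b) {f : Fin n → Tractor₂ n}
    (hs : ∀ b B C, f b B C = f b C B) (hYY : ∀ b, f b slotY slotY = 0)
    (hYZ : ∀ b c, f b slotY (slotZ c) = 0) (hYX : ∀ b, f b slotY slotX = 0)
    (hcyc : ∀ b c d, f b (slotZ c) (slotZ d) + f c (slotZ d) (slotZ b)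
      + f d (slotZ b) (slotZ c) = 0)
    (htr : ∀ b, m.tr (fun c d => f b (slotZ c) (slotZ d)) = 0)
    (htr' : ∀ b, m.tr (fun a c => f a (slotZ b) (slotZ c)) = 0)
    (hZX : m.tr (fun b c => f b (slotZ c) slotX) = 0) :
    ∃ ψ : Fin n → Fin n → Tractor₂ n, (∀ a b, ψ a b ∈ traceFreeSymTractors G) ∧
      (∀ a b, ψ a b = - ψ b a) ∧ ∀ b, f b = codiff G ψ b := by
  have hn3 : (3 : ℝ) ≤ n := by exact_mod_cast hn
  have hn0 : (n : ℝ) ≠ 0 := by positivity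
  have hn2 : (n : ℝ) + 2 ≠ 0 := by positivity
  have hn1 : (n : ℝ) - 1 ≠ 0 := by linarith
  -- On trace-free S the ZX slot of ∂^* is S_{cb} - (n + 1)S_{bc}; inverting this brings in 1 - (n +
  -- 1)² = -n(n + 2).
  obtain ⟨β, hβ⟩ : ∃ β : ℝ, β * (n * (n + 2)) = -1 := ⟨-1 / (n * (n + 2)), by field_simp⟩
  -- The XX slot of ∂^* is -2 times a trace, and that trace is (n - 1)κ times the given component.
  obtain ⟨κ, hκ⟩ : ∃ κ : ℝ, κ * (n - 1) = - (1 / 2) := ⟨- (1 / 2) / (n - 1), by field_simp⟩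
  set S : Fin n → Fin n → ℝ := fun a b =>
    (n + 1) * β * f a (slotZ b) slotX + β * f b (slotZ a) slotX with hS
  have hStr : m.tr S = 0 := by
    have h : m.tr (fun a b => f b (slotZ a) slotX) = 0 := by
      rw [← hZX]; exact m.tr_swap fun b c => f b (slotZ c) slotX
    simp only [hS, LocalMetric.tr_add, LocalMetric.tr_mul_left, hZX, h, mul_zero, add_zero]
  -- The 1/3 in the YZ slot inverts a symmetrisation on tensors with vanishing cyclic sum; the YX
  -- slot is chosen to cancel the trace of the ZZ slot.
  set ψ : Fin n → Fin n → Tractor₂ n := fun a b => symTractor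
    (fun c => -(1 / 3) * (f a (slotZ b) (slotZ c) - f b (slotZ a) (slotZ c)))
    (S a b - S b a)
    (fun c d => m.g a c * S b d + m.g a d * S b c - m.g b c * S a d - m.g b d * S a c)
    (fun c => κ * (m.g a c * f b slotX slotX - m.g b c * f a slotX slotX)) with hψ
  have hψs : ∀ a b B C, ψ a b B C = ψ a b C B := fun a b =>
    symTractor_symm fun c d => by ring
  have hg1 : ∀ a (k : Fin n → ℝ), m.tr (fun c d => m.g a c * k d) = k a := m.tr_g_mul'
  have hg2 : ∀ a (k : Fin n → ℝ), m.tr (fun c d => m.g a d * k c) = k a := fun a k => by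
    rw [← m.tr_swap]; exact m.tr_g_mul' a k
  have hg3 : ∀ a (k : Fin n → ℝ), m.tr (fun c d => m.g c a * k d) = k a := m.tr_g_mul
  have hg4 : ∀ k, m.tr (fun a p => m.g a p * k) = n * k := fun k => by
    rw [m.tr_mul_right]; exact congrArg (· * k) m.tr_g
  refine ⟨ψ, fun a b => ⟨hψs a b, ?_⟩, fun a b => ?_, fun b => ?_⟩
  · rw [sum_hUp_mul]
    have : ∑ c, ∑ d, G⁻¹ c d * ψ a b (slotZ c) (slotZ d)
        = m.tr fun c d => ψ a b (slotZ c) (slotZ d) := by simp only [LocalMetric.tr, hG]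
    rw [this]
    simp only [hψ, symTractor, LocalMetric.tr_add, LocalMetric.tr_sub, hg1, hg2]
    ring
  · funext B C
    rcases B with _ | c | _ <;> rcases C with _ | d | _ <;> simp [hψ, symTractor] <;> ring
  · have h1 : ∀ c, f b slotY (slotZ c) = codiff G ψ b slotY (slotZ c) := fun c => by
      rw [codiff_YZ, hYZ]; rfl
    have h2 : f b slotY slotX = codiff G ψ b slotY slotX := by
      rw [codiff_YX m hG, hYX]
      simp only [hψ, symTractor, LocalMetric.tr_mul_left, LocalMetric.tr_sub, htr, htr']
      ring
    have h3 : ∀ c, f b (slotZ c) slotX = codiff G ψ b (slotZ c) slotX := fun c => by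
      rw [codiff_ZX m hG]
      simp only [hψ, symTractor, LocalMetric.tr_add, LocalMetric.tr_sub, hg2, hg3, hg4,
        LocalMetric.tr_mul_left]
      rw [show m.tr (fun a p => S a p) = 0 from hStr]
      simp only [hS]
      linear_combination (f b (slotZ c) slotX) * hβ
    have hc := codiff_symm (G := G) hψs b
    funext B C
    rcases B with _ | c | _ <;> rcases C with _ | d | _
    · exact (hYY b).trans (codiff_YY ψ b).symm
    · exact h1 d
    · exact h2
    · exact (hs _ _ _).trans ((h1 c).trans (hc _ _))
    · change f b (slotZ c) (slotZ d) = codiff G ψ b (slotZ c) (slotZ d)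
      rw [codiff_ZZ]
      simp only [hψ, symTractor]
      linarith [hcyc b c d, hs b (slotZ c) (slotZ d), hs c (slotZ d) (slotZ b)]
    · exact h3 c
    · exact (hs _ _ _).trans (h2.trans (hc _ _))
    · exact (hs _ _ _).trans ((h3 d).trans (hc _ _))
    · change f b slotX slotX = codiff G ψ b slotX slotX
      rw [codiff_XX m hG hψs]
      simp only [hψ, symTractor, LocalMetric.tr_mul_left, LocalMetric.tr_sub, hg2, hg4]
      linear_combination (2 * f b slotX slotX) * hκ

end Image

/-! ### The modification defines the prolongation connection -/

namespace IsMetricOn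

variable {n : ℕ} {g : MetricMatrix n} {U : Set (Coord n)} (hg : IsMetricOn g U) {y : Coord n}
  {V : Matrix (Fin n) (Fin n) ℝ → Submodule ℝ (Tractor₂ n)}

lemma atPoint_tr (hy : y ∈ U) (T : Fin n → Fin n → smoothOn U) :
    (hg.atPoint hy).tr (fun a b => smoothEval y (T a b)) = smoothEval y (hg.toLocal.tr T) := by
  rw [hg.eval_tr _ hy]; rfl

/-- The components of a section over the ring of smooth functions. -/
def lift {F : Coord n → Tractor₂ n} (hF : ∀ B C, ContDiffOn ℝ ∞ (fun y => F y B C) U)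
    (B C : TIdx n) : smoothOn U := smoothLift (hF B C)

lemma eval_lift {F : Coord n → Tractor₂ n} (hF : ∀ B C, ContDiffOn ℝ ∞ (fun y => F y B C) U)
    (hy : y ∈ U) (B C : TIdx n) : smoothEval y (lift hF B C) = F y B C :=
  smoothEval_lift (hF B C) hy

lemma lift_symm {F : Coord n → Tractor₂ n} (hF : ∀ B C, ContDiffOn ℝ ∞ (fun y => F y B C) U)
    (hs : ∀ y ∈ U, ∀ B C, F y B C = F y C B) (B C : TIdx n) : lift hF B C = lift hF C B :=
  smoothLift_congr _ _ fun y hy => hs y hy B C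

lemma modAct_Y (a : Fin n) (y : Coord n) (f : Tractor₂ n) (C : TIdx n) :
    hg.modAct a y f slotY C = 0 := by
  rcases C with _ | d | _ <;> simp [modAct, LocalMetric.modif]

lemma modAct_mem (hn : 3 ≤ n) (a : Fin n) (hy : y ∈ U) (f : Tractor₂ n) :
    hg.modAct a y f ∈ traceFreeSymTractors (g y) := by
  refine ⟨hg.modAct_symm a y f, ?_⟩
  rw [sum_hUp_mul, hg.modAct_symm a y f slotX, modAct_Y]
  have : ∑ c, ∑ d, (g y)⁻¹ c d * hg.modAct a y f (slotZ c) (slotZ d) = 0 :=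
    (hg.eval_tr (fun c d => hg.toLocal.modZZ _ _ a c d) hy).symm.trans
      ((congrArg _ (hg.toLocal.tr_modZZ₂₃ hn _ _ a)).trans (map_zero _))
  rw [this, add_zero, add_zero]

lemma modAct_isEndFormOn (hn : 3 ≤ n) (hV : IsTractorSubbundle g U V) :
    IsEndFormOn g V U hg.modAct :=
  ⟨fun a f B C => (hg.toLocal.modif a (fun B C => algebraMap ℝ _ (f B C)) B C).2,
    fun a _ hy f _ => hV.traceFree_le _ (hg.modAct_mem hn a hy f)⟩

/-- Each nonzero slot of Φ reads only slots of F of strictly smaller degree. -/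
lemma modAct_isHomogeneousOn : IsHomogeneousOn g V U 1 hg.modAct := by
  intro a y hy i f _ hf B C h
  rw [sub_add_cancel] at h
  have hYY : -2 < i → f slotY slotY = 0 := fun hi => hf _ _ (by simpa [slotDegree] using hi)
  have hYZ : -1 < i → ∀ c, f slotY (slotZ c) = 0 := fun hi c =>
    hf _ _ (by simpa [slotDegree] using hi)
  have hZZ : 0 < i → ∀ c d, f (slotZ c) (slotZ d) = 0 := fun hi c d =>
    hf _ _ (by simpa [slotDegree] using hi)
  have hY := hg.modAct_Y a y f
  have hs := hg.modAct_symm a y f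
  have hZX : 0 < i → ∀ c, hg.modAct a y f (slotZ c) slotX = 0 := fun hi c => by
    simp [modAct, LocalMetric.modif, hg.eval_modZX _ _ _ _ _ hy,
      hYY (by linarith), hYZ (by linarith), hZZ hi]
  rcases B with _ | c | _ <;> rcases C with _ | d | _
  · exact hY _
  · exact hY _
  · exact hY _
  · exact (hs _ _).trans (hY _)
  · have hi : 0 < i := by simpa [slotDegree] using h
    simp [modAct, LocalMetric.modif, hg.eval_modZZ _ _ _ _ _ hy,
      hYY (by linarith), hYZ (by linarith)]
  · have hi : 1 < i := by simpa [slotDegree] using h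
    exact hZX (by linarith) c
  · exact (hs _ _).trans (hY _)
  · have hi : 1 < i := by simpa [slotDegree] using h
    exact (hs _ _).trans (hZX (by linarith) d)
  · have hi : 2 < i := by simpa [slotDegree] using h
    simp [modAct, LocalMetric.modif, hg.eval_modXX _ _ _ _ hy,
      hYY (by linarith), hYZ (by linarith), hZZ (by linarith)]

lemma modAct_inImCodiffOn (hn : 3 ≤ n) (hV : IsTractorSubbundle g U V) :
    InImCodiffOn g V U hg.modAct := by
  intro y hy f _
  have hY := fun b => hg.modAct_Y b y f
  have hcyc : ∀ b c d, hg.modAct b y f (slotZ c) (slotZ d) + hg.modAct c y f (slotZ d) (slotZ b)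
      + hg.modAct d y f (slotZ b) (slotZ c) = 0 := fun b c d => by
    have := congrArg (smoothEval y) (hg.toLocal.modZZ_cyclic
      (algebraMap ℝ (smoothOn U) (f slotY slotY)) (fun q => algebraMap ℝ _ (f slotY (slotZ q)))
      b c d)
    rw [map_add, map_add, map_zero] at this
    exact this
  obtain ⟨ψ, h1, h2, h3⟩ := exists_eq_codiff (hg.atPoint hy) hn (G := g y) (fun _ _ => rfl)
    (f := fun b => hg.modAct b y f) (fun b => hg.modAct_symm b y f) (fun b => hY b _)
    (fun b c => hY b _) (fun b => hY b _) hcyc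
    (fun b => (hg.atPoint_tr hy fun c d => hg.toLocal.modZZ _ _ b c d).trans
      ((congrArg _ (hg.toLocal.tr_modZZ₂₃ hn _ _ b)).trans (map_zero _)))
    (fun b => (hg.atPoint_tr hy fun a c => hg.toLocal.modZZ _ _ a b c).trans
      ((congrArg _ (hg.toLocal.tr_modZZ₁₃ hn _ _ b)).trans (map_zero _)))
    ((hg.atPoint_tr hy fun a c => hg.toLocal.modZX _ _ _ a c).trans
      ((congrArg _ (hg.toLocal.tr_modZX hn _ _ _)).trans (map_zero _)))
  exact ⟨ψ, fun a b => hV.traceFree_le _ (h1 a b), h2, h3⟩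

lemma eval_modNab {F : TIdx n → TIdx n → smoothOn U} {F' : Coord n → Tractor₂ n}
    (h : ∀ z ∈ U, ∀ B C, smoothEval z (F B C) = F' z B C) (a : Fin n) (hy : y ∈ U)
    (B C : TIdx n) :
    smoothEval y (hg.toLocal.modNab a F B C) = modNabla g hg.modAct a F' y B C := by
  have e : F' y = fun B C => smoothEval y (F B C) := by
    funext B C; exact (h y hy B C).symm
  rw [modNabla, e, modAct_eval _ _ _ hy, LocalMetric.modNab, map_add,
    hg.eval_tnab h a B C hy]
  rfl

lemma eval_modCurv {F : TIdx n → TIdx n → smoothOn U} {F' : Coord n → Tractor₂ n}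
    (h : ∀ z ∈ U, ∀ B C, smoothEval z (F B C) = F' z B C) (a b : Fin n) (hy : y ∈ U)
    (B C : TIdx n) :
    smoothEval y (hg.toLocal.modCurv a b F B C) = modCurvature g hg.modAct F' y a b B C := by
  have h' := fun a => fun z (hz : z ∈ U) => hg.eval_modNab h a hz
  rw [LocalMetric.modCurv, map_sub, hg.eval_modNab (h' b) a hy, hg.eval_modNab (h' a) b hy]
  rfl

/-- The identities proved over the ring of smooth functions are evaluated at the point and fed into
`codiff_eq_zero`. -/
theorem modAct_isProlongation (hn : 3 ≤ n) (hV : IsTractorSubbundle g U V) :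
    IsProlongation g V U hg.modAct := by
  refine ⟨hg.modAct_isEndFormOn hn hV, hg.modAct_isHomogeneousOn, hg.modAct_inImCodiffOn hn hV,
    fun F hF y hy b => ?_⟩
  have hs := lift_symm hF.1 fun y hy => hV.symm _ _ (hF.2 y hy)
  have he : ∀ a b B C, modCurvature g hg.modAct F y a b B C
      = smoothEval y (hg.toLocal.modCurv a b (lift hF.1) B C) := fun a b B C =>
    (hg.eval_modCurv (fun z hz => eval_lift hF.1 hz) a b hy B C).symm
  have hcs : ∀ a b B C, hg.toLocal.modCurv a b (lift hF.1) B C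
      = hg.toLocal.modCurv a b (lift hF.1) C B := by
    have h : ∀ F : TIdx n → TIdx n → smoothOn U, (∀ B C, F B C = F C B) → ∀ a B C,
        hg.toLocal.modNab a F B C = hg.toLocal.modNab a F C B := fun F hF a B C => by
      rw [LocalMetric.modNab, LocalMetric.modNab, hg.toLocal.tnab_symm hF, hg.toLocal.modif_symm]
    intro a b B C
    rw [LocalMetric.modCurv, LocalMetric.modCurv, h _ (h _ hs b) a, h _ (h _ hs a) b]
  refine codiff_eq_zero (hg.atPoint hy) (fun _ _ => rfl) (fun a b B C => ?_) (fun a b => ?_)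
    (fun a b c => ?_) (fun a b => ?_) (fun b c => ?_) (fun b => ?_) b
  · rw [he, he, hcs]
  · rw [he, LocalMetric.modCurv_YY, map_zero]
  · rw [he, LocalMetric.modCurv_YZ, map_zero]
  · rw [he, LocalMetric.modCurv_YX _ hn hs, map_zero]
  · simp only [he, hg.atPoint_tr hy, LocalMetric.tr_modCurv_ZZ _ hn hs, map_zero]
  · simp only [he, hg.atPoint_tr hy, LocalMetric.tr_modCurv_ZX _ hn hs, map_zero]

/-! ### The bundles of symmetric and of trace-free symmetric 2-tractors -/

lemma contDiffOn_tractorNabla (hg : IsMetricOn g U) {F : Coord n → Tractor₂ n}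
    (hF : ∀ B C, ContDiffOn ℝ ∞ (fun y => F y B C) U) (a : Fin n) (B C : TIdx n) :
    ContDiffOn ℝ ∞ (fun y => tractorNabla g a F y B C) U :=
  contDiffOn_of_smoothEval fun _ hz => hg.eval_tnab (fun _ hz => eval_lift hF hz) a B C hz

lemma symTractors_isTractorSubbundle (hg : IsMetricOn g U) :
    IsTractorSubbundle g U symTractors where
  traceFree_le _ _ hf := hf.1
  symm _ _ hf := hf
  exists_section _ _ f hf := ⟨fun _ => f, ⟨fun _ _ => contDiffOn_const, fun _ _ => hf⟩, rfl⟩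
  tractorNabla _ hF a := ⟨hg.contDiffOn_tractorNabla hF.1 a,
    fun _ hy B C => tractorNabla_symm hF.2 hg.isOpen hy a B C⟩

lemma contDiffOn_trace (hg : IsMetricOn g U) (f : Tractor₂ n) :
    ContDiffOn ℝ ∞ (fun y => ∑ B, ∑ C, hUp (g y) B C * f B C) U := by
  simp only [sum_hUp_mul]
  refine (contDiffOn_const.add (ContDiffOn.sum fun c _ => ContDiffOn.sum fun d _ => ?_)).add
    contDiffOn_const
  exact (contDiffOn_inv hg c d).mul contDiffOn_const

lemma traceFreeSymTractors_isTractorSubbundle (hg : IsMetricOn g U) :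
    IsTractorSubbundle g U traceFreeSymTractors where
  traceFree_le _ _ hf := hf
  symm _ _ hf := hf.1
  exists_section y hy f hf := by
    -- A constant extension of f need not stay trace-free, as the metric varies; its trace is
    -- removed with a tractor of trace one supported in the slots YX and XY, and this correction is
    -- zero at y.
    refine ⟨fun z => f - (∑ B, ∑ C, hUp (g z) B C * f B C) •
      symTractor 0 (1 / 2) 0 0, ⟨fun B C => ?_, fun z hz => ⟨fun B C => ?_, ?_⟩⟩, ?_⟩
    · exact contDiffOn_const.sub ((hg.contDiffOn_trace f).mul contDiffOn_const)
    · simp only [Pi.sub_apply, Pi.smul_apply, hf.1 B C]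
      rw [symTractor_symm fun _ _ => rfl]
    · simp only [sum_hUp_mul]
      simp [symTractor]
      ring
    · simp only [hf.2, zero_smul, sub_zero]
  tractorNabla F hF a := by
    have hs : ∀ z ∈ U, ∀ B C, F z B C = F z C B := fun z hz => (hF.2 z hz).1
    refine ⟨hg.contDiffOn_tractorNabla hF.1 a,
      fun y hy => ⟨tractorNabla_symm hs hg.isOpen hy a, ?_⟩⟩
    have h := congrArg (smoothEval y) (hg.toLocal.trace_tnab (lift_symm hF.1 hs) a)
    have h0 : ∀ z ∈ U, smoothEval z (2 * lift hF.1 slotY slotX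
        + hg.toLocal.tr fun c d => lift hF.1 (slotZ c) (slotZ d)) = 0 := by
      intro z hz
      have := (hF.2 z hz).2
      rw [sum_hUp_mul, hs z hz slotX] at this
      rw [map_add, map_mul, hg.eval_tr _ hz, map_ofNat]
      simp only [eval_lift hF.1 hz]
      linarith
    rw [hg.eval_D a h0 hy, pd_eq_zero hg.isOpen (fun _ _ => rfl) hy, map_add, map_mul,
      hg.eval_tr _ hy, map_ofNat] at h
    simp only [hg.eval_tnab (fun _ hz => eval_lift hF.1 hz) a _ _ hy] at h
    rw [sum_hUp_mul, tractorNabla_symm hs hg.isOpen hy a slotX]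
    linarith

end IsMetricOn

/-! ### From metrics on the manifold to metric matrices in a chart -/

section Manifold

variable {n : ℕ} {M : Type*} [TopologicalSpace M] [ChartedSpace (Coord n) M]

lemma mdifferentiable_of_mem_maximalAtlas [IsManifold (𝓡 n) ∞ M]
    {e : OpenPartialHomeomorph M (Coord n)} (he : e ∈ IsManifold.maximalAtlas (𝓡 n) ∞ M) :
    e.MDifferentiable (𝓡 n) (𝓡 n) :=
  ⟨(contMDiffOn_of_mem_maximalAtlas he).mdifferentiableOn (by simp),
    (contMDiffOn_symm_of_mem_maximalAtlas he).mdifferentiableOn (by simp)⟩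

/-- The coordinate vectors are the image of a basis under the bijective differential of the inverse
chart, so a kernel vector of the matrix would be a nonzero vector orthogonal to the whole tangent
space. -/
lemma PseudoMetric.isUnit_det [IsManifold (𝓡 n) ∞ M] (g : PseudoMetric n M)
    {e : OpenPartialHomeomorph M (Coord n)} (he : e ∈ IsManifold.maximalAtlas (𝓡 n) ∞ M)
    {y : Coord n} (hy : y ∈ e.target) : IsUnit (g.matrix e y).det := by
  rw [isUnit_iff_ne_zero, Ne, ← Matrix.exists_mulVec_eq_zero_iff]
  rintro ⟨u, hu, h⟩
  set L := mfderiv (𝓡 n) (𝓡 n) e.symm y with hL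
  have hb : Function.Bijective L :=
    (mdifferentiable_of_mem_maximalAtlas he).symm.mfderiv_bijective hy
  have hsum : ∀ v : Fin n → ℝ, L (WithLp.toLp 2 v : Coord n) = ∑ b, v b • coordVec e y b := by
    intro v
    have : (WithLp.toLp 2 v : Coord n) = ∑ b, v b • EuclideanSpace.single b (1 : ℝ) := by
      ext i; simp [Pi.single_apply]
    rw [this]
    exact (map_sum L _ _).trans (Finset.sum_congr rfl fun b _ => map_smul L _ _)
  have h0 : L (WithLp.toLp 2 u : Coord n) = 0 := by
    refine g.nondegenerate _ _ fun v => ?_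
    obtain ⟨w, rfl⟩ := hb.2 v
    obtain ⟨w, rfl⟩ : ∃ v : Fin n → ℝ, (WithLp.toLp 2 v : Coord n) = w :=
      ⟨WithLp.ofLp (show Coord n from w), rfl⟩
    rw [hsum, hsum]
    simp only [map_sum, map_smul, sum_apply, smul_apply, smul_eq_mul]
    refine Finset.sum_eq_zero fun a _ => ?_
    have := congrFun h a
    simp only [Matrix.mulVec, dotProduct, PseudoMetric.matrix, Matrix.of_apply,
      Pi.zero_apply] at this
    rw [← mul_zero (w a), ← this]
    exact congrArg (w a * ·) (Finset.sum_congr rfl fun b _ => by rw [g.symm, mul_comm])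
  have h1 : (WithLp.toLp 2 u : Coord n) = 0 := hb.1 (h0.trans (map_zero L).symm)
  exact hu (by simpa using h1)

lemma PseudoMetric.isMetricOn [IsManifold (𝓡 n) ∞ M] (g : PseudoMetric n M)
    {e : OpenPartialHomeomorph M (Coord n)} (he : e ∈ IsManifold.maximalAtlas (𝓡 n) ∞ M) :
    IsMetricOn (g.matrix e) e.target where
  isOpen := e.open_target
  smooth := g.smooth e he
  symm _ _ _ _ := g.symm _ _ _
  isUnit _ hy := g.isUnit_det he hy

lemma ofComponents_add (c : ConformalStructure n M) (g : c.Scale)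
    (e : OpenPartialHomeomorph M (Coord n)) (y : Coord n) (f f' : Tractor₂ n) :
    ofComponents c g e y (f + f') = ofComponents c g e y f + ofComponents c g e y f' := by
  simp only [ofComponents, Pi.add_apply, add_smul, Finset.sum_add_distrib]

end Manifold

end ConformalProlongation
end

/-! ### The proposition -/

open ConformalProlongation in
theorem proposition4p4 {n : ℕ} (hn : 3 ≤ n) {M : Type*} [TopologicalSpace M]
    [ChartedSpace (Coord n) M] [IsManifold (𝓡 n) ∞ M]
    (c : ConformalStructure n M)
    (V : Matrix (Fin n) (Fin n) ℝ → Submodule ℝ (Tractor₂ n))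
    (hV : V = traceFreeSymTractors ∨ V = symTractors)
    (Φ : ModificationMap c) (g : c.Scale)
    (e : OpenPartialHomeomorph M (Coord n)) (he : e ∈ IsManifold.maximalAtlas (𝓡 n) ∞ M) :
    IsProlongationConnection c Φ g e V ↔
      ∀ F, IsSectionOn (g.1.matrix e) V e.target F → ∀ y ∈ e.target, ∀ a,
        modifiedConnection c Φ g e a F y =
          ofComponents c g e y (tractorNabla (g.1.matrix e) a F y
            + (2 / 3 : ℝ) • psiAct (g.1.matrix e) y a (F y)) := by
  have hg := g.1.isMetricOn he
  have hV' : IsTractorSubbundle (g.1.matrix e) e.target V := by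
    rcases hV with rfl | rfl
    · exact hg.traceFreeSymTractors_isTractorSubbundle
    · exact hg.symTractors_isTractorSubbundle
  have hpro := hg.modAct_isProlongation hn hV'
  have hact : ∀ a, ∀ y ∈ e.target, ∀ f ∈ V (g.1.matrix e y),
      hg.modAct a y f = (2 / 3 : ℝ) • psiAct (g.1.matrix e) y a f := fun a y hy f hf =>
    hg.modAct_eq_psiAct hn (hV'.symm _ f hf) a hy
  constructor
  · rintro ⟨φ, hφ, hφ'⟩ F hF y hy a
    -- Any components representing Φ agree on V with the explicit modification, by uniqueness.
    rw [modifiedConnection, hφ a y hy _ (hF.2 y hy),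
      hφ'.unique hn hg hV' hpro a y hy _ (hF.2 y hy), hact a y hy _ (hF.2 y hy), ofComponents_add]
  · intro h
    -- The explicit modification is the witness. That it represents Φ at f follows by extending f to
    -- a section and cancelling the common term ∇F in the formula for the connection.
    refine ⟨hg.modAct, fun a y hy f hf => ?_, hpro⟩
    obtain ⟨F, hF, rfl⟩ := hV'.exists_section y hy f hf
    have h' := (h F hF y hy a).trans (ofComponents_add c g e y _ _)
    refine Eq.trans (LinearMap.ext₂ fun v w => ?_)
      (congrArg (ofComponents c g e y) (hact a y hy _ hf).symm)
    exact add_left_cancel (LinearMap.congr_fun₂ h' v w)
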